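/- **Setting.** Let $\mathcal H$ be a smooth manifold, $\gamma$ a smooth symmetric two-covariant tensor, $\ell$ a smooth one-form, $\ell^{(2)}$ a smooth function and $Y$ a smooth symmetric two-covariant tensor on $\mathcal H$, such that the form $\mathcal A((W,a),(Z,b))=\gamma(W,Z)+a\,\ell(Z)+b\,\ell(W)+ab\,\ell^{(2)}$ is non-degenerate on every $T_p\mathcal H\times\mathbb R$ (*hypersurface data*). Its inverse form defines $P$, $n$, $n^{(2)}$ by $\mathcal A^\sharp((\alpha,a),(\beta,b))=P(\alpha,\beta)+a\,n(\beta)+b\,n(\alpha)+ab\,n^{(2)}$. The data are *characteristic* if $\gamma$ is positive semi-definite with $\operatorname{Rad}\gamma\ne\{0\}$ at every point, and there is a foliation function whose level sets (leaves) are all diffeomorphic; a *foliation function* is a smooth $\underline u$ with $\lambda:=n(\underline u)$ nowhere zero. Put $F=\tfrac12 d\ell$, $\Pi=Y+F$, $K=n^{(2)}Y+\tfrac12\mathcal L_n\gamma+\tfrac12(\ell\otimes dn^{(2)}+dn^{(2)}\otimes\ell)$. Let $\overline\nabla$ be the torsion-free connection determined by $$(\overline\nabla_X\gamma)(Z,W)=-\ell(Z)K(X,W)-\ell(W)K(X,Z),\qquad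 (\overline\nabla_X\ell)(Z)=Y(X,Z)+F(X,Z)-\ell^{(2)}K(X,Z),$$ with curvature $\overline R(X,W)Z=\overline\nabla_X\overline\nabla_WZ-\overline\nabla_W\overline\nabla_XZ-\overline\nabla_{[X,W]}Z$ and $\overline R^a{}_{bcd}Z^bX^cW^d=(\overline R(X,W)Z)^a$. Define (brackets: antisymmetrization with weight $\tfrac12$) $$A_{bcd}=\ell_a\overline R^a{}_{bcd}+2\ell^{(2)}\overline\nabla_{[d}K_{c]b}+K_{b[c}\overline\nabla_{d]}\ell^{(2)},\qquad B_{abcd}=\gamma_{af}\overline R^f{}_{bcd}+2\overline\nabla_{[d}(K_{c]b}\ell_a)+2\ell^{(2)}K_{b[c}K_{d]a},$$ and the *constraint tensors* $$\mathcal R_{ab}=B_{acbd}P^{cd}-(A_{bac}+A_{abc})n^c,\qquad J_b=\mathcal R_{ab}n^a,\qquad H=-\tfrac12P^{ab}\mathcal R_{ab}.$$ **Foliation tensors.** Given a foliation function $\underline u$, let $T\mathcal S=\ker d\underline u$, so $T\mathcal H=T\mathcal S\oplus\langle n\rangle$; let $h$ be the metric induced by $\gamma$ on the leaves, $\nabla^h$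 its Levi-Civita connection, $R^h_{AB}$ and $R^h$ its Ricci tensor and scalar curvature. Let $\chi,\Upsilon$ be the restrictions of $K,Y$ to $T\mathcal S$, $\omega=\tfrac12Y(n,n)$, $\ell_\parallel$ the one-form equal to $\ell$ on $T\mathcal S$ and to $0$ on $n$, $\ell^\sharp=h^\sharp(\ell_\parallel,\cdot)$, and, on $T\mathcal S$, $\eta=\mathcal L_n\ell_\parallel-\Pi(n,\cdot)-\chi(\ell^\sharp,\cdot)$ and $\tau=-\eta-d\log|\lambda|$. For $X$ tangent to the leaves let $\widetilde\nabla_nX$ be the $T\mathcal S$-component of $\overline\nabla_nX$, extended to leaf tensors by the Leibniz rule. Put $|\chi|^2=h^{AC}h^{BD}\chi_{AB}\chi_{CD}$, $|\eta|^2=h^{AB}\eta_A\eta_B$, $(\chi\cdot\alpha)_A=h^{BC}\chi_{BA}\alpha_C$, $\operatorname{div}(\eta)=h^{AB}\nabla^h_A\eta_B$, $\operatorname{div}(\chi)_C=h^{AB}\nabla^h_A\chi_{BC}$. **Theorem.** Let the data be characteristic and $\underline u$ a foliation function, and suppose the gauge is characteristic, i.e. $\ell(X)=0$ for all $X\in T\mathcal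 S$ and $\ell^{(2)}=0$. Then, for $X\in T\mathcal S$ and indices $A,B$ tangent to the leaves, $$J(n)=-n(\operatorname{tr}_h\chi)-2\omega\operatorname{tr}_h\chi-|\chi|^2,$$ $$J(X)=-(\widetilde\nabla_n\tau)(X)+2\nabla^h_X\omega-(\chi\cdot\tau)(X)-\tau(X)\operatorname{tr}_h\chi+\operatorname{div}(\chi)(X)-\nabla^h_X\operatorname{tr}_h\chi-2\omega\nabla^h_X\log|\lambda|-(\chi\cdot d\log|\lambda|)(X),$$ $$\mathcal R_{AB}=R^h_{AB}-2(\widetilde\nabla_n\Upsilon)_{AB}+4\omega\Upsilon_{AB}-\nabla^h_A\eta_B-\nabla^h_B\eta_A-2\eta_A\eta_B-\chi_{AB}\operatorname{tr}_h\Upsilon-\Upsilon_{AB}\operatorname{tr}_h\chi,$$ $$H=n(\operatorname{tr}_h\Upsilon)+|\eta|^2+\operatorname{div}(\eta)-\tfrac12R^h+(\operatorname{tr}_h\chi-2\omega)\operatorname{tr}_h\Upsilon.$$ -/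

import Mathlib

open scoped Manifold ContDiff Topology

/-! ## Hypersurface data on a smooth manifold

`M` is a smooth manifold without boundary modelled on the finite dimensional space `E`
(so that its dimension is the dimension of `E`). Tensor fields are given pointwise on the tangent
spaces. An expression that has to be differentiated is evaluated on vector fields; its value on
tangent vectors at `p` is obtained by extending them to vector fields that are smooth near `p`
(all these expressions are tensorial, so the extension is immaterial). -/

noncomputable section

/-- The form `((W, a), (Z, b)) ↦ g(W, Z) + a l(Z) + b l(W) + a b c` on `V × ℝ`. -/
def ambientForm {V : Type*} [AddCommGroup V] [Module ℝ V] [TopologicalSpace V]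
    [IsTopologicalAddGroup V] [ContinuousSMul ℝ V]
    (g : V →L[ℝ] V →L[ℝ] ℝ) (l : V →L[ℝ] ℝ) (c : ℝ) :
    LinearMap.BilinForm ℝ (V × ℝ) :=
  LinearMap.mk₂ ℝ
    (fun x y => g x.1 y.1 + x.2 * l y.1 + y.2 * l x.1 + x.2 * y.2 * c)
    (fun x x' y => by simp; ring)
    (fun a x y => by simp; ring)
    (fun x y y' => by simp; ring)
    (fun a x y => by simp; ring)

/-- The covector `(α, a)` on `V × ℝ`, i.e. `(w, b) ↦ α w + b a`. -/
def covector {V : Type*} [AddCommGroup V] [Module ℝ V] (α : Module.Dual ℝ V) (a : ℝ) :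
    Module.Dual ℝ (V × ℝ) :=
  LinearMap.coprod α (LinearMap.toSpanSingleton ℝ ℝ a)

section Calculus

variable {E : Type*} [NormedAddCommGroup E] [NormedSpace ℝ E]
  {M : Type*} [TopologicalSpace M] [ChartedSpace E M]

/-- (Not necessarily smooth) vector fields on `M`. -/
abbrev VField (E : Type*) [NormedAddCommGroup E] [NormedSpace ℝ E]
    (M : Type*) [TopologicalSpace M] [ChartedSpace E M] : Type _ :=
  (p : M) → TangentSpace 𝓘(ℝ, E) p

/-- Smoothness of a vector field. -/
def VField.Smooth [IsManifold 𝓘(ℝ, E) ∞ M] (X : VField E M) : Prop :=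
  ContMDiff 𝓘(ℝ, E) 𝓘(ℝ, E).tangent ∞ (fun p => (⟨p, X p⟩ : TangentBundle 𝓘(ℝ, E) M))

/-- The derivative `X(f)` of a function along a vector field. -/
def dirDeriv (X : VField E M) (f : M → ℝ) : M → ℝ :=
  fun p => mvfderiv 𝓘(ℝ, E) f p (X p)

/-- The Lie bracket `[X, Z]`. -/
def bracket (X Z : VField E M) : VField E M :=
  VectorField.mlieBracket 𝓘(ℝ, E) X Z

/-- A vector field, smooth near `p`, with the value `v` at `p`. -/
def extendVec [IsManifold 𝓘(ℝ, E) ∞ M] {p : M} (v : TangentSpace 𝓘(ℝ, E) p) : VField E M :=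
  FiberBundle.extend E v

/-- `(𝓛_N T)(V, W)` for a two-covariant tensor field `T`. -/
def lieDeriv₂ (N : VField E M)
    (T : (p : M) → TangentSpace 𝓘(ℝ, E) p → TangentSpace 𝓘(ℝ, E) p → ℝ)
    (V W : VField E M) : M → ℝ := fun p =>
  dirDeriv N (fun q => T q (V q) (W q)) p - T p (bracket N V p) (W p) - T p (V p) (bracket N W p)

/-- `(𝓛_N α)(V)` for a one-form `α`. -/
def lieDeriv₁ (N : VField E M) (α : (p : M) → TangentSpace 𝓘(ℝ, E) p → ℝ)
    (V : VField E M) : M → ℝ := fun p =>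
  dirDeriv N (fun q => α q (V q)) p - α p (bracket N V p)

/-- `(dα)(V, W) = V(α(W)) - W(α(V)) - α([V, W])` for a one-form `α`. -/
def extDeriv₁ (α : (p : M) → TangentSpace 𝓘(ℝ, E) p → ℝ) (V W : VField E M) : M → ℝ := fun p =>
  dirDeriv V (fun q => α q (W q)) p - dirDeriv W (fun q => α q (V q)) p - α p (bracket V W p)

/-- The right-hand side of the Koszul formula of a symmetric two-covariant tensor field `g`:
half of `X g(Z,W) + Z g(X,W) - W g(X,Z) + g([X,Z],W) - g([X,W],Z) - g([Z,W],X)`. -/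
def koszul (g : (p : M) → TangentSpace 𝓘(ℝ, E) p → TangentSpace 𝓘(ℝ, E) p → ℝ)
    (X Z W : VField E M) : M → ℝ := fun p =>
  (dirDeriv X (fun q => g q (Z q) (W q)) p + dirDeriv Z (fun q => g q (X q) (W q)) p
    - dirDeriv W (fun q => g q (X q) (Z q)) p
    + g p (bracket X Z p) (W p) - g p (bracket X W p) (Z p) - g p (bracket Z W p) (X p)) / 2

/-- A map on a subset `A` of `M` is smooth if locally it is the restriction of a smooth map
defined on an open subset of `M`. -/
def SmoothOnSubset (E : Type*) [NormedAddCommGroup E] [NormedSpace ℝ E]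
    {M : Type*} [TopologicalSpace M] [ChartedSpace E M] (A : Set M) (f : A → M) : Prop :=
  ∀ p : A, ∃ U : Set M, IsOpen U ∧ (p : M) ∈ U ∧ ∃ F : M → M,
    ContMDiffOn 𝓘(ℝ, E) 𝓘(ℝ, E) ∞ F U ∧ ∀ q : A, (q : M) ∈ U → F q = f q

/-- Diffeomorphic (embedded submanifolds) `A`, `B` of `M`. -/
def DiffeomorphicSubsets (E : Type*) [NormedAddCommGroup E] [NormedSpace ℝ E]
    {M : Type*} [TopologicalSpace M] [ChartedSpace E M] (A B : Set M) : Prop :=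
  ∃ φ : A ≃ B, SmoothOnSubset E A (fun a => (φ a : M)) ∧
    SmoothOnSubset E B (fun b => (φ.symm b : M))

end Calculus

/-- Hypersurface data `{M, γ, ℓ, ℓ⁽²⁾, Y}`: a symmetric two-covariant tensor `γ`, a one-form `ℓ`, a
scalar `ℓ⁽²⁾` such that `((W,a),(Z,b)) ↦ γ(W,Z) + a ℓ(Z) + b ℓ(W) + a b ℓ⁽²⁾` is non-degenerate
on every `T_p M × ℝ`, and a symmetric two-covariant tensor `Y`; everything is smooth. -/
structure HypersurfaceData (E : Type*) [NormedAddCommGroup E] [NormedSpace ℝ E]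
    [FiniteDimensional ℝ E] (M : Type*) [TopologicalSpace M] [ChartedSpace E M]
    [IsManifold 𝓘(ℝ, E) ∞ M] where
  gamma : (p : M) → TangentSpace 𝓘(ℝ, E) p →L[ℝ] TangentSpace 𝓘(ℝ, E) p →L[ℝ] ℝ
  ell : (p : M) → TangentSpace 𝓘(ℝ, E) p →L[ℝ] ℝ
  ell2 : M → ℝ
  Y : (p : M) → TangentSpace 𝓘(ℝ, E) p →L[ℝ] TangentSpace 𝓘(ℝ, E) p →L[ℝ] ℝ
  gamma_symm : ∀ p v w, gamma p v w = gamma p w v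
  Y_symm : ∀ p v w, Y p v w = Y p w v
  gamma_smooth : ContMDiff 𝓘(ℝ, E) (𝓘(ℝ, E).prod 𝓘(ℝ, E →L[ℝ] E →L[ℝ] ℝ)) ∞
    (fun p => Bundle.TotalSpace.mk' (E →L[ℝ] E →L[ℝ] ℝ)
      (E := fun q : M => TangentSpace 𝓘(ℝ, E) q →L[ℝ] TangentSpace 𝓘(ℝ, E) q →L[ℝ] ℝ)
      p (gamma p))
  ell_smooth : ContMDiff 𝓘(ℝ, E) (𝓘(ℝ, E).prod 𝓘(ℝ, E →L[ℝ] ℝ)) ∞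
    (fun p => Bundle.TotalSpace.mk' (E →L[ℝ] ℝ)
      (E := fun q : M => TangentSpace 𝓘(ℝ, E) q →L[ℝ] ℝ) p (ell p))
  ell2_smooth : ContMDiff 𝓘(ℝ, E) 𝓘(ℝ, ℝ) ∞ ell2
  Y_smooth : ContMDiff 𝓘(ℝ, E) (𝓘(ℝ, E).prod 𝓘(ℝ, E →L[ℝ] E →L[ℝ] ℝ)) ∞
    (fun p => Bundle.TotalSpace.mk' (E →L[ℝ] E →L[ℝ] ℝ)
      (E := fun q : M => TangentSpace 𝓘(ℝ, E) q →L[ℝ] TangentSpace 𝓘(ℝ, E) q →L[ℝ] ℝ)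
      p (Y p))
  nondegenerate : ∀ p, (ambientForm (gamma p) (ell p) (ell2 p)).Nondegenerate

namespace HypersurfaceData

variable {E : Type*} [NormedAddCommGroup E] [NormedSpace ℝ E] [FiniteDimensional ℝ E]
  {M : Type*} [TopologicalSpace M] [ChartedSpace E M] [IsManifold 𝓘(ℝ, E) ∞ M]

instance tangentFinite (p : M) : FiniteDimensional ℝ (TangentSpace 𝓘(ℝ, E) p) :=
  inferInstanceAs (FiniteDimensional ℝ E)

variable (D : HypersurfaceData E M)

/-- The isomorphism from covectors to vectors of `T_p M × ℝ` inverse to `V ↦ 𝒜(V, ·)`; the inverse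
form is `𝒜♯(a, b) = b (sharp a)`. -/
def sharp (p : M) :
    Module.Dual ℝ (TangentSpace 𝓘(ℝ, E) p × ℝ) ≃ₗ[ℝ] TangentSpace 𝓘(ℝ, E) p × ℝ :=
  (LinearMap.BilinForm.toDual _ (D.nondegenerate p)).symm

/-- The two-contravariant tensor `P`, from
`𝒜♯((α,a),(β,b)) = P(α,β) + a n(β) + b n(α) + a b n⁽²⁾`. -/
def P (p : M) (α β : Module.Dual ℝ (TangentSpace 𝓘(ℝ, E) p)) : ℝ :=
  covector β 0 (D.sharp p (covector α 0))

/-- The vector field `n`. -/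
def n : VField E M := fun p => (D.sharp p (covector 0 1)).1

/-- The scalar `n⁽²⁾`. -/
def n2 (p : M) : ℝ := (D.sharp p (covector 0 1)).2

/-- The contraction `P^{ab} T_{ab}`. -/
def trP (p : M) (T : TangentSpace 𝓘(ℝ, E) p → TangentSpace 𝓘(ℝ, E) p → ℝ) : ℝ :=
  let b := Module.finBasis ℝ (TangentSpace 𝓘(ℝ, E) p)
  ∑ i, ∑ j, D.P p (b.coord i) (b.coord j) * T (b i) (b j)

/-- `F = dℓ / 2`. -/
def F (p : M) (v w : TangentSpace 𝓘(ℝ, E) p) : ℝ :=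
  extDeriv₁ (fun q x => D.ell q x) (extendVec v) (extendVec w) p / 2

/-- `Π = Y + F`. -/
def Pi (p : M) (v w : TangentSpace 𝓘(ℝ, E) p) : ℝ := D.Y p v w + D.F p v w

/-- `K = n⁽²⁾ Y + 𝓛_n γ / 2 + ℓ ⊗ₛ dn⁽²⁾`. -/
def K (p : M) (v w : TangentSpace 𝓘(ℝ, E) p) : ℝ :=
  D.n2 p * D.Y p v w
    + lieDeriv₂ D.n (fun q x y => D.gamma q x y) (extendVec v) (extendVec w) p / 2
    + (D.ell p v * mvfderiv 𝓘(ℝ, E) D.n2 p w + D.ell p w * mvfderiv 𝓘(ℝ, E) D.n2 p v) / 2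

/-- The defining conditions of the hypersurface connection: `∇` is torsion-free,
`(∇_X γ)(Z,W) = -ℓ(Z) K(X,W) - ℓ(W) K(X,Z)` and `(∇_X ℓ)(Z) = Y(X,Z) + F(X,Z) - ℓ⁽²⁾ K(X,Z)`. -/
def IsHypersurfaceConnection (nabla : VField E M → VField E M → VField E M) : Prop :=
  ∀ X Z W : VField E M, X.Smooth → Z.Smooth → W.Smooth → ∀ p,
    nabla X Z p - nabla Z X p = bracket X Z p ∧
    dirDeriv X (fun q => D.gamma q (Z q) (W q)) p
        - D.gamma p (nabla X Z p) (W p) - D.gamma p (Z p) (nabla X W p)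
      = - D.ell p (Z p) * D.K p (X p) (W p) - D.ell p (W p) * D.K p (X p) (Z p) ∧
    dirDeriv X (fun q => D.ell q (Z q)) p - D.ell p (nabla X Z p)
      = D.Y p (X p) (Z p) + D.F p (X p) (Z p) - D.ell2 p * D.K p (X p) (Z p)

/-- The hypersurface connection `∇̄_X Z`. The defining conditions fix, by the argument that gives
the Koszul formula, `γ(∇̄_X Z, W) = koszul γ (X, Z, W) + ℓ(W) K(X, Z)` and
`ℓ(∇̄_X Z) = X(ℓ(Z)) - Y(X,Z) - F(X,Z) + ℓ⁽²⁾ K(X,Z)`, that is, the covector `𝒜((∇̄_X Z, 0), ·)`. -/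
def conn (X Z : VField E M) : VField E M := fun p =>
  let b := Module.finBasis ℝ (TangentSpace 𝓘(ℝ, E) p)
  let κ : Module.Dual ℝ (TangentSpace 𝓘(ℝ, E) p) := b.constr ℝ (fun i =>
    koszul (fun q x y => D.gamma q x y) X Z (extendVec (b i)) p
      + D.ell p (b i) * D.K p (X p) (Z p))
  let c : ℝ := dirDeriv X (fun q => D.ell q (Z q)) p - D.Y p (X p) (Z p) - D.F p (X p) (Z p)
    + D.ell2 p * D.K p (X p) (Z p)
  (D.sharp p (covector κ c)).1

/-- The curvature `R̄(X, W) Z = ∇̄_X ∇̄_W Z - ∇̄_W ∇̄_X Z - ∇̄_[X,W] Z`. -/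
def curv (X W Z : VField E M) : VField E M := fun p =>
  D.conn X (D.conn W Z) p - D.conn W (D.conn X Z) p - D.conn (bracket X W) Z p

/-- The curvature on tangent vectors; `R̄^a_{bcd}` is the vector `riem (e_c) (e_d) (e_b)`. -/
def riem (p : M) (x w z : TangentSpace 𝓘(ℝ, E) p) : TangentSpace 𝓘(ℝ, E) p :=
  D.curv (extendVec x) (extendVec w) (extendVec z) p

/-- `∇̄_d K_{ab}`. -/
def nablaK (p : M) (d a b : TangentSpace 𝓘(ℝ, E) p) : ℝ :=
  dirDeriv (extendVec d) (fun q => D.K q (extendVec a q) (extendVec b q)) p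
    - D.K p (D.conn (extendVec d) (extendVec a) p) b
    - D.K p a (D.conn (extendVec d) (extendVec b) p)

/-- `∇̄_d (K_{cb} ℓ_a)`. -/
def nablaKell (p : M) (d c b a : TangentSpace 𝓘(ℝ, E) p) : ℝ :=
  dirDeriv (extendVec d)
      (fun q => D.K q (extendVec c q) (extendVec b q) * D.ell q (extendVec a q)) p
    - D.K p (D.conn (extendVec d) (extendVec c) p) b * D.ell p a
    - D.K p c (D.conn (extendVec d) (extendVec b) p) * D.ell p a
    - D.K p c b * D.ell p (D.conn (extendVec d) (extendVec a) p)

/-- `A_{bcd} = ℓ_a R̄^a_{bcd} + 2 ℓ⁽²⁾ ∇̄_{[d} K_{c]b} + K_{b[c} ∇̄_{d]} ℓ⁽²⁾`. -/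
def A (p : M) (b c d : TangentSpace 𝓘(ℝ, E) p) : ℝ :=
  D.ell p (D.riem p c d b)
    + D.ell2 p * (D.nablaK p d c b - D.nablaK p c d b)
    + (D.K p b c * mvfderiv 𝓘(ℝ, E) D.ell2 p d - D.K p b d * mvfderiv 𝓘(ℝ, E) D.ell2 p c) / 2

/-- `B_{abcd} = γ_{af} R̄^f_{bcd} + 2 ∇̄_{[d} (K_{c]b} ℓ_a) + 2 ℓ⁽²⁾ K_{b[c} K_{d]a}`. -/
def B (p : M) (a b c d : TangentSpace 𝓘(ℝ, E) p) : ℝ :=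
  D.gamma p a (D.riem p c d b)
    + (D.nablaKell p d c b a - D.nablaKell p c d b a)
    + D.ell2 p * (D.K p b c * D.K p d a - D.K p b d * D.K p c a)

/-- The constraint tensor `𝓡_{ab} = B_{acbd} P^{cd} - (A_{bac} + A_{abc}) n^c`. -/
def Rcon (p : M) (a b : TangentSpace 𝓘(ℝ, E) p) : ℝ :=
  D.trP p (fun c d => D.B p a c b d) - (D.A p b a (D.n p) + D.A p a b (D.n p))

/-- The constraint scalar `H = - P^{ab} 𝓡_{ab} / 2`. -/
def H (p : M) : ℝ := - D.trP p (D.Rcon p) / 2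

/-- The constraint one-form `J_b = 𝓡_{ab} n^a`. -/
def J (p : M) (b : TangentSpace 𝓘(ℝ, E) p) : ℝ := D.Rcon p (D.n p) b

/-- `ω = Y(n, n) / 2`. -/
def omega (p : M) : ℝ := D.Y p (D.n p) (D.n p) / 2

/-- A foliation function: a smooth function `u` with `λ = n(u)` nowhere zero. -/
structure FoliationFunction where
  toFun : M → ℝ
  smooth : ContMDiff 𝓘(ℝ, E) 𝓘(ℝ, ℝ) ∞ toFun
  ne_zero : ∀ p, dirDeriv D.n toFun p ≠ 0

/-- Characteristic hypersurface data. -/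
structure IsCharacteristic : Prop where
  radical : ∀ p, ∃ v, v ≠ 0 ∧ ∀ w, D.gamma p v w = 0
  nonneg : ∀ p v, 0 ≤ D.gamma p v v
  foliation : ∃ u : D.FoliationFunction, ∀ s ∈ Set.range u.toFun, ∀ t ∈ Set.range u.toFun,
    DiffeomorphicSubsets E (u.toFun ⁻¹' {s}) (u.toFun ⁻¹' {t})

namespace FoliationFunction

variable {D} (u : D.FoliationFunction)

/-! ### The geometry of the foliation by the leaves `{u = const}` -/

/-- `λ = n(u)`. -/
def lam : M → ℝ := dirDeriv D.n u.toFun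

/-- The tangent space of the leaf through `p`, the kernel of `du` at `p`. -/
def leafSpace (p : M) : Submodule ℝ (TangentSpace 𝓘(ℝ, E) p) :=
  LinearMap.ker (mvfderiv 𝓘(ℝ, E) u.toFun p).toLinearMap

/-- The component `v_∥` tangent to the leaves in `v = v_∥ + v_n n`. -/
def proj (p : M) (v : TangentSpace 𝓘(ℝ, E) p) : u.leafSpace p :=
  ⟨v - (mvfderiv 𝓘(ℝ, E) u.toFun p v / u.lam p) • D.n p, by
    have h : mvfderiv 𝓘(ℝ, E) u.toFun p (D.n p) = u.lam p := rfl
    have h0 : u.lam p ≠ 0 := u.ne_zero p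
    simp only [leafSpace, LinearMap.mem_ker, ContinuousLinearMap.coe_coe, map_sub, map_smul, h,
      smul_eq_mul]
    field_simp
    ring⟩

/-- (Not necessarily smooth) vector fields tangent to the leaves. -/
abbrev LeafField : Type _ := (p : M) → u.leafSpace p

/-- A field tangent to the leaves, as a vector field on `M`. -/
def toVField (X : u.LeafField) : VField E M := fun p => (X p : TangentSpace 𝓘(ℝ, E) p)

/-- A field tangent to the leaves, smooth near `p`, with the value `v` at `p`. -/
def extendLeaf {p : M} (v : u.leafSpace p) : u.LeafField := fun q =>
  u.proj q (extendVec (v : TangentSpace 𝓘(ℝ, E) p) q)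

/-- The induced metric `h` of the leaves. -/
def h (p : M) (v w : u.leafSpace p) : ℝ := D.gamma p v w

/-- The components `h^{AB}` of the inverse of `h` in a basis of the tangent space of the leaf. -/
def hInv (p : M) : Matrix (Fin (Module.finrank ℝ (u.leafSpace p)))
    (Fin (Module.finrank ℝ (u.leafSpace p))) ℝ :=
  let e := Module.finBasis ℝ (u.leafSpace p)
  (Matrix.of fun i j => u.h p (e i) (e j))⁻¹

/-- The trace `tr_h T = h^{AB} T_{AB}`. -/
def trh (p : M) (T : u.leafSpace p → u.leafSpace p → ℝ) : ℝ :=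
  let e := Module.finBasis ℝ (u.leafSpace p)
  ∑ i, ∑ j, u.hInv p i j * T (e i) (e j)

/-- The vector `h♯(α, ·)` of a covector `α`. -/
def sharph (p : M) (α : u.leafSpace p → ℝ) : u.leafSpace p :=
  let e := Module.finBasis ℝ (u.leafSpace p)
  ∑ i, ∑ j, (u.hInv p i j * α (e i)) • e j

/-- The Levi-Civita connection `∇^h` of the leaves, from the Koszul formula of `h`. -/
def leafConn (X Z : u.LeafField) : u.LeafField := fun p =>
  u.sharph p (fun w => koszul (fun q x y => D.gamma q x y)
    (u.toVField X) (u.toVField Z) (u.toVField (u.extendLeaf w)) p)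

/-- The defining conditions of the Levi-Civita connection of `h`: torsion-free and metric. -/
def IsLeafLeviCivita (nabla : u.LeafField → u.LeafField → u.LeafField) : Prop :=
  ∀ X Z W : u.LeafField,
    (u.toVField X).Smooth → (u.toVField Z).Smooth → (u.toVField W).Smooth → ∀ p,
    (nabla X Z p : TangentSpace 𝓘(ℝ, E) p) - nabla Z X p
      = bracket (u.toVField X) (u.toVField Z) p ∧
    dirDeriv (u.toVField X) (fun q => u.h q (Z q) (W q)) p
      = u.h p (nabla X Z p) (W p) + u.h p (Z p) (nabla X W p)

/-- The bracket of two fields tangent to the leaves. (The bracket of smooth ones is tangent to the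
leaves, so that the projection does not change it.) -/
def leafBracket (X Z : u.LeafField) : u.LeafField := fun p =>
  u.proj p (bracket (u.toVField X) (u.toVField Z) p)

/-- The curvature `R^h(X, W) Z` of `∇^h`. -/
def leafCurv (X W Z : u.LeafField) : u.LeafField := fun p =>
  u.leafConn X (u.leafConn W Z) p - u.leafConn W (u.leafConn X Z) p
    - u.leafConn (u.leafBracket X W) Z p

/-- The Ricci tensor `R^h_{AB}`, the trace of `z ↦ R^h(z, b) a`. -/
def leafRicci (p : M) (a b : u.leafSpace p) : ℝ :=
  u.trh p (fun c d =>
    u.h p (u.leafCurv (u.extendLeaf c) (u.extendLeaf b) (u.extendLeaf a) p) d)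

/-- The scalar curvature `R^h`. -/
def leafScalar (p : M) : ℝ := u.trh p (u.leafRicci p)

/-- The differential of a function along the leaves, `∇^h_x f = df(x)`. -/
def leafD (f : M → ℝ) (p : M) (x : u.leafSpace p) : ℝ := mvfderiv 𝓘(ℝ, E) f p x

/-- `(∇^h_a α)(b)` for a one-form on the leaves. -/
def leafNabla₁ (α : (p : M) → u.leafSpace p → ℝ) (p : M) (a b : u.leafSpace p) : ℝ :=
  u.leafD (fun q => α q (u.extendLeaf b q)) p a
    - α p (u.leafConn (u.extendLeaf a) (u.extendLeaf b) p)

/-- `(∇^h_a T)(b, c)` for a two-covariant tensor on the leaves. -/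
def leafNabla₂ (T : (p : M) → u.leafSpace p → u.leafSpace p → ℝ)
    (p : M) (a b c : u.leafSpace p) : ℝ :=
  u.leafD (fun q => T q (u.extendLeaf b q) (u.extendLeaf c q)) p a
    - T p (u.leafConn (u.extendLeaf a) (u.extendLeaf b) p) c
    - T p b (u.leafConn (u.extendLeaf a) (u.extendLeaf c) p)

/-- `div α = h^{AB} ∇^h_A α_B`. -/
def div₁ (α : (p : M) → u.leafSpace p → ℝ) (p : M) : ℝ := u.trh p (u.leafNabla₁ α p)

/-- `(div T)(x) = h^{AB} (∇^h_A T)(e_B, x)`. -/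
def div₂ (T : (p : M) → u.leafSpace p → u.leafSpace p → ℝ) (p : M) (x : u.leafSpace p) : ℝ :=
  u.trh p (fun a b => u.leafNabla₂ T p a b x)

/-- `∇̃_n X`, the component of `∇̄_n X` tangent to the leaves. -/
def tildeNabla (X : u.LeafField) : u.LeafField := fun p =>
  u.proj p (D.conn D.n (u.toVField X) p)

/-- `(∇̃_n α)(x)` for a one-form on the leaves. -/
def tildeNabla₁ (α : (p : M) → u.leafSpace p → ℝ) (p : M) (x : u.leafSpace p) : ℝ :=
  dirDeriv D.n (fun q => α q (u.extendLeaf x q)) p - α p (u.tildeNabla (u.extendLeaf x) p)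

/-- `(∇̃_n T)(x, y)` for a two-covariant tensor on the leaves. -/
def tildeNabla₂ (T : (p : M) → u.leafSpace p → u.leafSpace p → ℝ)
    (p : M) (x y : u.leafSpace p) : ℝ :=
  dirDeriv D.n (fun q => T q (u.extendLeaf x q) (u.extendLeaf y q)) p
    - T p (u.tildeNabla (u.extendLeaf x) p) y - T p x (u.tildeNabla (u.extendLeaf y) p)

/-! ### The foliation tensors -/

/-- `χ`, the pull-back of `K` to the leaves. -/
def chi (p : M) (v w : u.leafSpace p) : ℝ := D.K p v w

/-- `Υ`, the pull-back of `Y` to the leaves. -/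
def Upsilon (p : M) (v w : u.leafSpace p) : ℝ := D.Y p v w

/-- `ℓ_∥`, as the one-form on `M` that agrees with `ℓ` on the leaves and vanishes on `n`. -/
def ellPar (p : M) (v : TangentSpace 𝓘(ℝ, E) p) : ℝ := D.ell p (u.proj p v)

/-- `ℓ♯ = h♯(ℓ_∥, ·)`. -/
def ellSharp (p : M) : u.leafSpace p := u.sharph p (fun v => u.ellPar p v)

/-- `η = 𝓛_n ℓ_∥ - Π(n, ·) - χ(ℓ♯, ·)` on the leaves. -/
def eta (p : M) (x : u.leafSpace p) : ℝ :=
  lieDeriv₁ D.n u.ellPar (u.toVField (u.extendLeaf x)) p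
    - D.Pi p (D.n p) x - u.chi p (u.ellSharp p) x

/-- The function `log |λ|`. -/
def logLam (p : M) : ℝ := Real.log |u.lam p|

/-- `τ = - η - d(log |λ|)`. -/
def tau (p : M) (x : u.leafSpace p) : ℝ := - u.eta p x - u.leafD u.logLam p x

/-- `tr_h χ`. -/
def trChi (p : M) : ℝ := u.trh p (u.chi p)

/-- `tr_h Υ`. -/
def trUpsilon (p : M) : ℝ := u.trh p (u.Upsilon p)

/-- `|χ|² = h^{AC} h^{BD} χ_{AB} χ_{CD}`. -/
def chiSq (p : M) : ℝ :=
  u.trh p (fun a c => u.trh p (fun b d => u.chi p a b * u.chi p c d))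

/-- `|η|² = h^{AB} η_A η_B`. -/
def etaSq (p : M) : ℝ := u.trh p (fun a b => u.eta p a * u.eta p b)

/-- `(χ · α)(x) = h^{BC} χ(e_B, x) α_C`. -/
def chiDot (α : (p : M) → u.leafSpace p → ℝ) (p : M) (x : u.leafSpace p) : ℝ :=
  u.trh p (fun b c => u.chi p b x * α p c)

/-- Characteristic gauge: `ℓ` vanishes on vectors tangent to the leaves and `ℓ⁽²⁾ = 0`. -/
structure IsCharacteristicGauge : Prop where
  ell_tangent : ∀ p (v : u.leafSpace p), D.ell p v = 0
  ell2_zero : ∀ p, D.ell2 p = 0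

end FoliationFunction

end HypersurfaceData

end

/-! In the characteristic gauge the algebra of the data collapses. A nonzero radical vector of `γ`
forces `n⁽²⁾ = 0`. Hence `γ(n, ·) = 0` and `ℓ(n) = 1`, `ℓ` reads off the `n`-component in `T𝓗 = T𝓢 ⊕
⟨n⟩`, and `P = ∑ e_k ⊗ e_k` for every `h`-orthonormal basis `e_k` of the leaf. Also `ℓ = du/λ`, so
`dℓ = ℓ ∧ d log|λ|`; `K` is half of `𝓛_n γ` and kills `n`; and `∇̄ℓ = Π`. Consequently `A` is the
antisymmetrized `∇̄Π` (`A_eq`), and `B` is the lowered curvature plus terms in `∇̄K` and `K ⊗ Π`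
(`B_eq`).

The foliation tensors are components of `Π` and `K`: `η = -Π(n, ·)`, `τ = Π(·, n)`, `2ω = Π(n, n)`.
The two connections differ only along `n`: `∇^h_X Z = ∇̄_X Z + Y(X, Z) n`, and `∇̃_n X = ∇̄_n X -
η(X) n`. The derivative of `n` has `γ`-part `K(x, ·)` and `ℓ`-part `-Π(x, n)`. So each derivative in
the theorem is a component of `∇̄Π` or `∇̄K` plus explicit quadratic terms. Where `Π(n, x)` meets
`Π(x, n)`, the difference is `d log|λ|`, the source of all logarithmic terms.

For `J`, the curvature is lowered with `γ(n, ·) = 0` and drops out, leaving a Codazzi-type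
expression in `∇̄K` and `∇̄Π`. For `𝓡_{AB}`, the Gauss equation `gamma_leafCurv` turns the curvature
into `R^h`. The formula for `H` is the trace of that for `𝓡_{AB}`; a trace commutes with
differentiation up to `n`-components, because the connection coefficients of an orthonormal frame
are skew (`dirDeriv_trace`).

The analytic groundwork is that `n` and `∇̄` are given pointwise, by inverting `𝒜`, and that tensors
are evaluated on chosen extensions. Gram–Schmidt gives local orthonormal leaf frames, from which `n`
and `∇̄` are seen to be smooth; tensoriality then allows any smooth extension to replace the chosen
one. -/

set_option linter.unusedSectionVars false

noncomputable section

/-! ### Calculus of functions and vector fields smooth near a point -/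

section Germs

variable {E : Type*} [NormedAddCommGroup E] [NormedSpace ℝ E]
  {M : Type*} [TopologicalSpace M] [ChartedSpace E M]

/-- The function `f` is smooth near `p`. -/
def SmoothFunAt (E : Type*) [NormedAddCommGroup E] [NormedSpace ℝ E] {M : Type*}
    [TopologicalSpace M] [ChartedSpace E M] (f : M → ℝ) (p : M) : Prop :=
  ∀ᶠ q in 𝓝 p, ContMDiffAt 𝓘(ℝ, E) 𝓘(ℝ, ℝ) ∞ f q

namespace SmoothFunAt

variable {f g : M → ℝ} {p : M}

/-- Being `C^∞` at a single point only gives neighbourhoods that may shrink with the order of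
differentiation. Asking for smoothness at all nearby points makes the notion pass to nearby points
and survive differentiation. -/
theorem eventually (hf : SmoothFunAt E f p) : ∀ᶠ q in 𝓝 p, SmoothFunAt E f q :=
  eventually_eventually_nhds.2 hf

theorem contMDiffAt (hf : SmoothFunAt E f p) : ContMDiffAt 𝓘(ℝ, E) 𝓘(ℝ, ℝ) ∞ f p :=
  hf.self_of_nhds

theorem mdifferentiableAt (hf : SmoothFunAt E f p) :
    MDifferentiableAt 𝓘(ℝ, E) 𝓘(ℝ, ℝ) f p :=
  hf.contMDiffAt.mdifferentiableAt (by simp)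

theorem continuousAt (hf : SmoothFunAt E f p) : ContinuousAt f p :=
  hf.contMDiffAt.continuousAt

theorem congr (hf : SmoothFunAt E f p) (h : g =ᶠ[𝓝 p] f) : SmoothFunAt E g p := by
  filter_upwards [hf, h.eventuallyEq_nhds] with q h1 h2
  exact h1.congr_of_eventuallyEq h2

theorem const (c : ℝ) : SmoothFunAt E (fun _ : M => c) p :=
  Filter.Eventually.of_forall fun _ => contMDiffAt_const

theorem add (hf : SmoothFunAt E f p) (hg : SmoothFunAt E g p) :
    SmoothFunAt E (fun q => f q + g q) p := by
  filter_upwards [hf, hg] with q h1 h2 using h1.add h2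

theorem sub (hf : SmoothFunAt E f p) (hg : SmoothFunAt E g p) :
    SmoothFunAt E (fun q => f q - g q) p := by
  filter_upwards [hf, hg] with q h1 h2 using h1.sub h2

theorem mul (hf : SmoothFunAt E f p) (hg : SmoothFunAt E g p) :
    SmoothFunAt E (fun q => f q * g q) p := by
  filter_upwards [hf, hg] with q h1 h2
  exact ContMDiffAt.smul h1 h2

theorem comp {φ : ℝ → ℝ} (hf : SmoothFunAt E f p)
    (hφ' : ∀ᶠ t in 𝓝 (f p), ContDiffAt ℝ ∞ φ t) :
    SmoothFunAt E (fun q => φ (f q)) p := by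
  filter_upwards [hf, hf.continuousAt.eventually hφ'] with q h1 h2
  exact h2.contMDiffAt.comp q h1

theorem inv (hf : SmoothFunAt E f p) (h0 : f p ≠ 0) : SmoothFunAt E (fun q => (f q)⁻¹) p :=
  hf.comp (Filter.Eventually.mono (isOpen_ne.mem_nhds h0) fun _ ht => contDiffAt_inv ℝ ht)

theorem div (hf : SmoothFunAt E f p) (hg : SmoothFunAt E g p) (h0 : g p ≠ 0) :
    SmoothFunAt E (fun q => f q / g q) p := by
  simpa only [div_eq_mul_inv] using hf.mul (hg.inv h0)

theorem sum {ι : Type*} {s : Finset ι} {F : ι → M → ℝ} (hF : ∀ i ∈ s, SmoothFunAt E (F i) p) :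
    SmoothFunAt E (fun q => ∑ i ∈ s, F i q) p := by
  classical
  induction s using Finset.induction_on with
  | empty => simpa using const 0
  | insert a s ha h =>
    simp only [Finset.sum_insert ha]
    exact (hF a (by simp)).add (h fun i hi => hF i (by simp [hi]))

end SmoothFunAt

section dirDeriv

variable {f g : M → ℝ} {p : M} {X X' : VField E M}

theorem dirDeriv_congr (h : f =ᶠ[𝓝 p] g) (hX : X p = X' p) :
    dirDeriv X f p = dirDeriv X' g p := by
  unfold dirDeriv mvfderiv
  rw [hX, h.mfderiv_eq, h.eq_of_nhds]

theorem dirDeriv_const (X : VField E M) (c : ℝ) (p : M) :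
    dirDeriv X (fun _ => c) p = 0 := by
  simp [dirDeriv, mvfderiv_const]

theorem dirDeriv_add (hf : SmoothFunAt E f p) (hg : SmoothFunAt E g p) :
    dirDeriv X (fun q => f q + g q) p = dirDeriv X f p + dirDeriv X g p := by
  unfold dirDeriv
  rw [mvfderiv_fun_add hf.mdifferentiableAt hg.mdifferentiableAt]; rfl

theorem dirDeriv_sub (hf : SmoothFunAt E f p) (hg : SmoothFunAt E g p) :
    dirDeriv X (fun q => f q - g q) p = dirDeriv X f p - dirDeriv X g p := by
  unfold dirDeriv
  rw [mvfderiv_fun_sub hf.mdifferentiableAt hg.mdifferentiableAt]; rfl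

theorem dirDeriv_neg (X : VField E M) (f : M → ℝ) (p : M) :
    dirDeriv X (fun q => - f q) p = - dirDeriv X f p := by
  unfold dirDeriv
  rw [mvfderiv_fun_neg]; rfl

theorem dirDeriv_mul (hf : SmoothFunAt E f p) (hg : SmoothFunAt E g p) :
    dirDeriv X (fun q => f q * g q) p = f p * dirDeriv X g p + g p * dirDeriv X f p := by
  unfold dirDeriv
  rw [mvfderiv_fun_mul hf.mdifferentiableAt hg.mdifferentiableAt]; rfl

theorem dirDeriv_sum {ι : Type*} {s : Finset ι} {F : ι → M → ℝ}
    (hF : ∀ i ∈ s, SmoothFunAt E (F i) p) :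
    dirDeriv X (fun q => ∑ i ∈ s, F i q) p = ∑ i ∈ s, dirDeriv X (F i) p := by
  classical
  induction s using Finset.induction_on with
  | empty => simpa using dirDeriv_const X 0 p
  | insert a s ha h =>
    simp only [Finset.sum_insert ha]
    rw [dirDeriv_add (hF a (by simp)) (SmoothFunAt.sum fun i hi => hF i (by simp [hi])),
      h fun i hi => hF i (by simp [hi])]

theorem dirDeriv_add_left (X X' : VField E M) (f : M → ℝ) (p : M) :
    dirDeriv (X + X') f p = dirDeriv X f p + dirDeriv X' f p :=
  map_add (mvfderiv 𝓘(ℝ, E) f p) (X p) (X' p)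

theorem dirDeriv_smul_left (g : M → ℝ) (X : VField E M) (f : M → ℝ) (p : M) :
    dirDeriv (g • X) f p = g p * dirDeriv X f p :=
  map_smul (mvfderiv 𝓘(ℝ, E) f p) (g p) (X p)

end dirDeriv

section bracketCongr

variable {X X' Z Z' : VField E M} {p : M}

theorem bracket_swap (X Z : VField E M) (p : M) : bracket X Z p = - bracket Z X p :=
  VectorField.mlieBracket_swap_apply

theorem bracket_self (X : VField E M) (p : M) : bracket X X p = 0 := by
  simp [bracket]

end bracketCongr

section Fields

variable [IsManifold 𝓘(ℝ, E) ∞ M]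

/-- The vector field `X` is smooth near `p`. -/
def VField.SmoothAt (X : VField E M) (p : M) : Prop :=
  ∀ᶠ q in 𝓝 p, ContMDiffAt 𝓘(ℝ, E) 𝓘(ℝ, E).tangent ∞
    (fun q => (⟨q, X q⟩ : TangentBundle 𝓘(ℝ, E) M)) q

namespace VField.SmoothAt

variable {X Z : VField E M} {f : M → ℝ} {p : M}

theorem eventually (hX : X.SmoothAt p) : ∀ᶠ q in 𝓝 p, X.SmoothAt q :=
  eventually_eventually_nhds.2 hX

theorem contMDiffAt (hX : X.SmoothAt p) : ContMDiffAt 𝓘(ℝ, E) 𝓘(ℝ, E).tangent ∞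
    (fun q => (⟨q, X q⟩ : TangentBundle 𝓘(ℝ, E) M)) p :=
  hX.self_of_nhds

theorem mdifferentiableAt (hX : X.SmoothAt p) : MDifferentiableAt 𝓘(ℝ, E) 𝓘(ℝ, E).tangent
    (fun q => (⟨q, X q⟩ : TangentBundle 𝓘(ℝ, E) M)) p :=
  hX.contMDiffAt.mdifferentiableAt (by simp)

theorem congr (hX : X.SmoothAt p) (h : Z =ᶠ[𝓝 p] X) : Z.SmoothAt p := by
  filter_upwards [hX, h.eventuallyEq_nhds] with q h1 h2
  refine h1.congr_of_eventuallyEq ?_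
  filter_upwards [h2] with r hr
  rw [hr]

theorem add (hX : X.SmoothAt p) (hZ : Z.SmoothAt p) : (X + Z).SmoothAt p := by
  filter_upwards [hX, hZ] with q h1 h2 using h1.add_section h2

theorem sub (hX : X.SmoothAt p) (hZ : Z.SmoothAt p) : (X - Z).SmoothAt p := by
  filter_upwards [hX, hZ] with q h1 h2 using h1.sub_section h2

theorem smul (hf : SmoothFunAt E f p) (hX : X.SmoothAt p) : (f • X).SmoothAt p := by
  filter_upwards [hf, hX] with q h1 h2 using h1.smul_section h2

theorem sum {ι : Type*} {s : Finset ι} {F : ι → VField E M} (hF : ∀ i ∈ s, (F i).SmoothAt p) :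
    VField.SmoothAt (fun q => ∑ i ∈ s, F i q) p := by
  have := (s.eventually_all (l := 𝓝 p)).2 hF
  filter_upwards [this] with q h1
  exact ContMDiffAt.sum_section fun i hi => h1 i hi

theorem extendVec {p : M} (v : TangentSpace 𝓘(ℝ, E) p) :
    VField.SmoothAt (extendVec v : VField E M) p := by
  obtain ⟨s, hs, h⟩ := FiberBundle.exists_contMDiffOn_extend (k := ∞) 𝓘(ℝ, E) E v
  filter_upwards [eventually_mem_nhds_iff.2 hs] with q hq
  exact h.contMDiffAt hq

theorem _root_.VField.Smooth.smoothAt (hX : X.Smooth) (p : M) : X.SmoothAt p :=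
  Filter.Eventually.of_forall fun q => hX q

theorem bracket [FiniteDimensional ℝ E] (hX : X.SmoothAt p) (hZ : Z.SmoothAt p) :
    VField.SmoothAt (bracket X Z) p := by
  filter_upwards [hX, hZ] with q h1 h2
  have : IsManifold 𝓘(ℝ, E) ((∞ : WithTop ℕ∞) + 1) M := by
    simpa using (inferInstance : IsManifold 𝓘(ℝ, E) ∞ M)
  have : CompleteSpace E := FiniteDimensional.complete ℝ E
  have : IsManifold 𝓘(ℝ, E) (minSmoothness ℝ 2) M := by
    rw [minSmoothness_of_isRCLikeNormedField]
    exact .of_le (n := ∞) (by norm_cast)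
  have : IsManifold 𝓘(ℝ, E) (minSmoothness ℝ 3) M := by
    rw [minSmoothness_of_isRCLikeNormedField]
    exact .of_le (n := ∞) (by norm_cast)
  exact ContMDiffAt.mlieBracket_vectorField (m := ⊤) (n := ⊤) h1 h2 (by simp)

theorem dirDeriv (hX : X.SmoothAt p) (hf : SmoothFunAt E f p) :
    SmoothFunAt E (dirDeriv X f) p := by
  filter_upwards [hX, hf] with q h1 h2
  have h3 := h2.mfderiv_const (m := ∞) (by simp)
  have h4 := ContMDiffAt.clm_apply_of_inCoordinates (b₁ := fun q : M => q) (b₂ := f)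
    (E₁ := TangentSpace 𝓘(ℝ, E)) (E₂ := TangentSpace 𝓘(ℝ, ℝ)) (v := X) h3 h1 h2
  exact (contMDiff_snd_tangentBundle_modelSpace ℝ 𝓘(ℝ, ℝ)).contMDiffAt.comp q h4

end VField.SmoothAt

@[simp] theorem extendVec_self {p : M} (v : TangentSpace 𝓘(ℝ, E) p) :
    extendVec v p = v := FiberBundle.extend_apply_self E v

/-! ### Lie brackets and the commutator of derivations -/

section bracket

variable {X X' Z Z' : VField E M} {f : M → ℝ} {p : M}

variable [FiniteDimensional ℝ E]

theorem bracket_add_left (hX : X.SmoothAt p) (hX' : X'.SmoothAt p) :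
    bracket (X + X') Z p = bracket X Z p + bracket X' Z p := by
  have : IsManifold 𝓘(ℝ, E) 2 M := .of_le (n := ∞) (by norm_cast)
  have : CompleteSpace E := FiniteDimensional.complete ℝ E
  exact VectorField.mlieBracket_add_left hX.mdifferentiableAt hX'.mdifferentiableAt

theorem bracket_add_right (hZ : Z.SmoothAt p) (hZ' : Z'.SmoothAt p) :
    bracket X (Z + Z') p = bracket X Z p + bracket X Z' p := by
  have : IsManifold 𝓘(ℝ, E) 2 M := .of_le (n := ∞) (by norm_cast)
  have : CompleteSpace E := FiniteDimensional.complete ℝ E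
  exact VectorField.mlieBracket_add_right hZ.mdifferentiableAt hZ'.mdifferentiableAt

theorem bracket_smul_left (hf : SmoothFunAt E f p) (hX : X.SmoothAt p) :
    bracket (f • X) Z p = f p • bracket X Z p - dirDeriv Z f p • X p := by
  have : IsManifold 𝓘(ℝ, E) 2 M := .of_le (n := ∞) (by norm_cast)
  have : CompleteSpace E := FiniteDimensional.complete ℝ E
  have h := VectorField.mlieBracket_smul_left (W := Z) hf.mdifferentiableAt hX.mdifferentiableAt
  rw [neg_smul, neg_add_eq_sub] at h
  exact h

theorem bracket_smul_right (hf : SmoothFunAt E f p) (hZ : Z.SmoothAt p) :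
    bracket X (f • Z) p = f p • bracket X Z p + dirDeriv X f p • Z p := by
  have : IsManifold 𝓘(ℝ, E) 2 M := .of_le (n := ∞) (by norm_cast)
  have : CompleteSpace E := FiniteDimensional.complete ℝ E
  have h := VectorField.mlieBracket_smul_right (V := X) hf.mdifferentiableAt hZ.mdifferentiableAt
  rw [add_comm] at h
  exact h

-- The chart is the one at `p` while the derivative is taken at a nearby `q`: a second
-- differentiation at `p` needs the first derivative on a whole neighbourhood, in one fixed chart.
omit [FiniteDimensional ℝ E] in
theorem dirDeriv_eq_fderiv_extChartAt {q : M} (hq : q ∈ (extChartAt 𝓘(ℝ, E) p).source)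
    (hf : MDifferentiableAt 𝓘(ℝ, E) 𝓘(ℝ, ℝ) f q) :
    dirDeriv X f q = fderiv ℝ (f ∘ (extChartAt 𝓘(ℝ, E) p).symm) (extChartAt 𝓘(ℝ, E) p q)
      (VectorField.mpullbackWithin 𝓘(ℝ, E) 𝓘(ℝ, E) (extChartAt 𝓘(ℝ, E) p).symm X
        (Set.range 𝓘(ℝ, E)) (extChartAt 𝓘(ℝ, E) p q)) := by
  have : IsManifold 𝓘(ℝ, E) 1 M := .of_le (n := ∞) (by norm_cast)
  set φ := extChartAt 𝓘(ℝ, E) p with hφ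
  have hqt : φ q ∈ φ.target := φ.map_source hq
  have hinv := isInvertible_mfderivWithin_extChartAt_symm (I := 𝓘(ℝ, E)) hqt
  have hd : MDifferentiableWithinAt 𝓘(ℝ, E) 𝓘(ℝ, E) φ.symm (Set.range 𝓘(ℝ, E)) (φ q) :=
    mdifferentiableWithinAt_extChartAt_symm hqt
  have hq' : φ.symm (φ q) = q := φ.left_inv hq
  have hf' : MDifferentiableAt 𝓘(ℝ, E) 𝓘(ℝ, ℝ) f (φ.symm (φ q)) := by rwa [hq']
  have hcomp := mfderiv_comp_mfderivWithin (φ q) hf' hd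
    (by simp only [ModelWithCorners.range_eq_univ]; exact uniqueMDiffWithinAt_univ _)
  have e : fderiv ℝ (f ∘ φ.symm) (φ q)
      = mfderivWithin 𝓘(ℝ, E) 𝓘(ℝ, ℝ) (f ∘ φ.symm) (Set.range 𝓘(ℝ, E)) (φ q) := by
    rw [ModelWithCorners.range_eq_univ, mfderivWithin_univ, mfderiv_eq_fderiv]
  have e2 : mfderivWithin 𝓘(ℝ, E) 𝓘(ℝ, E) φ.symm (Set.range 𝓘(ℝ, E)) (φ q)
      (VectorField.mpullbackWithin 𝓘(ℝ, E) 𝓘(ℝ, E) φ.symm X (Set.range 𝓘(ℝ, E)) (φ q))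
      = X (φ.symm (φ q)) := by
    rw [VectorField.mpullbackWithin_apply]
    exact DFunLike.congr_fun hinv.self_comp_inverse _
  rw [e, hcomp]
  change _ = mfderiv 𝓘(ℝ, E) 𝓘(ℝ, ℝ) f (φ.symm (φ q)) (mfderivWithin 𝓘(ℝ, E) 𝓘(ℝ, E) φ.symm
    (Set.range 𝓘(ℝ, E)) (φ q) (VectorField.mpullbackWithin 𝓘(ℝ, E) 𝓘(ℝ, E) φ.symm X
      (Set.range 𝓘(ℝ, E)) (φ q)))
  rw [e2, hq']
  rfl

/-- In a chart, `X(Z f)` is `D²g(X, Z) + Dg(DZ · X)`. The second derivative is symmetric, so only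
`Dg(DZ · X - DX · Z)` survives in the commutator, and this is the bracket applied to `f`. -/
theorem dirDeriv_bracket (hX : X.SmoothAt p) (hZ : Z.SmoothAt p) (hf : SmoothFunAt E f p) :
    dirDeriv (bracket X Z) f p = dirDeriv X (dirDeriv Z f) p - dirDeriv Z (dirDeriv X f) p := by
  have : IsManifold 𝓘(ℝ, E) 2 M := .of_le (n := ∞) (by norm_cast)
  have : CompleteSpace E := FiniteDimensional.complete ℝ E
  set φ := extChartAt 𝓘(ℝ, E) p with hφ
  set g : E → ℝ := f ∘ φ.symm with hg
  let V (X : VField E M) : E → E :=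
    VectorField.mpullbackWithin 𝓘(ℝ, E) 𝓘(ℝ, E) φ.symm X (Set.range 𝓘(ℝ, E))
  have hp : p ∈ φ.source := mem_extChartAt_source p
  have hpt : φ p ∈ φ.target := φ.map_source hp
  have hV {X : VField E M} (hX : X.SmoothAt p) : DifferentiableAt ℝ (V X) (φ p) := by
    have h : DifferentiableWithinAt ℝ (V X) (φ.symm ⁻¹' Set.univ ∩ Set.range 𝓘(ℝ, E)) (φ p) :=
      (hX.mdifferentiableAt.mdifferentiableWithinAt
        (s := Set.univ)).differentiableWithinAt_mpullbackWithin_vectorField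
    rwa [Set.preimage_univ, Set.univ_inter, ModelWithCorners.range_eq_univ,
      differentiableWithinAt_univ] at h
  have hgs : ContDiffAt ℝ 2 g (φ p) := by
    have h1 : ContMDiffAt 𝓘(ℝ, E) 𝓘(ℝ, E) 2 φ.symm (φ p) := by
      have := contMDiffWithinAt_extChartAt_symm_range (I := 𝓘(ℝ, E)) (n := 2) p hpt
      rw [ModelWithCorners.range_eq_univ, contMDiffWithinAt_univ] at this
      exact this
    have h2 : ContMDiffAt 𝓘(ℝ, E) 𝓘(ℝ, ℝ) 2 f (φ.symm (φ p)) := by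
      rw [φ.left_inv hp]
      exact hf.contMDiffAt.of_le (by norm_cast)
    exact (h2.comp (φ p) h1).contDiffAt
  have hdg : DifferentiableAt ℝ (fderiv ℝ g) (φ p) :=
    (hgs.fderiv_right (m := 1) (by norm_num)).differentiableAt (by norm_num)
  have hcont : ContinuousAt φ.symm (φ p) := continuousAt_extChartAt_symm'' hpt
  have key {X Z : VField E M} (hX : X.SmoothAt p) (hZ : Z.SmoothAt p) :
      dirDeriv X (dirDeriv Z f) p = fderiv ℝ (fderiv ℝ g) (φ p) (V X (φ p)) (V Z (φ p))
        + fderiv ℝ g (φ p) (fderiv ℝ (V Z) (φ p) (V X (φ p))) := by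
    rw [dirDeriv_eq_fderiv_extChartAt hp (hZ.dirDeriv hf).mdifferentiableAt]
    have he : (dirDeriv Z f ∘ φ.symm) =ᶠ[𝓝 (φ p)] fun y => fderiv ℝ g y (V Z y) := by
      have h1 : ∀ᶠ y in 𝓝 (φ p), SmoothFunAt E f (φ.symm y) := by
        refine hcont.eventually ?_
        rw [φ.left_inv hp]
        exact hf.eventually
      filter_upwards [h1, extChartAt_target_mem_nhds (I := 𝓘(ℝ, E)) p] with y hy hyt
      simp only [Function.comp_apply]
      rw [dirDeriv_eq_fderiv_extChartAt (φ.map_target hyt) hy.mdifferentiableAt]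
      change fderiv ℝ g (φ (φ.symm y)) (V Z (φ (φ.symm y))) = _
      rw [φ.right_inv hyt]
    change fderiv ℝ (dirDeriv Z f ∘ φ.symm) (φ p) (V X (φ p)) = _
    rw [he.fderiv_eq, fderiv_clm_apply hdg (hV hZ)]
    exact add_comm _ _
  have hb : V (bracket X Z) (φ p)
      = fderiv ℝ (V Z) (φ p) (V X (φ p)) - fderiv ℝ (V X) (φ p) (V Z (φ p)) := by
    have hinv := isInvertible_mfderivWithin_extChartAt_symm (I := 𝓘(ℝ, E)) hpt
    have h1 : bracket X Z p = VectorField.lieBracket ℝ (V X) (V Z) (φ p) := by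
      have h3 : bracket X Z p = (ContinuousLinearMap.id ℝ E).inverse
          (VectorField.lieBracketWithin ℝ (V X) (V Z)
            (φ.symm ⁻¹' Set.univ ∩ Set.range 𝓘(ℝ, E)) (φ p)) := by
        unfold bracket VectorField.mlieBracket
        rw [VectorField.mlieBracketWithin_apply]
        -- The derivative at `p` of the chart based at `p` is the identity, so the bracket at `p` is
        -- the bracket of the coordinate expressions without further transformation.
        exact congrArg (fun A : E →L[ℝ] E => A.inverse _) mfderiv_extChartAt_self
      rw [h3, ContinuousLinearMap.inverse_id, Set.preimage_univ, Set.univ_inter,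
        ModelWithCorners.range_eq_univ, VectorField.lieBracketWithin_univ]
      rfl
    have h2 : V (bracket X Z) (φ p) = bracket X Z p := by
      simp only [V, VectorField.mpullbackWithin_apply]
      rw [φ.left_inv hp]
      exact mfderivWithin_extChartAt_symm_inverse_apply (I := 𝓘(ℝ, E)) (bracket X Z p)
    rw [h2, h1]
    rfl
  rw [key hX hZ, key hZ hX, dirDeriv_eq_fderiv_extChartAt hp hf.mdifferentiableAt]
  change fderiv ℝ g (φ p) (V (bracket X Z) (φ p)) = _
  have hsymm := (hgs.isSymmSndFDerivAt (by simp)) (V X (φ p)) (V Z (φ p))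
  rw [hb, map_sub, hsymm]
  ring

end bracket

end Fields

end Germs

/-! ### Tensorial operations on vector fields and the linear maps they induce -/

section Tensoriality

variable {E : Type*} [NormedAddCommGroup E] [NormedSpace ℝ E] [FiniteDimensional ℝ E]
  {M : Type*} [TopologicalSpace M] [ChartedSpace E M] [IsManifold 𝓘(ℝ, E) ∞ M]
  {A : Type*} [AddCommGroup A] [Module ℝ A]

/-- An operation on vector fields that is linear over the functions smooth near `p`. -/
structure IsTensorialAt (Φ : VField E M → A) (p : M) : Prop where
  add : ∀ {X X' : VField E M}, X.SmoothAt p → X'.SmoothAt p → Φ (X + X') = Φ X + Φ X'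
  smul : ∀ {f : M → ℝ} {X : VField E M}, SmoothFunAt E f p → X.SmoothAt p →
    Φ (f • X) = f p • Φ X

/-- No bump function is needed: the indicator of the set where the two fields agree is equal to `1`
near `p`, and smoothness is only ever required near `p`. -/
theorem exists_cutoff {p : M} {X X' : VField E M} (h : X =ᶠ[𝓝 p] X') :
    ∃ ψ : M → ℝ, ψ =ᶠ[𝓝 p] (fun _ => 1) ∧ SmoothFunAt E ψ p ∧ ψ • X = ψ • X' := by
  classical
  have h1 : (fun q => if X q = X' q then (1 : ℝ) else 0) =ᶠ[𝓝 p] fun _ => 1 := by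
    filter_upwards [h] with q hq
    simp [hq]
  refine ⟨_, h1, (SmoothFunAt.const 1).congr h1, ?_⟩
  funext q
  simp only [Pi.smul_apply']
  split_ifs with hq <;> simp [hq]

namespace IsTensorialAt

variable {Φ : VField E M → A} {p : M} {X X' : VField E M}

/-- Multiplication by a cutoff with value `1` at `p` does not change `Φ`, and it makes the two
fields equal everywhere. -/
theorem congr_of_eventuallyEq (hΦ : IsTensorialAt Φ p) (hX : X.SmoothAt p) (h : X =ᶠ[𝓝 p] X') :
    Φ X = Φ X' := by
  obtain ⟨ψ, h1, h2, h3⟩ := exists_cutoff h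
  have e := hΦ.smul h2 hX
  have e' := hΦ.smul h2 (hX.congr h.symm)
  rw [h1.eq_of_nhds, one_smul] at e e'
  rw [← e, ← e', h3]

theorem zero (hΦ : IsTensorialAt Φ p) : Φ 0 = 0 := by
  have h0 : VField.SmoothAt (0 : VField E M) p :=
    (VField.SmoothAt.sum (s := ∅) (F := fun i : ℕ => (0 : VField E M)) (by simp)).congr
      (Filter.Eventually.of_forall fun q => Finset.sum_empty.symm)
  have := hΦ.smul (SmoothFunAt.const 0) h0
  rwa [zero_smul, smul_zero] at this

theorem sum (hΦ : IsTensorialAt Φ p) {ι : Type*} (s : Finset ι) {F : ι → VField E M}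
    (hF : ∀ i ∈ s, (F i).SmoothAt p) :
    Φ (fun q => ∑ i ∈ s, F i q) = ∑ i ∈ s, Φ (F i) := by
  classical
  induction s using Finset.induction_on with
  | empty =>
    rw [Finset.sum_empty]
    exact hΦ.zero
  | insert a s ha h =>
    simp only [Finset.sum_insert ha]
    rw [← h fun i hi => hF i (by simp [hi])]
    exact hΦ.add (hF a (by simp)) (VField.SmoothAt.sum fun i hi => hF i (by simp [hi]))

/-- Expanding `X` in a local frame near `p` and pulling out the coefficients expresses `Φ X` through
the values of these coefficients at `p`, hence through `X p`. This makes the choice of extension of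
a tangent vector immaterial. -/
theorem congr_of_eq (hΦ : IsTensorialAt Φ p) (hX : X.SmoothAt p) (hX' : X'.SmoothAt p)
    (h : X p = X' p) : Φ X = Φ X' := by
  let t := trivializationAt E (TangentSpace 𝓘(ℝ, E) : M → Type _) p
  have hp : p ∈ t.baseSet := FiberBundle.mem_baseSet_trivializationAt E _ p
  have hnear : ∀ᶠ q in 𝓝 p, q ∈ t.baseSet := t.open_baseSet.mem_nhds hp
  let b := Module.finBasis ℝ E
  let s : Fin (Module.finrank ℝ E) → VField E M := t.localFrame b
  let c := t.localFrameCoeff 𝓘(ℝ, E) b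
  have hs (i) : (s i).SmoothAt p := by
    filter_upwards [hnear] with q hq
    exact contMDiffAt_localFrame_of_mem ∞ t b i hq
  have hc {X : VField E M} (hX : X.SmoothAt p) (i) : SmoothFunAt E (fun q => c i q (X q)) p := by
    filter_upwards [hnear, hX] with q hq h1
    exact contMDiffAt_localFrameCoeff b hq h1 i
  have key {X : VField E M} (hX : X.SmoothAt p) : Φ X = ∑ i, c i p (X p) • Φ (s i) := by
    have e : X =ᶠ[𝓝 p] fun q => ∑ i, ((fun q => c i q (X q)) • s i) q :=
      t.eventually_eq_localFrame_sum_coeff_smul b hp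
    refine (hΦ.congr_of_eventuallyEq hX e).trans
      ((hΦ.sum _ fun i _ => VField.SmoothAt.smul (hc hX i) (hs i)).trans ?_)
    exact Finset.sum_congr rfl fun i _ => hΦ.smul (hc hX i) (hs i)
  rw [key hX, key hX', h]

/-- The linear map on the tangent space at `p` induced by a tensorial operation. -/
def toLinearMap (hΦ : IsTensorialAt Φ p) : TangentSpace 𝓘(ℝ, E) p →ₗ[ℝ] A where
  toFun v := Φ (extendVec v)
  map_add' v w := by
    rw [← hΦ.add (.extendVec v) (.extendVec w)]
    exact hΦ.congr_of_eq (.extendVec _) (.add (.extendVec v) (.extendVec w)) (by simp)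
  map_smul' c v := by
    have := hΦ.smul (SmoothFunAt.const c) (.extendVec v)
    rw [RingHom.id_apply, ← this]
    exact hΦ.congr_of_eq (.extendVec _) (.smul (.const c) (.extendVec v)) (by simp)

theorem toLinearMap_apply (hΦ : IsTensorialAt Φ p) (hX : X.SmoothAt p) :
    hΦ.toLinearMap (X p) = Φ X :=
  hΦ.congr_of_eq (.extendVec _) hX (by simp)

end IsTensorialAt

/-- A smooth one-form. -/
structure OneForm (E : Type*) [NormedAddCommGroup E] [NormedSpace ℝ E] (M : Type*)
    [TopologicalSpace M] [ChartedSpace E M] [IsManifold 𝓘(ℝ, E) ∞ M] where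
  toFun : (p : M) → TangentSpace 𝓘(ℝ, E) p →ₗ[ℝ] ℝ
  smooth' : ∀ {X : VField E M} {p : M}, X.SmoothAt p → SmoothFunAt E (fun q => toFun q (X q)) p

instance : CoeFun (OneForm E M) fun _ => (p : M) → TangentSpace 𝓘(ℝ, E) p →ₗ[ℝ] ℝ :=
  ⟨OneForm.toFun⟩

theorem OneForm.smooth (α : OneForm E M) {X : VField E M} {p : M} (hX : X.SmoothAt p) :
    SmoothFunAt E (fun q => α q (X q)) p := α.smooth' hX

/-- A smooth two-covariant tensor field. -/
structure TwoForm (E : Type*) [NormedAddCommGroup E] [NormedSpace ℝ E] (M : Type*)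
    [TopologicalSpace M] [ChartedSpace E M] [IsManifold 𝓘(ℝ, E) ∞ M] where
  toFun : (p : M) → TangentSpace 𝓘(ℝ, E) p →ₗ[ℝ] TangentSpace 𝓘(ℝ, E) p →ₗ[ℝ] ℝ
  smooth' : ∀ {X Z : VField E M} {p : M}, X.SmoothAt p → Z.SmoothAt p →
    SmoothFunAt E (fun q => toFun q (X q) (Z q)) p

instance : CoeFun (TwoForm E M) fun _ =>
    (p : M) → TangentSpace 𝓘(ℝ, E) p →ₗ[ℝ] TangentSpace 𝓘(ℝ, E) p →ₗ[ℝ] ℝ :=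
  ⟨TwoForm.toFun⟩

theorem TwoForm.smooth (T : TwoForm E M) {X Z : VField E M} {p : M} (hX : X.SmoothAt p)
    (hZ : Z.SmoothAt p) : SmoothFunAt E (fun q => T q (X q) (Z q)) p := T.smooth' hX hZ

/-- The two-covariant tensor field of an operation that is tensorial in both arguments. -/
def TwoForm.ofTensorial (Φ : VField E M → VField E M → M → ℝ)
    (h₁ : ∀ {p : M} {Z : VField E M}, Z.SmoothAt p → IsTensorialAt (fun X => Φ X Z p) p)
    (h₂ : ∀ {p : M} {X : VField E M}, X.SmoothAt p → IsTensorialAt (fun Z => Φ X Z p) p)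
    (hs : ∀ {p : M} {X Z : VField E M}, X.SmoothAt p → Z.SmoothAt p → SmoothFunAt E (Φ X Z) p) :
    TwoForm E M where
  toFun p := LinearMap.mk₂ ℝ (fun x z => Φ (extendVec x) (extendVec z) p)
    (fun x x' z => map_add (h₁ (.extendVec z)).toLinearMap x x')
    (fun c x z => map_smul (h₁ (.extendVec z)).toLinearMap c x)
    (fun x z z' => map_add (h₂ (.extendVec x)).toLinearMap z z')
    (fun c x z => map_smul (h₂ (.extendVec x)).toLinearMap c z)
  smooth' {X Z p} hX hZ := by
    refine (hs hX hZ).congr ?_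
    filter_upwards [hX.eventually, hZ.eventually] with q h3 h4
    rw [← (h₂ h3).toLinearMap_apply h4]
    change _ = Φ X (extendVec (Z q)) q
    rw [← (h₁ (.extendVec (Z q))).toLinearMap_apply h3]
    rfl

theorem TwoForm.ofTensorial_apply {Φ : VField E M → VField E M → M → ℝ}
    (h₁ : ∀ {p : M} {Z : VField E M}, Z.SmoothAt p → IsTensorialAt (fun X => Φ X Z p) p)
    (h₂ : ∀ {p : M} {X : VField E M}, X.SmoothAt p → IsTensorialAt (fun Z => Φ X Z p) p)
    (hs : ∀ {p : M} {X Z : VField E M}, X.SmoothAt p → Z.SmoothAt p → SmoothFunAt E (Φ X Z) p)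
    {p : M} {X Z : VField E M} (hX : X.SmoothAt p) (hZ : Z.SmoothAt p) :
    TwoForm.ofTensorial Φ h₁ h₂ hs p (X p) (Z p) = Φ X Z p := by
  rw [← (h₂ hX).toLinearMap_apply hZ]
  change _ = Φ X (extendVec (Z p)) p
  rw [← (h₁ (.extendVec (Z p))).toLinearMap_apply hX]
  rfl

/-! ### Affine connections -/

/-- The defining properties of an affine connection, near each point. -/
structure IsAffineConnection (D : VField E M → VField E M → VField E M) : Prop where
  smooth : ∀ {X Z : VField E M} {p : M}, X.SmoothAt p → Z.SmoothAt p → (D X Z).SmoothAt p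
  add_left : ∀ {X X' Z : VField E M} {p : M}, X.SmoothAt p → X'.SmoothAt p → Z.SmoothAt p →
    D (X + X') Z p = D X Z p + D X' Z p
  smul_left : ∀ {f : M → ℝ} {X Z : VField E M} {p : M}, SmoothFunAt E f p → X.SmoothAt p →
    Z.SmoothAt p → D (f • X) Z p = f p • D X Z p
  add_right : ∀ {X Z Z' : VField E M} {p : M}, X.SmoothAt p → Z.SmoothAt p → Z'.SmoothAt p →
    D X (Z + Z') p = D X Z p + D X Z' p
  smul_right : ∀ {f : M → ℝ} {X Z : VField E M} {p : M}, SmoothFunAt E f p → X.SmoothAt p →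
    Z.SmoothAt p → D X (f • Z) p = f p • D X Z p + dirDeriv X f p • Z p

/-- The curvature `R(X, W) Z` of a connection. -/
def curvature (D : VField E M → VField E M → VField E M) (X W Z : VField E M) : VField E M :=
  fun p => D X (D W Z) p - D W (D X Z) p - D (bracket X W) Z p

/-- The covariant derivative `(D_X T)(Z, W)` of a two-covariant tensor field. -/
def covDeriv₂ (D : VField E M → VField E M → VField E M) (T : TwoForm E M) (X Z W : VField E M)
    (p : M) : ℝ :=
  dirDeriv X (fun q => T q (Z q) (W q)) p - T p (D X Z p) (W p) - T p (Z p) (D X W p)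

namespace IsAffineConnection

variable {D : VField E M → VField E M → VField E M} {X X' W W' Z Z' : VField E M} {p : M}

theorem tensorial_left (hD : IsAffineConnection D) (hZ : Z.SmoothAt p) :
    IsTensorialAt (fun X => D X Z p) p where
  add h h' := hD.add_left h h' hZ
  smul hf h := hD.smul_left hf h hZ

/-- A connection is tensorial in the direction, so the value at `p` suffices there. In the
differentiated field only locality holds; a cutoff proves it, since its derivative at `p` is zero.
-/
theorem congr (hD : IsAffineConnection D) (hX : X.SmoothAt p) (hX' : X'.SmoothAt p)
    (hZ : Z.SmoothAt p) (e : X p = X' p) (e' : Z =ᶠ[𝓝 p] Z') : D X Z p = D X' Z' p := by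
  rw [(hD.tensorial_left hZ).congr_of_eq hX hX' e]
  obtain ⟨ψ, h1, h2, h3⟩ := exists_cutoff e'
  have a := hD.smul_right h2 hX' hZ
  have b := hD.smul_right h2 hX' (hZ.congr e'.symm)
  rw [dirDeriv_congr h1 rfl, dirDeriv_const, zero_smul, h1.eq_of_nhds, one_smul, add_zero] at a b
  rw [← a, ← b, h3]

theorem sub_left (hD : IsAffineConnection D) (hX : X.SmoothAt p) (hX' : X'.SmoothAt p)
    (hZ : Z.SmoothAt p) : D (X - X') Z p = D X Z p - D X' Z p := by
  rw [eq_sub_iff_add_eq, ← hD.add_left (hX.sub hX') hX' hZ, sub_add_cancel]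

theorem covDeriv₂_tensorial_left (hD : IsAffineConnection D) (T : TwoForm E M)
    (hZ : Z.SmoothAt p) (hW : W.SmoothAt p) :
    IsTensorialAt (fun X => covDeriv₂ D T X Z W p) p where
  add h h' := by
    simp only [covDeriv₂, dirDeriv_add_left, hD.add_left h h' hZ, hD.add_left h h' hW, map_add,
      LinearMap.add_apply]
    ring
  smul hf h := by
    simp only [covDeriv₂, dirDeriv_smul_left, hD.smul_left hf h hZ, hD.smul_left hf h hW,
      map_smul, LinearMap.smul_apply, smul_eq_mul]
    ring

theorem covDeriv₂_tensorial_middle (hD : IsAffineConnection D) (T : TwoForm E M)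
    (hX : X.SmoothAt p) (hW : W.SmoothAt p) :
    IsTensorialAt (fun Z => covDeriv₂ D T X Z W p) p where
  add h h' := by
    simp only [covDeriv₂, Pi.add_apply, map_add, LinearMap.add_apply, hD.add_right hX h h',
      dirDeriv_add (T.smooth h hW) (T.smooth h' hW)]
    ring
  smul hf h := by
    simp only [covDeriv₂, Pi.smul_apply', map_smul, map_add, LinearMap.add_apply,
      LinearMap.smul_apply, smul_eq_mul, hD.smul_right hf hX h, dirDeriv_mul hf (T.smooth h hW)]
    ring

theorem covDeriv₂_tensorial_right (hD : IsAffineConnection D) (T : TwoForm E M)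
    (hX : X.SmoothAt p) (hZ : Z.SmoothAt p) :
    IsTensorialAt (fun W => covDeriv₂ D T X Z W p) p where
  add h h' := by
    simp only [covDeriv₂, Pi.add_apply, map_add, hD.add_right hX h h',
      dirDeriv_add (T.smooth hZ h) (T.smooth hZ h')]
    ring
  smul hf h := by
    simp only [covDeriv₂, Pi.smul_apply', map_smul, map_add, smul_eq_mul, hD.smul_right hf hX h,
      dirDeriv_mul hf (T.smooth hZ h)]
    ring

theorem curvature_swap (hD : IsAffineConnection D) (hX : X.SmoothAt p) (hW : W.SmoothAt p)
    (hZ : Z.SmoothAt p) : curvature D X W Z p = - curvature D W X Z p := by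
  have h : D (bracket X W) Z p = - D (bracket W X) Z p := by
    have h1 : D ((fun _ : M => (-1 : ℝ)) • bracket W X) Z p = - D (bracket W X) Z p := by
      rw [hD.smul_left (.const _) (hW.bracket hX) hZ]; simp
    rw [← h1]
    refine (hD.tensorial_left hZ).congr_of_eq (hX.bracket hW) (.smul (.const _) (hW.bracket hX)) ?_
    rw [bracket_swap]; simp
  simp only [curvature, h]
  abel

/-- The Leibniz term `W(f) D_X Z` of `D_W (f D_X Z)` cancels against the term `-W(f) X` of `[f X,
W]`. -/
theorem curvature_tensorial_left (hD : IsAffineConnection D) (hW : W.SmoothAt p)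
    (hZ : Z.SmoothAt p) : IsTensorialAt (fun X => curvature D X W Z p) p where
  add {X X'} h h' := by
    have e1 : D W (D (X + X') Z) p = D W (D X Z) p + D W (D X' Z) p := by
      rw [← hD.add_right hW (hD.smooth h hZ) (hD.smooth h' hZ)]
      refine hD.congr hW hW (hD.smooth (h.add h') hZ) rfl ?_
      filter_upwards [h.eventually, h'.eventually, hZ.eventually] with q a b c
      exact hD.add_left a b c
    have e2 : D (bracket (X + X') W) Z p = D (bracket X W) Z p + D (bracket X' W) Z p := by
      rw [← hD.add_left (h.bracket hW) (h'.bracket hW) hZ]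
      exact hD.congr ((h.add h').bracket hW) ((h.bracket hW).add (h'.bracket hW)) hZ
        (bracket_add_left h h') .rfl
    simp only [curvature, e1, e2, hD.add_left h h' (hD.smooth hW hZ)]
    abel
  smul {f X} hf h := by
    have e1 : D W (D (f • X) Z) p = f p • D W (D X Z) p + dirDeriv W f p • D X Z p := by
      rw [← hD.smul_right hf hW (hD.smooth h hZ)]
      refine hD.congr hW hW (hD.smooth (h.smul hf) hZ) rfl ?_
      filter_upwards [h.eventually, hf.eventually, hZ.eventually] with q a b c
      exact hD.smul_left b a c
    have e2 : D (bracket (f • X) W) Z p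
        = f p • D (bracket X W) Z p - dirDeriv W f p • D X Z p := by
      rw [← hD.smul_left hf (h.bracket hW) hZ, ← hD.smul_left (hW.dirDeriv hf) h hZ,
        ← hD.sub_left (.smul hf (h.bracket hW)) (.smul (hW.dirDeriv hf) h) hZ]
      exact hD.congr ((h.smul hf).bracket hW)
        (.sub (.smul hf (h.bracket hW)) (.smul (hW.dirDeriv hf) h)) hZ
        (bracket_smul_left hf h) .rfl
    simp only [curvature, e1, e2, hD.smul_left hf h (hD.smooth hW hZ)]
    module

theorem curvature_tensorial_middle (hD : IsAffineConnection D) (hX : X.SmoothAt p)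
    (hZ : Z.SmoothAt p) : IsTensorialAt (fun W => curvature D X W Z p) p where
  add h h' := by
    simp only [hD.curvature_swap hX h hZ, hD.curvature_swap hX h' hZ,
      hD.curvature_swap hX (h.add h') hZ, (hD.curvature_tensorial_left hX hZ).add h h']
    abel
  smul hf h := by
    simp only [hD.curvature_swap hX h hZ, hD.curvature_swap hX (h.smul hf) hZ,
      (hD.curvature_tensorial_left hX hZ).smul hf h, smul_neg]

/-- The mixed first-order terms are symmetric in `X` and `W` and cancel. The second-order terms
leave `(X(W f) - W(X f)) Z`, which the bracket term removes by `dirDeriv_bracket`. -/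
theorem curvature_tensorial_right (hD : IsAffineConnection D) (hX : X.SmoothAt p)
    (hW : W.SmoothAt p) : IsTensorialAt (fun Z => curvature D X W Z p) p where
  add {Z Z'} h h' := by
    have e1 {X W : VField E M} (hX : X.SmoothAt p) (hW : W.SmoothAt p) :
        D X (D W (Z + Z')) p = D X (D W Z) p + D X (D W Z') p := by
      rw [← hD.add_right hX (hD.smooth hW h) (hD.smooth hW h')]
      refine hD.congr hX hX (hD.smooth hW (h.add h')) rfl ?_
      filter_upwards [h.eventually, h'.eventually, hW.eventually] with q a b c
      exact hD.add_right c a b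
    simp only [curvature, e1 hX hW, e1 hW hX, hD.add_right (hX.bracket hW) h h']
    abel
  smul {f Z} hf h := by
    have e1 {X W : VField E M} (hX : X.SmoothAt p) (hW : W.SmoothAt p) :
        D X (D W (f • Z)) p = f p • D X (D W Z) p + dirDeriv X f p • D W Z p
          + (dirDeriv W f p • D X Z p + dirDeriv X (dirDeriv W f) p • Z p) := by
      rw [← hD.smul_right hf hX (hD.smooth hW h), ← hD.smul_right (hW.dirDeriv hf) hX h,
        ← hD.add_right hX (.smul hf (hD.smooth hW h)) (.smul (hW.dirDeriv hf) h)]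
      refine hD.congr hX hX (hD.smooth hW (h.smul hf)) rfl ?_
      filter_upwards [h.eventually, hf.eventually, hW.eventually] with q a b c
      exact hD.smul_right b c a
    simp only [curvature, e1 hX hW, e1 hW hX, hD.smul_right hf (hX.bracket hW) h,
      dirDeriv_bracket hX hW hf]
    module

theorem covDeriv₂_congr (hD : IsAffineConnection D) (T : TwoForm E M) (hX : X.SmoothAt p)
    (hX' : X'.SmoothAt p) (hZ : Z.SmoothAt p) (hZ' : Z'.SmoothAt p) (hW : W.SmoothAt p)
    (hW' : W'.SmoothAt p) (eX : X p = X' p) (eZ : Z p = Z' p) (eW : W p = W' p) :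
    covDeriv₂ D T X Z W p = covDeriv₂ D T X' Z' W' p :=
  ((hD.covDeriv₂_tensorial_left T hZ hW).congr_of_eq hX hX' eX).trans
    (((hD.covDeriv₂_tensorial_middle T hX' hW).congr_of_eq hZ hZ' eZ).trans
      ((hD.covDeriv₂_tensorial_right T hX' hZ').congr_of_eq hW hW' eW))

theorem curvature_congr (hD : IsAffineConnection D) (hX : X.SmoothAt p)
    (hX' : X'.SmoothAt p) (hW : W.SmoothAt p) (hW' : W'.SmoothAt p) (hZ : Z.SmoothAt p)
    (hZ' : Z'.SmoothAt p) (eX : X p = X' p) (eW : W p = W' p) (eZ : Z p = Z' p) :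
    curvature D X W Z p = curvature D X' W' Z' p :=
  ((hD.curvature_tensorial_left hW hZ).congr_of_eq hX hX' eX).trans
    (((hD.curvature_tensorial_middle hX' hZ).congr_of_eq hW hW' eW).trans
      ((hD.curvature_tensorial_right hX' hW').congr_of_eq hZ hZ' eZ))

end IsAffineConnection

end Tensoriality

/-! ### Linear algebra of characteristic data in the characteristic gauge -/

namespace HypersurfaceData

variable {E : Type*} [NormedAddCommGroup E] [NormedSpace ℝ E] [FiniteDimensional ℝ E]
  {M : Type*} [TopologicalSpace M] [ChartedSpace E M] [IsManifold 𝓘(ℝ, E) ∞ M]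
  (D : HypersurfaceData E M)

/-- `γ` as a smooth tensor field. -/
def gammaForm : TwoForm E M where
  toFun p := LinearMap.mk₂ ℝ (fun v w => D.gamma p v w) (by simp) (by simp) (by simp) (by simp)
  smooth' {X Z p} hX hZ := by
    filter_upwards [hX, hZ] with q h1 h2
    have h3 := (D.gamma_smooth q).clm_bundle_apply h1
    have h4 := h3.clm_bundle_apply (F₂ := ℝ) (E₂ := fun _ : M => ℝ) h2
    exact (Bundle.contMDiffAt_totalSpace.1 h4).2

/-- `Y` as a smooth tensor field. -/
def YForm : TwoForm E M where
  toFun p := LinearMap.mk₂ ℝ (fun v w => D.Y p v w) (by simp) (by simp) (by simp) (by simp)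
  smooth' {X Z p} hX hZ := by
    filter_upwards [hX, hZ] with q h1 h2
    have h3 := (D.Y_smooth q).clm_bundle_apply h1
    have h4 := h3.clm_bundle_apply (F₂ := ℝ) (E₂ := fun _ : M => ℝ) h2
    exact (Bundle.contMDiffAt_totalSpace.1 h4).2

/-- `ℓ` as a smooth one-form. -/
def ellForm : OneForm E M where
  toFun p := (D.ell p).toLinearMap
  smooth' {X p} hX := by
    filter_upwards [hX] with q h1
    have h4 := (D.ell_smooth q).clm_bundle_apply (F₂ := ℝ) (E₂ := fun _ : M => ℝ) h1
    exact (Bundle.contMDiffAt_totalSpace.1 h4).2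

@[simp] theorem gammaForm_apply (p : M) (v w : TangentSpace 𝓘(ℝ, E) p) :
    D.gammaForm p v w = D.gamma p v w := rfl

@[simp] theorem YForm_apply (p : M) (v w : TangentSpace 𝓘(ℝ, E) p) :
    D.YForm p v w = D.Y p v w := rfl

variable {D} {X Z : VField E M} {p : M}

theorem smooth_gamma (hX : X.SmoothAt p) (hZ : Z.SmoothAt p) :
    SmoothFunAt E (fun q => D.gamma q (X q) (Z q)) p := D.gammaForm.smooth hX hZ

theorem smooth_Y (hX : X.SmoothAt p) (hZ : Z.SmoothAt p) :
    SmoothFunAt E (fun q => D.Y q (X q) (Z q)) p := D.YForm.smooth hX hZ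

theorem smooth_ell (hX : X.SmoothAt p) : SmoothFunAt E (fun q => D.ell q (X q)) p :=
  D.ellForm.smooth hX

variable (D) in
theorem sharp_spec (p : M) (φ : Module.Dual ℝ (TangentSpace 𝓘(ℝ, E) p × ℝ))
    (w : TangentSpace 𝓘(ℝ, E) p) (b : ℝ) :
    D.gamma p (D.sharp p φ).1 w + (D.sharp p φ).2 * D.ell p w + b * D.ell p (D.sharp p φ).1
      + (D.sharp p φ).2 * b * D.ell2 p = φ (w, b) :=
  LinearMap.BilinForm.apply_toDual_symm_apply (hB := D.nondegenerate p) φ (w, b)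

variable (D) in
theorem sharp_covector_fst (p : M) (α : Module.Dual ℝ (TangentSpace 𝓘(ℝ, E) p)) (c : ℝ)
    (w : TangentSpace 𝓘(ℝ, E) p) :
    D.gamma p (D.sharp p (covector α c)).1 w + (D.sharp p (covector α c)).2 * D.ell p w = α w := by
  have := D.sharp_spec p (covector α c) w 0
  simpa [covector] using this

variable (D) in
theorem sharp_covector_snd (p : M) (α : Module.Dual ℝ (TangentSpace 𝓘(ℝ, E) p)) (c : ℝ) :
    D.ell p (D.sharp p (covector α c)).1 + (D.sharp p (covector α c)).2 * D.ell2 p = c := by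
  have := D.sharp_spec p (covector α c) 0 1
  simpa [covector] using this

-- Non-degeneracy of `𝒜`, tested on `(v, 0)`: the pairing with `(w, b)` is `γ(v, w) + b ℓ(v)`. A
-- tangent vector is thus determined by its `γ`- and `ℓ`-components, which is how vector identities
-- are proved below.
variable (D) in
theorem eq_zero_of_gamma_of_ell {v : TangentSpace 𝓘(ℝ, E) p} (h : ∀ w, D.gamma p v w = 0)
    (h' : D.ell p v = 0) : v = 0 := by
  have := (D.nondegenerate p).1 (v, 0) (fun y => by simp [ambientForm, h, h'])
  exact congrArg Prod.fst this

theorem eq_of_gamma_of_ell {v v' : TangentSpace 𝓘(ℝ, E) p}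
    (h : ∀ w, D.gamma p v w = D.gamma p v' w) (h' : D.ell p v = D.ell p v') : v = v' :=
  sub_eq_zero.1 (D.eq_zero_of_gamma_of_ell (by simp [h]) (by simp [h']))

variable {u : D.FoliationFunction} (hD : D.IsCharacteristic) (hu : u.IsCharacteristicGauge)

include hu in
theorem ell_n (p : M) : D.ell p (D.n p) = 1 := by
  have := D.sharp_covector_snd p 0 1
  rw [hu.ell2_zero, mul_zero, add_zero] at this
  exact this

-- For a nonzero `v` in the radical, `ℓ(v) ≠ 0` by non-degeneracy. Pairing `(n, n⁽²⁾)` with `(v, 0)`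
-- gives `n⁽²⁾ ℓ(v) = 0`.
include hD hu in
theorem n2_eq_zero (p : M) : D.n2 p = 0 := by
  obtain ⟨v, hv, h⟩ := hD.radical p
  have h1 : D.ell p v ≠ 0 := fun h0 => hv (D.eq_zero_of_gamma_of_ell h h0)
  have h2 := D.sharp_covector_fst p 0 1 v
  rw [D.gamma_symm, h] at h2
  rw [zero_add, LinearMap.zero_apply] at h2
  exact (mul_eq_zero.1 h2).resolve_right h1

include hD hu in
theorem gamma_n_left (p : M) (w : TangentSpace 𝓘(ℝ, E) p) : D.gamma p (D.n p) w = 0 := by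
  have h2 := D.sharp_covector_fst p 0 1 w
  have h3 : (D.sharp p (covector 0 1)).2 = 0 := n2_eq_zero hD hu p
  rw [h3, zero_mul, add_zero] at h2
  exact h2

include hD hu in
theorem gamma_n_right (p : M) (w : TangentSpace 𝓘(ℝ, E) p) : D.gamma p w (D.n p) = 0 := by
  rw [D.gamma_symm, gamma_n_left hD hu]

-- The forms `ℓ` and `du` both vanish on the leaves, so they are proportional; the factor is found
-- from `ℓ(n) = 1` and `du(n) = λ`.
include hu in
theorem ell_eq (p : M) (v : TangentSpace 𝓘(ℝ, E) p) :
    D.ell p v = mvfderiv 𝓘(ℝ, E) u.toFun p v / u.lam p := by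
  have h := hu.ell_tangent p (u.proj p v)
  simp only [FoliationFunction.proj, map_sub, map_smul, ell_n hu, smul_eq_mul, mul_one] at h
  linarith

include hu in
theorem mem_leafSpace_iff {v : TangentSpace 𝓘(ℝ, E) p} : v ∈ u.leafSpace p ↔ D.ell p v = 0 := by
  have h0 : u.lam p ≠ 0 := u.ne_zero p
  rw [ell_eq hu, div_eq_zero_iff, or_iff_left h0]
  rfl

include hu in
theorem coe_proj (p : M) (v : TangentSpace 𝓘(ℝ, E) p) :
    (u.proj p v : TangentSpace 𝓘(ℝ, E) p) = v - D.ell p v • D.n p := by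
  rw [ell_eq hu]; rfl

-- Cauchy–Schwarz for a semi-definite form: `γ(w + t…)`-type quadratics `γ(v + t w, v + t w) ≥ 0`
-- with zero constant term have discriminant `4 γ(v, w)²`, which must be nonpositive.
include hD in
theorem gamma_eq_zero_of_self {v : TangentSpace 𝓘(ℝ, E) p} (h : D.gamma p v v = 0)
    (w : TangentSpace 𝓘(ℝ, E) p) : D.gamma p v w = 0 := by
  have key : ∀ t : ℝ, 0 ≤ D.gamma p w w * (t * t) + 2 * D.gamma p v w * t + 0 := fun t => by
    have := hD.nonneg p (v + t • w)
    simp only [map_add, map_smul, add_apply, FunLike.coe_smul, Pi.smul_apply, smul_eq_mul, h,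
      D.gamma_symm p w v] at this
    linarith
  have := discrim_le_zero key
  simp only [discrim] at this
  nlinarith [sq_nonneg (D.gamma p v w)]

include hD in
theorem eq_zero_of_gamma_self {v : TangentSpace 𝓘(ℝ, E) p} (h : D.gamma p v v = 0)
    (h' : D.ell p v = 0) : v = 0 :=
  D.eq_zero_of_gamma_of_ell (gamma_eq_zero_of_self hD h) h'

include hu in
theorem finrank_leafSpace (p : M) :
    Module.finrank ℝ (u.leafSpace p) = Module.finrank ℝ E - 1 := by
  have h0 : (mvfderiv 𝓘(ℝ, E) u.toFun p).toLinearMap ≠ 0 := fun h =>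
    u.ne_zero p (DFunLike.congr_fun h (D.n p))
  have := Module.Dual.finrank_ker_add_one_of_ne_zero h0
  change Module.finrank ℝ (u.leafSpace p) + 1 = Module.finrank ℝ E at this
  omega

/-! ### Orthonormal frames of the leaves -/

namespace FoliationFunction

variable {ι : Type*} [Fintype ι] [DecidableEq ι]

/-- The fields `e` form an orthonormal basis of the tangent space of the leaf at `q`. -/
structure IsLeafFrame (u : D.FoliationFunction) (e : ι → VField E M) (q : M) : Prop where
  tangent : ∀ k, e k q ∈ u.leafSpace q
  orthonormal : ∀ i j, D.gamma q (e i q) (e j q) = if i = j then 1 else 0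
  span : ∀ v ∈ u.leafSpace q, v = ∑ k, D.gamma q v (e k q) • e k q

namespace IsLeafFrame

variable {e : ι → VField E M} {q : M}

/-- The frame at `q` as vectors of the tangent space of the leaf. -/
def vec (he : u.IsLeafFrame e q) (k : ι) : u.leafSpace q := ⟨e k q, he.tangent k⟩

/-- The matrix `∑_k e_k^i e_k^j` is a right inverse of the Gram matrix of the chosen basis, because
each basis vector equals its orthonormal expansion. Contractions in the arbitrary basis thereby
become sums over the frame. -/
theorem hInv_eq (he : u.IsLeafFrame e q) (i j : Fin (Module.finrank ℝ (u.leafSpace q))) :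
    u.hInv q i j = ∑ k, (Module.finBasis ℝ (u.leafSpace q)).coord i (he.vec k)
      * (Module.finBasis ℝ (u.leafSpace q)).coord j (he.vec k) := by
  set b := Module.finBasis ℝ (u.leafSpace q) with hb
  let G : Matrix (Fin (Module.finrank ℝ (u.leafSpace q))) (Fin (Module.finrank ℝ (u.leafSpace q)))
    ℝ := Matrix.of fun i j => u.h q (b i) (b j)
  let N : Matrix (Fin (Module.finrank ℝ (u.leafSpace q))) (Fin (Module.finrank ℝ (u.leafSpace q)))
    ℝ := Matrix.of fun i j => ∑ k, b.coord i (he.vec k) * b.coord j (he.vec k)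
  have hcoord (v w : u.leafSpace q) : ∑ j, u.h q v (b j) * b.coord j w = u.h q v w := by
    conv_rhs => rw [← b.sum_repr w]
    simp only [h, Submodule.coe_sum, Submodule.coe_smul, map_sum, map_smul, smul_eq_mul]
    exact Finset.sum_congr rfl fun j _ => mul_comm _ _
  have hGN : G * N = 1 := by
    ext i l
    simp only [G, N, Matrix.mul_apply, Matrix.of_apply, Finset.mul_sum]
    rw [Finset.sum_comm]
    have e1 : ∀ k, ∑ j, u.h q (b i) (b j) * (b.coord j (he.vec k) * b.coord l (he.vec k))
        = u.h q (b i) (he.vec k) * b.coord l (he.vec k) := fun k => by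
      rw [← hcoord, Finset.sum_mul]
      exact Finset.sum_congr rfl fun j _ => (mul_assoc _ _ _).symm
    simp only [e1]
    have e2 : b i = ∑ k, u.h q (b i) (he.vec k) • he.vec k := by
      apply Subtype.ext
      simp only [Submodule.coe_sum, Submodule.coe_smul]
      exact he.span _ (b i).2
    have e3 := congrArg (b.coord l) e2
    rw [map_sum] at e3
    simp only [map_smul, smul_eq_mul] at e3
    rw [← e3, Module.Basis.coord_apply, Module.Basis.repr_self, Finsupp.single_apply,
      Matrix.one_apply]
  have : u.hInv q = N := Matrix.inv_eq_right_inv hGN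
  rw [this]; rfl

theorem trh_eq_sum (he : u.IsLeafFrame e q) {T : u.leafSpace q → u.leafSpace q → ℝ}
    (B : TangentSpace 𝓘(ℝ, E) q →ₗ[ℝ] TangentSpace 𝓘(ℝ, E) q →ₗ[ℝ] ℝ)
    (hT : ∀ v w, T v w = B v w) : u.trh q T = ∑ k, B (e k q) (e k q) := by
  simp only [trh, he.hInv_eq, hT, Finset.sum_mul]
  set b := Module.finBasis ℝ (u.leafSpace q) with hb
  have hv (k : ι) : e k q = ∑ i, b.coord i (he.vec k) • (b i : TangentSpace 𝓘(ℝ, E) q) := by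
    have := congrArg Subtype.val (b.sum_repr (he.vec k))
    simp only [Submodule.coe_sum, Submodule.coe_smul] at this
    exact this.symm
  have e1 : ∀ k, B (e k q) (e k q) = ∑ i, ∑ j, b.coord i (he.vec k) * b.coord j (he.vec k)
      * B (b i) (b j) := fun k => by
    rw [hv k]
    simp only [map_sum, map_smul, LinearMap.sum_apply, LinearMap.smul_apply, smul_eq_mul,
      Finset.mul_sum]
    rw [Finset.sum_comm]
    refine Finset.sum_congr rfl fun i _ => Finset.sum_congr rfl fun j _ => by ring
  simp only [e1]
  rw [Finset.sum_comm (s := Finset.univ (α := ι))]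
  exact Finset.sum_congr rfl fun i _ => Finset.sum_comm

theorem coe_sharph (he : u.IsLeafFrame e q) {α : u.leafSpace q → ℝ}
    (a : TangentSpace 𝓘(ℝ, E) q →ₗ[ℝ] ℝ) (hα : ∀ v, α v = a v) :
    (u.sharph q α : TangentSpace 𝓘(ℝ, E) q) = ∑ k, a (e k q) • e k q := by
  simp only [sharph, he.hInv_eq, hα, Finset.sum_mul]
  set b := Module.finBasis ℝ (u.leafSpace q) with hb
  have hv (k : ι) : e k q = ∑ i, b.coord i (he.vec k) • (b i : TangentSpace 𝓘(ℝ, E) q) := by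
    have := congrArg Subtype.val (b.sum_repr (he.vec k))
    simp only [Submodule.coe_sum, Submodule.coe_smul] at this
    exact this.symm
  have e1 : ∀ k, a (e k q) • e k q = ∑ i, ∑ j, (b.coord i (he.vec k) * b.coord j (he.vec k)
      * a (b i)) • (b j : TangentSpace 𝓘(ℝ, E) q) := fun k => by
    rw [hv k]
    simp only [map_sum, map_smul, smul_eq_mul, Finset.smul_sum, smul_smul, Finset.sum_mul,
      Finset.sum_smul]
    rw [Finset.sum_comm]
    refine Finset.sum_congr rfl fun i _ => Finset.sum_congr rfl fun j _ => by congr 1; ring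
  simp only [e1, Submodule.coe_sum, Submodule.coe_smul, Finset.sum_smul]
  rw [Finset.sum_comm (s := Finset.univ (α := ι))]
  exact Finset.sum_congr rfl fun i _ => Finset.sum_comm

-- As `ℓ⁽²⁾ = 0`, the vector `P(α, ·)` satisfies `ℓ = 0` and so is tangent to the leaf. Its product
-- with `e_k` is `α(e_k)`, since `ℓ(e_k) = 0`, and the orthonormal expansion gives the claim.
include hD hu in
theorem P_eq_sum (he : u.IsLeafFrame e q) (α β : Module.Dual ℝ (TangentSpace 𝓘(ℝ, E) q)) :
    D.P q α β = ∑ k, α (e k q) * β (e k q) := by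
  set V := (D.sharp q (covector α 0)).1 with hV
  have h1 : D.ell q V = 0 := by
    have := D.sharp_covector_snd q α 0
    rwa [hu.ell2_zero, mul_zero, add_zero] at this
  have h2 : ∀ k, D.gamma q V (e k q) = α (e k q) := fun k => by
    have := D.sharp_covector_fst q α 0 (e k q)
    rwa [(mem_leafSpace_iff hu).1 (he.tangent k), mul_zero, add_zero] at this
  have h3 := he.span V ((mem_leafSpace_iff hu).2 h1)
  have h4 : D.P q α β = β V := by simp [P, covector, hV]
  rw [h4, h3]
  simp only [map_sum, map_smul, h2, smul_eq_mul]

include hD hu in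
theorem trP_eq_sum (he : u.IsLeafFrame e q)
    {T : TangentSpace 𝓘(ℝ, E) q → TangentSpace 𝓘(ℝ, E) q → ℝ}
    (B : TangentSpace 𝓘(ℝ, E) q →ₗ[ℝ] TangentSpace 𝓘(ℝ, E) q →ₗ[ℝ] ℝ)
    (hT : ∀ v w, T v w = B v w) : D.trP q T = ∑ k, B (e k q) (e k q) := by
  simp only [trP, he.P_eq_sum hD hu, hT, Finset.sum_mul]
  set b := Module.finBasis ℝ (TangentSpace 𝓘(ℝ, E) q) with hb
  have e1 : ∀ k, B (e k q) (e k q) = ∑ i, ∑ j, b.coord i (e k q) * b.coord j (e k q)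
      * B (b i) (b j) := fun k => by
    conv_lhs => rw [← b.sum_repr (e k q)]
    simp only [map_sum, map_smul, LinearMap.sum_apply, LinearMap.smul_apply, smul_eq_mul,
      Finset.mul_sum]
    rw [Finset.sum_comm]
    refine Finset.sum_congr rfl fun i _ => Finset.sum_congr rfl fun j _ => ?_
    simp only [Module.Basis.coord_apply]
    ring
  simp only [e1]
  rw [Finset.sum_comm (s := Finset.univ (α := ι))]
  exact Finset.sum_congr rfl fun i _ => Finset.sum_comm

include hD hu in
theorem sub_ell_smul_n (he : u.IsLeafFrame e q) (v : TangentSpace 𝓘(ℝ, E) q) :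
    v - D.ell q v • D.n q = ∑ k, D.gamma q v (e k q) • e k q := by
  have h := he.span (u.proj q v) (u.proj q v).2
  have h' : ∀ w, D.gamma q (u.proj q v) w = D.gamma q v w := fun w => by
    rw [coe_proj hu, ← D.gammaForm_apply, map_sub, map_smul]
    simp only [LinearMap.sub_apply, LinearMap.smul_apply, gammaForm_apply, gamma_n_left hD hu,
      smul_zero, sub_zero]
  simp only [h'] at h
  rw [← h, coe_proj hu]

-- A dimension count: pairing with the `e_k` maps the leaf space onto a space of the same dimension,
-- hence injectively, and a vector has the same pairings as its orthonormal expansion.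
include hu in
theorem of_card {e : Fin (Module.finrank ℝ E - 1) → VField E M} {q : M}
    (ht : ∀ k, D.ell q (e k q) = 0)
    (ho : ∀ i j, D.gamma q (e i q) (e j q) = if i = j then 1 else 0) : u.IsLeafFrame e q where
  tangent k := (mem_leafSpace_iff hu).2 (ht k)
  orthonormal := ho
  span v hv := by
    let A : u.leafSpace q →ₗ[ℝ] (Fin (Module.finrank ℝ E - 1) → ℝ) :=
      LinearMap.pi fun k => ((D.gammaForm q).flip (e k q)).comp (u.leafSpace q).subtype
    have hA : ∀ (w : u.leafSpace q) k, A w k = D.gamma q w (e k q) := fun _ _ => rfl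
    have hcomb (c : Fin (Module.finrank ℝ E - 1) → ℝ) : ∑ k, c k • e k q ∈ u.leafSpace q :=
      Submodule.sum_mem _ fun k _ => Submodule.smul_mem _ _ ((mem_leafSpace_iff hu).2 (ht k))
    have hAc (c : Fin (Module.finrank ℝ E - 1) → ℝ) : A ⟨_, hcomb c⟩ = c := by
      funext k
      rw [hA, ← D.gammaForm_apply]
      simp only [map_sum, map_smul, LinearMap.sum_apply, LinearMap.smul_apply, gammaForm_apply, ho]
      simp
    have hinj : Function.Injective A :=
      (LinearMap.injective_iff_surjective_of_finrank_eq_finrank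
        (by rw [finrank_leafSpace hu]; simp)).2 fun c => ⟨_, hAc c⟩
    have := hinj ((hAc (A ⟨v, hv⟩)).symm)
    exact congrArg Subtype.val this

end IsLeafFrame

-- Gram–Schmidt carried out on fields, adding one field at a time. The field `n` is not yet known to
-- be smooth, so tangency to the leaves is arranged with an auxiliary smooth field `U` that agrees
-- with `n` only at `p`.
include hD hu in
theorem exists_orthonormal_fields (p : M) (k : ℕ) (hk : k ≤ Module.finrank ℝ E - 1) :
    ∃ e : Fin k → VField E M, (∀ i, (e i).SmoothAt p) ∧ ∀ᶠ q in 𝓝 p,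
      (∀ i, D.ell q (e i q) = 0) ∧
      ∀ i j, D.gamma q (e i q) (e j q) = if i = j then 1 else 0 := by
  induction k with
  | zero => exact ⟨fun i => i.elim0, fun i => i.elim0, by simp⟩
  | succ k ih =>
    obtain ⟨e, hs, he⟩ := ih (by omega)
    let A : u.leafSpace p →ₗ[ℝ] (Fin k → ℝ) :=
      LinearMap.pi fun k => ((D.gammaForm p).flip (e k p)).comp (u.leafSpace p).subtype
    -- Fewer than `dim E - 1` vectors have been found, so some nonzero leaf vector at `p` is
    -- orthogonal to all of them.
    obtain ⟨v, hv, hv0⟩ := Submodule.exists_mem_ne_zero_of_ne_bot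
      (LinearMap.ker_ne_bot_of_finrank_lt (f := A) (by rw [finrank_leafSpace hu]; simp; omega))
    have hve : ∀ i, D.gamma p v (e i p) = 0 := fun i => congrFun (LinearMap.mem_ker.1 hv) i
    have hvl : D.ell p v = 0 := hu.ell_tangent p v
    let V₀ : VField E M := extendVec (v : TangentSpace 𝓘(ℝ, E) p)
    let U : VField E M := extendVec (D.n p)
    have hU : U.SmoothAt p := .extendVec _
    have hV₀ : V₀.SmoothAt p := .extendVec _
    have hU1 : D.ell p (U p) = 1 := by simp only [U, extendVec_self]; exact ell_n hu p
    have hU0 : D.ell p (U p) ≠ 0 := by rw [hU1]; exact one_ne_zero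
    -- `V₁` is corrected to be tangent to the leaves and `V₂` to be orthogonal to the earlier
    -- fields. Both corrections vanish at `p`, so `V₂ p = v` is nonzero and normalization is
    -- possible nearby.
    let V₁ : VField E M := V₀ - (fun q => D.ell q (V₀ q) / D.ell q (U q)) • U
    have hV₁ : V₁.SmoothAt p := hV₀.sub (hU.smul ((smooth_ell hV₀).div (smooth_ell hU) hU0))
    let V₂ : VField E M := V₁ - fun q => ∑ i, ((fun q => D.gamma q (V₁ q) (e i q)) • e i) q
    have hV₂ : V₂.SmoothAt p := hV₁.sub (.sum fun i _ => (hs i).smul (smooth_gamma hV₁ (hs i)))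
    have hV₁p : V₁ p = v := by
      simp [V₁, V₀, hvl]
    have hV₂p : V₂ p = v := by
      simp only [V₂, Pi.sub_apply, Pi.smul_apply', hV₁p, hve]
      simp
    have hpos : D.gamma p (V₂ p) (V₂ p) ≠ 0 := fun h => hv0 <| Subtype.ext <| by
      rw [hV₂p] at h
      exact eq_zero_of_gamma_self hD h hvl
    have hpos' : 0 < D.gamma p (V₂ p) (V₂ p) := lt_of_le_of_ne (hD.nonneg p _) hpos.symm
    have hγ := smooth_gamma (D := D) hV₂ hV₂
    let s : M → ℝ := fun q => (Real.sqrt (D.gamma q (V₂ q) (V₂ q)))⁻¹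
    have hφ (t : ℝ) (ht : 0 < t) : ContDiffAt ℝ ∞ (fun t => (Real.sqrt t)⁻¹) t :=
      (Real.contDiffAt_sqrt ht.ne').inv (Real.sqrt_pos.2 ht).ne'
    have hsm : SmoothFunAt E s p :=
      hγ.comp (φ := fun t => (Real.sqrt t)⁻¹) ((lt_mem_nhds hpos').mono hφ)
    refine ⟨Fin.cons (s • V₂) e, fun i => ?_, ?_⟩
    · refine Fin.cases ?_ (fun i => ?_) i
      · exact hV₂.smul hsm
      · exact hs i
    · filter_upwards [he, hγ.continuousAt.eventually (lt_mem_nhds hpos'),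
        (smooth_ell (D := D) hU).continuousAt.eventually_ne hU0] with q ⟨ht, ho⟩ hq hUq
      have h1 : D.ell q (V₁ q) = 0 := by
        simp only [V₁, Pi.sub_apply, Pi.smul_apply', map_sub, map_smul, smul_eq_mul]
        field_simp
        ring
      have h2 : D.ell q (V₂ q) = 0 := by
        simp only [V₂, Pi.sub_apply, Pi.smul_apply', map_sub, map_sum, map_smul, smul_eq_mul, ht,
          h1]
        simp
      have h3 : ∀ j, D.gamma q (V₂ q) (e j q) = 0 := fun j => by
        rw [← D.gammaForm_apply]
        simp only [V₂, Pi.sub_apply, Pi.smul_apply', map_sub, map_sum, map_smul, smul_eq_mul,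
          LinearMap.sub_apply, LinearMap.sum_apply, LinearMap.smul_apply, gammaForm_apply, ho]
        simp
      have h4 : s q * s q * D.gamma q (V₂ q) (V₂ q) = 1 := by
        simp only [s, ← mul_inv, Real.mul_self_sqrt hq.le]
        exact inv_mul_cancel₀ hq.ne'
      refine ⟨fun i => ?_, fun i j => ?_⟩
      · refine Fin.cases ?_ (fun i => ?_) i
        · simp [h2]
        · exact ht i
      · refine Fin.cases ?_ (fun i => ?_) i <;> refine Fin.cases ?_ (fun j => ?_) j
        · rw [← D.gammaForm_apply]
          simp only [Fin.cons_zero, Pi.smul_apply', map_smul, LinearMap.smul_apply, smul_eq_mul,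
            gammaForm_apply, if_true]
          rw [← mul_assoc, h4]
        · rw [← D.gammaForm_apply]
          simp only [Fin.cons_zero, Fin.cons_succ, Pi.smul_apply', map_smul,
            LinearMap.smul_apply, smul_eq_mul, gammaForm_apply, h3]
          simp [(Fin.succ_ne_zero _).symm]
        · simp only [Fin.cons_zero, Fin.cons_succ, Pi.smul_apply', map_smul, smul_eq_mul]
          rw [D.gamma_symm, h3]
          simp
        · simp [ho]

include hD hu in
theorem exists_isLeafFrame (p : M) : ∃ e : Fin (Module.finrank ℝ E - 1) → VField E M,
    (∀ i, (e i).SmoothAt p) ∧ ∀ᶠ q in 𝓝 p, u.IsLeafFrame e q := by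
  obtain ⟨e, hs, he⟩ := exists_orthonormal_fields hD hu p _ le_rfl
  exact ⟨e, hs, he.mono fun q h => .of_card hu h.1 h.2⟩

end FoliationFunction

-- Removing from a smooth `U` with `ℓ(U) ≠ 0` its leaf part in a smooth orthonormal frame leaves
-- `ℓ(U) n`; division by the smooth function `ℓ(U)` gives `n`.
include hD hu in
theorem smoothAt_n (p : M) : VField.SmoothAt D.n p := by
  obtain ⟨e, hs, he⟩ := FoliationFunction.exists_isLeafFrame hD hu p
  let U : VField E M := extendVec (D.n p)
  have hU : U.SmoothAt p := .extendVec _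
  have hU1 : D.ell p (U p) = 1 := by simp only [U, extendVec_self]; exact ell_n hu p
  have hU0 : D.ell p (U p) ≠ 0 := by rw [hU1]; exact one_ne_zero
  let W : VField E M := U - fun q => ∑ i, ((fun q => D.gamma q (U q) (e i q)) • e i) q
  have hW : W.SmoothAt p := hU.sub (.sum fun i _ => (hs i).smul (smooth_gamma hU (hs i)))
  refine (hW.smul ((smooth_ell (D := D) hU).inv hU0)).congr ?_
  filter_upwards [he, (smooth_ell (D := D) hU).continuousAt.eventually_ne hU0] with q hq hUq
  change D.n q = (D.ell q (U q))⁻¹ • (U q - ∑ i, D.gamma q (U q) (e i q) • e i q)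
  rw [← hq.sub_ell_smul_n hD hu, sub_sub_cancel]
  rw [smul_smul, inv_mul_cancel₀ hUq, one_smul]

include hD hu in
/-- A vector field with smooth `γ` and `ℓ` components is smooth. -/
theorem smoothAt_of_gamma_of_ell {V : VField E M}
    (h : ∀ W : VField E M, W.SmoothAt p → SmoothFunAt E (fun q => D.gamma q (V q) (W q)) p)
    (h' : SmoothFunAt E (fun q => D.ell q (V q)) p) : V.SmoothAt p := by
  obtain ⟨e, hs, he⟩ := FoliationFunction.exists_isLeafFrame hD hu p
  have hW : VField.SmoothAt ((fun q => ∑ i, ((fun q => D.gamma q (V q) (e i q)) • e i) q)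
      + (fun q => D.ell q (V q)) • D.n) p :=
    .add (.sum fun i _ => (hs i).smul (h _ (hs i))) ((smoothAt_n hD hu p).smul h')
  refine hW.congr ?_
  filter_upwards [he] with q hq
  change V q = ∑ i, D.gamma q (V q) (e i q) • e i q + D.ell q (V q) • D.n q
  rw [← hq.sub_ell_smul_n hD hu, sub_add_cancel]

end HypersurfaceData

/-! ### Chain rule for functions of a function -/

section Chain

variable {E : Type*} [NormedAddCommGroup E] [NormedSpace ℝ E]
  {M : Type*} [TopologicalSpace M] [ChartedSpace E M]

theorem dirDeriv_comp {φ : ℝ → ℝ} {c : ℝ} {f : M → ℝ} {p : M} {X : VField E M}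
    (hf : SmoothFunAt E f p) (hφ : HasDerivAt φ c (f p)) :
    dirDeriv X (fun q => φ (f q)) p = c * dirDeriv X f p := by
  have h := hφ.hasFDerivAt.hasMFDerivAt.comp p hf.mdifferentiableAt.hasMFDerivAt
  unfold dirDeriv mvfderiv
  have h' : mfderiv 𝓘(ℝ, E) 𝓘(ℝ, ℝ) (fun q => φ (f q)) p = _ := h.mfderiv
  rw [h']
  exact mul_comm _ _

theorem dirDeriv_inv {f : M → ℝ} {p : M} {X : VField E M} (hf : SmoothFunAt E f p)
    (h0 : f p ≠ 0) : dirDeriv X (fun q => (f q)⁻¹) p = -((f p) ^ 2)⁻¹ * dirDeriv X f p :=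
  dirDeriv_comp hf (hasDerivAt_inv h0)

end Chain

namespace HypersurfaceData

variable {E : Type*} [NormedAddCommGroup E] [NormedSpace ℝ E] [FiniteDimensional ℝ E]
  {M : Type*} [TopologicalSpace M] [ChartedSpace E M] [IsManifold 𝓘(ℝ, E) ∞ M]
  {D : HypersurfaceData E M} {X X' Z Z' W W' V V' : VField E M} {f : M → ℝ} {p : M}
  {u : D.FoliationFunction} (hD : D.IsCharacteristic) (hu : u.IsCharacteristicGauge)

/-! ### The tensor `K` -/

theorem gamma_add_left (p : M) (v v' w : TangentSpace 𝓘(ℝ, E) p) :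
    D.gamma p (v + v') w = D.gamma p v w + D.gamma p v' w := by simp

theorem gamma_sub_left (p : M) (v v' w : TangentSpace 𝓘(ℝ, E) p) :
    D.gamma p (v - v') w = D.gamma p v w - D.gamma p v' w := by simp

theorem gamma_smul_left (p : M) (c : ℝ) (v w : TangentSpace 𝓘(ℝ, E) p) :
    D.gamma p (c • v) w = c * D.gamma p v w := by simp

theorem gamma_add_right (p : M) (v w w' : TangentSpace 𝓘(ℝ, E) p) :
    D.gamma p v (w + w') = D.gamma p v w + D.gamma p v w' := by simp

theorem gamma_sub_right (p : M) (v w w' : TangentSpace 𝓘(ℝ, E) p) :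
    D.gamma p v (w - w') = D.gamma p v w - D.gamma p v w' := by simp

theorem gamma_smul_right (p : M) (c : ℝ) (v w : TangentSpace 𝓘(ℝ, E) p) :
    D.gamma p v (c • w) = c * D.gamma p v w := by simp

theorem lieDeriv_gamma_symm (N V W : VField E M) (p : M) :
    lieDeriv₂ N (fun q x y => D.gamma q x y) V W p
      = lieDeriv₂ N (fun q x y => D.gamma q x y) W V p := by
  have h : (fun q => D.gamma q (V q) (W q)) = fun q => D.gamma q (W q) (V q) :=
    funext fun q => D.gamma_symm q _ _
  simp only [lieDeriv₂, h]
  rw [D.gamma_symm p (bracket N V p), D.gamma_symm p (V p)]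
  ring

/-- The term `N(f) γ(V, W)` from the product rule cancels the one from `[N, f V] = f [N, V] + N(f)
V`. -/
theorem lieDeriv_gamma_tensorial_left {N : VField E M} (hW : W.SmoothAt p) :
    IsTensorialAt (fun V => lieDeriv₂ N (fun q x y => D.gamma q x y) V W p / 2) p where
  add {V V'} h h' := by
    simp only [lieDeriv₂, Pi.add_apply, gamma_add_left, bracket_add_right h h',
      dirDeriv_add (smooth_gamma (D := D) h hW) (smooth_gamma h' hW)]
    ring
  smul {f V} hf h := by
    simp only [lieDeriv₂, Pi.smul_apply', gamma_add_left, gamma_smul_left,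
      bracket_smul_right hf h, dirDeriv_mul hf (smooth_gamma (D := D) h hW), smul_eq_mul]
    ring

theorem lieDeriv_gamma_tensorial_right {N : VField E M} (hV : V.SmoothAt p) :
    IsTensorialAt (fun W => lieDeriv₂ N (fun q x y => D.gamma q x y) V W p / 2) p := by
  simp only [lieDeriv_gamma_symm N V]
  exact lieDeriv_gamma_tensorial_left hV

/-- The tensor `𝓛_n γ / 2`. -/
def KForm (hn : ∀ p, VField.SmoothAt D.n p) : TwoForm E M :=
  .ofTensorial (fun V W p => lieDeriv₂ D.n (fun q x y => D.gamma q x y) V W p / 2)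
    (fun hW => lieDeriv_gamma_tensorial_left hW)
    (fun hV => lieDeriv_gamma_tensorial_right hV)
    (fun {p} {V W} hV hW => by
      unfold lieDeriv₂
      exact ((((hn p).dirDeriv (smooth_gamma hV hW)).sub
        (smooth_gamma ((hn p).bracket hV) hW)).sub
          (smooth_gamma hV ((hn p).bracket hW))).div (.const 2) two_ne_zero)

theorem KForm_apply (hn : ∀ p, VField.SmoothAt D.n p) (hV : V.SmoothAt p) (hW : W.SmoothAt p) :
    KForm hn p (V p) (W p) = lieDeriv₂ D.n (fun q x y => D.gamma q x y) V W p / 2 :=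
  (TwoForm.ofTensorial_apply (Φ := fun V W p => lieDeriv₂ D.n (fun q x y => D.gamma q x y) V W p / 2)
    (fun hW => lieDeriv_gamma_tensorial_left hW) (fun hV => lieDeriv_gamma_tensorial_right hV)
    (fun {p} {V W} hV hW => by
      unfold lieDeriv₂
      exact ((((hn p).dirDeriv (smooth_gamma hV hW)).sub
        (smooth_gamma ((hn p).bracket hV) hW)).sub
          (smooth_gamma hV ((hn p).bracket hW))).div (.const 2) two_ne_zero) hV hW :)

include hD hu

theorem K_eq_KForm (p : M) (v w : TangentSpace 𝓘(ℝ, E) p) :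
    D.K p v w = KForm (smoothAt_n hD hu) p v w := by
  have h : D.n2 = fun _ => 0 := funext (n2_eq_zero hD hu)
  have h' : mvfderiv 𝓘(ℝ, E) D.n2 p = 0 := by rw [h]; exact mvfderiv_const 0
  rw [K, h', n2_eq_zero hD hu]
  simp only [zero_apply, mul_zero, zero_mul, zero_add, add_zero, zero_div]
  rfl

theorem K_apply (hV : V.SmoothAt p) (hW : W.SmoothAt p) :
    D.K p (V p) (W p) = lieDeriv₂ D.n (fun q x y => D.gamma q x y) V W p / 2 := by
  rw [K_eq_KForm hD hu, KForm_apply _ hV hW]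

theorem K_symm (p : M) (v w : TangentSpace 𝓘(ℝ, E) p) : D.K p v w = D.K p w v := by
  have h := K_apply hD hu (.extendVec v) (.extendVec w)
  have h' := K_apply hD hu (.extendVec w) (.extendVec v)
  rw [lieDeriv_gamma_symm] at h
  simpa using h.trans h'.symm

theorem K_n_left (p : M) (w : TangentSpace 𝓘(ℝ, E) p) : D.K p (D.n p) w = 0 := by
  have h := K_apply hD hu (smoothAt_n hD hu p) (.extendVec w)
  rw [extendVec_self] at h
  rw [h]
  simp [lieDeriv₂, gamma_n_left hD hu, dirDeriv_const, bracket_self]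

theorem K_n_right (p : M) (w : TangentSpace 𝓘(ℝ, E) p) : D.K p w (D.n p) = 0 := by
  rw [K_symm hD hu, K_n_left hD hu]

theorem smooth_K (hX : X.SmoothAt p) (hZ : Z.SmoothAt p) :
    SmoothFunAt E (fun q => D.K q (X q) (Z q)) p := by
  simp only [K_eq_KForm hD hu]
  exact (KForm _).smooth hX hZ

/-! ### The differential of `ℓ` -/

omit hD hu in
theorem smooth_foliationFunction (u : D.FoliationFunction) (p : M) : SmoothFunAt E u.toFun p :=
  Filter.Eventually.of_forall fun q => u.smooth q

theorem smooth_lam (p : M) : SmoothFunAt E u.lam p :=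
  (smoothAt_n hD hu p).dirDeriv (smooth_foliationFunction u p)

theorem smooth_logLam (p : M) : SmoothFunAt E u.logLam p := by
  unfold FoliationFunction.logLam
  -- `Real.log` is even, so the absolute value can be dropped and smoothness is only needed away
  -- from zero.
  simp only [Real.log_abs]
  have h0 : u.lam p ≠ 0 := u.ne_zero p
  exact (smooth_lam hD hu p).comp
    ((isOpen_ne.eventually_mem h0).mono fun t ht => Real.contDiffAt_log.2 ht)

theorem dirDeriv_logLam (X : VField E M) (p : M) :
    dirDeriv X u.logLam p = (u.lam p)⁻¹ * dirDeriv X u.lam p := by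
  unfold FoliationFunction.logLam
  simp only [Real.log_abs]
  exact dirDeriv_comp (smooth_lam hD hu p) (Real.hasDerivAt_log (u.ne_zero p))

/-- The one-form `d log |λ|`. -/
def dLogLam : OneForm E M where
  toFun p := (mvfderiv 𝓘(ℝ, E) u.logLam p).toLinearMap
  smooth' hX := hX.dirDeriv (smooth_logLam hD hu _)

theorem dLogLam_apply (X : VField E M) (p : M) :
    dLogLam hD hu p (X p) = dirDeriv X u.logLam p := rfl

/-- This is `d(λ⁻¹ du) = -λ⁻² dλ ∧ du = ℓ ∧ d log|λ|`. It is the only source of antisymmetry in `Π`.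
-/
theorem extDeriv_ell (hV : V.SmoothAt p) (hW : W.SmoothAt p) :
    extDeriv₁ (fun q x => D.ell q x) V W p
      = D.ell p (V p) * dLogLam hD hu p (W p) - D.ell p (W p) * dLogLam hD hu p (V p) := by
  have hus := smooth_foliationFunction u p
  have hl := smooth_lam hD hu p
  have h0 : u.lam p ≠ 0 := u.ne_zero p
  have he : ∀ (W : VField E M), (fun q => D.ell q (W q))
      = fun q => dirDeriv W u.toFun q * (u.lam q)⁻¹ := fun W => funext fun q => ell_eq hu q (W q)
  simp only [extDeriv₁, dLogLam_apply, dirDeriv_logLam hD hu, he,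
    dirDeriv_mul (hV.dirDeriv hus) (hl.inv h0), dirDeriv_mul (hW.dirDeriv hus) (hl.inv h0),
    dirDeriv_inv hl h0]
  have e (W : VField E M) : D.ell p (W p) = dirDeriv W u.toFun p * (u.lam p)⁻¹ := ell_eq hu p (W p)
  rw [e, e, e, dirDeriv_bracket hV hW hus]
  field_simp
  ring

theorem F_eq (p : M) (v w : TangentSpace 𝓘(ℝ, E) p) :
    D.F p v w = (D.ell p v * dLogLam hD hu p w - D.ell p w * dLogLam hD hu p v) / 2 := by
  rw [F, extDeriv_ell hD hu (.extendVec v) (.extendVec w)]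
  simp

/-- `Π` as a smooth tensor field. -/
def PiForm : TwoForm E M where
  toFun p := LinearMap.mk₂ ℝ (fun v w => D.Y p v w
      + (D.ell p v * dLogLam hD hu p w - D.ell p w * dLogLam hD hu p v) / 2)
    (fun _ _ _ => by simp; ring) (fun _ _ _ => by simp; ring)
    (fun _ _ _ => by simp; ring) (fun _ _ _ => by simp; ring)
  smooth' hX hZ := (smooth_Y hX hZ).add ((((smooth_ell hX).mul ((dLogLam hD hu).smooth hZ)).sub
    ((smooth_ell hZ).mul ((dLogLam hD hu).smooth hX))).div (.const 2) two_ne_zero)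

theorem PiForm_apply (p : M) (v w : TangentSpace 𝓘(ℝ, E) p) :
    PiForm hD hu p v w = D.Y p v w
      + (D.ell p v * dLogLam hD hu p w - D.ell p w * dLogLam hD hu p v) / 2 := rfl

theorem Pi_eq (p : M) (v w : TangentSpace 𝓘(ℝ, E) p) : D.Pi p v w = PiForm hD hu p v w := by
  rw [Pi, F_eq hD hu, PiForm_apply]

omit hD hu

/-! ### The Koszul formula -/

/-- All terms differentiating `f` cancel, even though `γ` is degenerate. The covector `κ` in the
definition of `conn`, prescribed on a basis, is therefore given by the Koszul expression on every
smooth field. -/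
theorem koszul_tensorial (hX : X.SmoothAt p) (hZ : Z.SmoothAt p) :
    IsTensorialAt (fun W => koszul (fun q x y => D.gamma q x y) X Z W p) p where
  add {W W'} h h' := by
    simp only [koszul, Pi.add_apply, gamma_add_left, gamma_add_right, bracket_add_right h h',
      dirDeriv_add_left,
      dirDeriv_add (smooth_gamma (D := D) hX h) (smooth_gamma hX h'),
      dirDeriv_add (smooth_gamma (D := D) hZ h) (smooth_gamma hZ h')]
    ring
  smul {f W} hf h := by
    simp only [koszul, Pi.smul_apply', gamma_add_left, gamma_smul_left,
      gamma_smul_right, bracket_smul_right hf h, dirDeriv_smul_left,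
      dirDeriv_mul hf (smooth_gamma (D := D) hX h), dirDeriv_mul hf (smooth_gamma (D := D) hZ h),
      D.gamma_symm p (W p), smul_eq_mul]
    ring

theorem smooth_koszul (hX : X.SmoothAt p) (hZ : Z.SmoothAt p) (hW : W.SmoothAt p) :
    SmoothFunAt E (koszul (fun q x y => D.gamma q x y) X Z W) p := by
  unfold koszul
  exact ((((((hX.dirDeriv (smooth_gamma hZ hW)).add (hZ.dirDeriv (smooth_gamma hX hW))).sub
    (hW.dirDeriv (smooth_gamma hX hZ))).add (smooth_gamma (hX.bracket hZ) hW)).sub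
    (smooth_gamma (hX.bracket hW) hZ)).sub (smooth_gamma (hZ.bracket hW) hX)).div (.const 2)
    two_ne_zero

theorem koszul_add_left (hX : X.SmoothAt p) (hX' : X'.SmoothAt p) (hZ : Z.SmoothAt p)
    (hW : W.SmoothAt p) : koszul (fun q x y => D.gamma q x y) (X + X') Z W p
      = koszul (fun q x y => D.gamma q x y) X Z W p
        + koszul (fun q x y => D.gamma q x y) X' Z W p := by
  simp only [koszul, Pi.add_apply, gamma_add_left, gamma_add_right, bracket_add_left hX hX',
    dirDeriv_add_left, dirDeriv_add (smooth_gamma (D := D) hX hW) (smooth_gamma hX' hW),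
    dirDeriv_add (smooth_gamma (D := D) hX hZ) (smooth_gamma hX' hZ)]
  ring

theorem koszul_smul_left (hf : SmoothFunAt E f p) (hX : X.SmoothAt p) (hZ : Z.SmoothAt p)
    (hW : W.SmoothAt p) : koszul (fun q x y => D.gamma q x y) (f • X) Z W p
      = f p * koszul (fun q x y => D.gamma q x y) X Z W p := by
  simp only [koszul, Pi.smul_apply', gamma_sub_left, gamma_smul_left, gamma_smul_right,
    bracket_smul_left hf hX, dirDeriv_smul_left, dirDeriv_mul hf (smooth_gamma (D := D) hX hW),
    dirDeriv_mul hf (smooth_gamma (D := D) hX hZ)]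
  ring

theorem koszul_add_right (hX : X.SmoothAt p) (hZ : Z.SmoothAt p) (hZ' : Z'.SmoothAt p)
    (hW : W.SmoothAt p) : koszul (fun q x y => D.gamma q x y) X (Z + Z') W p
      = koszul (fun q x y => D.gamma q x y) X Z W p
        + koszul (fun q x y => D.gamma q x y) X Z' W p := by
  simp only [koszul, Pi.add_apply, gamma_add_left, gamma_add_right, bracket_add_left hZ hZ',
    bracket_add_right hZ hZ',
    dirDeriv_add_left, dirDeriv_add (smooth_gamma (D := D) hZ hW) (smooth_gamma hZ' hW),
    dirDeriv_add (smooth_gamma (D := D) hX hZ) (smooth_gamma hX hZ')]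
  ring

theorem koszul_smul_right (hf : SmoothFunAt E f p) (hX : X.SmoothAt p) (hZ : Z.SmoothAt p)
    (hW : W.SmoothAt p) : koszul (fun q x y => D.gamma q x y) X (f • Z) W p
      = f p * koszul (fun q x y => D.gamma q x y) X Z W p
        + dirDeriv X f p * D.gamma p (Z p) (W p) := by
  simp only [koszul, Pi.smul_apply', gamma_sub_left, gamma_add_left, gamma_smul_left,
    gamma_smul_right, bracket_smul_left hf hZ, bracket_smul_right hf hZ,
    dirDeriv_smul_left, dirDeriv_mul hf (smooth_gamma (D := D) hZ hW),
    dirDeriv_mul hf (smooth_gamma (D := D) hX hZ), D.gamma_symm p (X p) (Z p)]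
  ring

theorem gamma_bracket_swap (X Z : VField E M) (p : M) (w : TangentSpace 𝓘(ℝ, E) p) :
    D.gamma p (bracket X Z p) w = - D.gamma p (bracket Z X p) w := by
  rw [bracket_swap]; simp

theorem koszul_sub_swap (X Z W : VField E M) (p : M) :
    koszul (fun q x y => D.gamma q x y) X Z W p - koszul (fun q x y => D.gamma q x y) Z X W p
      = D.gamma p (bracket X Z p) (W p) := by
  simp only [koszul, gamma_bracket_swap Z X, D.gamma_symm _ (X _) (Z _)]
  ring

theorem koszul_add_swap (X Z W : VField E M) (p : M) :
    koszul (fun q x y => D.gamma q x y) X Z W p + koszul (fun q x y => D.gamma q x y) X W Z p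
      = dirDeriv X (fun q => D.gamma q (Z q) (W q)) p := by
  simp only [koszul, gamma_bracket_swap W Z, D.gamma_symm _ (W _) (Z _)]
  ring

include hD hu

/-- Since `γ(n, ·)` vanishes identically, only the derivative of `γ(X, Z)` along `n` and the two
brackets with `n` remain, and these form `-𝓛_n γ / 2`. This is the compatibility condition for
solving for `∇̄_X Z` despite the degeneracy. -/
theorem koszul_n (hX : X.SmoothAt p) (hZ : Z.SmoothAt p) :
    koszul (fun q x y => D.gamma q x y) X Z D.n p = - D.K p (X p) (Z p) := by
  rw [K_apply hD hu hX hZ]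
  simp only [koszul, lieDeriv₂, gamma_n_right hD hu, dirDeriv_const, gamma_bracket_swap _ D.n,
    D.gamma_symm p (X p)]
  ring

/-! ### The hypersurface connection -/

/-- The vector obtained from `𝒜♯` solves the prescribed equations only if its `ℝ`-component is zero.
Testing against `n` shows that this component is `κ(n)`. -/
theorem conn_spec (hX : X.SmoothAt p) (hZ : Z.SmoothAt p) :
    (∀ W : VField E M, W.SmoothAt p → D.gamma p (D.conn X Z p) (W p)
      = koszul (fun q x y => D.gamma q x y) X Z W p + D.ell p (W p) * D.K p (X p) (Z p)) ∧
    D.ell p (D.conn X Z p)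
      = dirDeriv X (fun q => D.ell q (Z q)) p - PiForm hD hu p (X p) (Z p) := by
  set b := Module.finBasis ℝ (TangentSpace 𝓘(ℝ, E) p) with hb
  set κ : Module.Dual ℝ (TangentSpace 𝓘(ℝ, E) p) := b.constr ℝ (fun i =>
    koszul (fun q x y => D.gamma q x y) X Z (extendVec (b i)) p
      + D.ell p (b i) * D.K p (X p) (Z p)) with hκ
  set c : ℝ := dirDeriv X (fun q => D.ell q (Z q)) p - D.Y p (X p) (Z p) - D.F p (X p) (Z p)
    + D.ell2 p * D.K p (X p) (Z p) with hc
  have hconn : D.conn X Z p = (D.sharp p (covector κ c)).1 := rfl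
  have hκ' : κ = (koszul_tensorial (D := D) hX hZ).toLinearMap
      + D.K p (X p) (Z p) • (D.ell p).toLinearMap := by
    refine b.ext fun i => ?_
    rw [hκ, Module.Basis.constr_basis]
    change _ = koszul (fun q x y => D.gamma q x y) X Z (extendVec (b i)) p
      + D.K p (X p) (Z p) * D.ell p (b i)
    ring
  have hκW : ∀ W : VField E M, W.SmoothAt p → κ (W p)
      = koszul (fun q x y => D.gamma q x y) X Z W p + D.ell p (W p) * D.K p (X p) (Z p) := by
    intro W hW
    rw [hκ', LinearMap.add_apply, (koszul_tensorial (D := D) hX hZ).toLinearMap_apply hW]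
    change _ + D.K p (X p) (Z p) * D.ell p (W p) = _
    ring
  -- The summand `ℓ(W) K(X, Z)` in `κ` is exactly what offsets the Koszul value `-K(X, Z)` at `W =
  -- n`.
  have hκn : κ (D.n p) = 0 := by
    rw [hκW _ (smoothAt_n hD hu p), koszul_n hD hu hX hZ, ell_n hu]; ring
  have h1 := D.sharp_covector_fst p κ c
  have h2 := D.sharp_covector_snd p κ c
  have h3 := h1 (D.n p)
  rw [gamma_n_right hD hu, ell_n hu, hκn, zero_add, mul_one] at h3
  simp only [h3, zero_mul, add_zero, ← hconn] at h1 h2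
  refine ⟨fun W hW => (h1 (W p)).trans (hκW W hW), ?_⟩
  rw [h2, hc, hu.ell2_zero, ← Pi_eq, Pi]
  ring

theorem gamma_conn (hX : X.SmoothAt p) (hZ : Z.SmoothAt p) (hW : W.SmoothAt p) :
    D.gamma p (D.conn X Z p) (W p)
      = koszul (fun q x y => D.gamma q x y) X Z W p + D.ell p (W p) * D.K p (X p) (Z p) :=
  (conn_spec hD hu hX hZ).1 W hW

theorem ell_conn (hX : X.SmoothAt p) (hZ : Z.SmoothAt p) : D.ell p (D.conn X Z p)
      = dirDeriv X (fun q => D.ell q (Z q)) p - PiForm hD hu p (X p) (Z p) :=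
  (conn_spec hD hu hX hZ).2

omit hD hu in
theorem eq_of_gamma_fields {v v' : TangentSpace 𝓘(ℝ, E) p}
    (h : ∀ W : VField E M, W.SmoothAt p → D.gamma p v (W p) = D.gamma p v' (W p))
    (h' : D.ell p v = D.ell p v') : v = v' :=
  eq_of_gamma_of_ell (fun w => by simpa using h _ (.extendVec w)) h'

/-- Each axiom is compared on `γ`- and `ℓ`-components, where it follows from the Koszul rules and
the bilinearity of `K` and `Π`. Smoothness of `∇̄_X Z` follows from smoothness of its components. -/
theorem isAffineConnection_conn : IsAffineConnection D.conn where
  smooth {X Z p} hX hZ := by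
    refine smoothAt_of_gamma_of_ell hD hu (fun W hW => ?_) ?_
    · refine ((smooth_koszul (D := D) hX hZ hW).add ((smooth_ell (D := D) hW).mul (smooth_K hD hu hX hZ))).congr ?_
      filter_upwards [hX.eventually, hZ.eventually, hW.eventually] with q h1 h2 h3
      exact gamma_conn hD hu h1 h2 h3
    · refine ((hX.dirDeriv (smooth_ell (D := D) hZ)).sub ((PiForm hD hu).smooth hX hZ)).congr ?_
      filter_upwards [hX.eventually, hZ.eventually] with q h1 h2
      exact ell_conn hD hu h1 h2
  add_left {X X' Z p} h h' hZ := by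
    refine eq_of_gamma_fields (D := D) (fun W hW => ?_) ?_
    · rw [gamma_add_left, gamma_conn hD hu (h.add h') hZ hW, gamma_conn hD hu h hZ hW,
        gamma_conn hD hu h' hZ hW, koszul_add_left h h' hZ hW]
      simp only [K_eq_KForm hD hu, Pi.add_apply, map_add, LinearMap.add_apply]
      ring
    · rw [map_add, ell_conn hD hu (h.add h') hZ, ell_conn hD hu h hZ, ell_conn hD hu h' hZ,
        dirDeriv_add_left]
      simp only [Pi.add_apply, map_add, LinearMap.add_apply]
      ring
  smul_left {f X Z p} hf h hZ := by
    refine eq_of_gamma_fields (D := D) (fun W hW => ?_) ?_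
    · rw [gamma_smul_left, gamma_conn hD hu (h.smul hf) hZ hW, gamma_conn hD hu h hZ hW,
        koszul_smul_left hf h hZ hW]
      simp only [K_eq_KForm hD hu, Pi.smul_apply', map_smul, LinearMap.smul_apply, smul_eq_mul]
      ring
    · rw [map_smul, ell_conn hD hu (h.smul hf) hZ, ell_conn hD hu h hZ, dirDeriv_smul_left]
      simp only [Pi.smul_apply', map_smul, LinearMap.smul_apply, smul_eq_mul]
      ring
  add_right {X Z Z' p} hX h h' := by
    refine eq_of_gamma_fields (D := D) (fun W hW => ?_) ?_
    · rw [gamma_add_left, gamma_conn hD hu hX (h.add h') hW, gamma_conn hD hu hX h hW,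
        gamma_conn hD hu hX h' hW, koszul_add_right hX h h' hW]
      simp only [K_eq_KForm hD hu, Pi.add_apply, map_add]
      ring
    · rw [map_add, ell_conn hD hu hX (h.add h'), ell_conn hD hu hX h, ell_conn hD hu hX h']
      simp only [Pi.add_apply, map_add, dirDeriv_add (smooth_ell (D := D) h) (smooth_ell h')]
      ring
  smul_right {f X Z p} hf hX h := by
    refine eq_of_gamma_fields (D := D) (fun W hW => ?_) ?_
    · rw [gamma_add_left, gamma_smul_left, gamma_smul_left, gamma_conn hD hu hX (h.smul hf) hW,
        gamma_conn hD hu hX h hW, koszul_smul_right hf hX h hW]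
      simp only [K_eq_KForm hD hu, Pi.smul_apply', map_smul, smul_eq_mul]
      ring
    · rw [map_add, map_smul, map_smul, ell_conn hD hu hX (h.smul hf), ell_conn hD hu hX h]
      simp only [Pi.smul_apply', map_smul, smul_eq_mul, dirDeriv_mul hf (smooth_ell (D := D) h)]
      ring

/-- On `γ`-components this is the Koszul identity together with the symmetry of `K`. On
`ℓ`-components the antisymmetric part of `Π` is `F`, and `2F = dℓ` supplies `ℓ([X, Z])`. -/
theorem conn_sub_swap (hX : X.SmoothAt p) (hZ : Z.SmoothAt p) :
    D.conn X Z p - D.conn Z X p = bracket X Z p := by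
  refine eq_of_gamma_fields (D := D) (fun W hW => ?_) ?_
  · rw [gamma_sub_left, gamma_conn hD hu hX hZ hW, gamma_conn hD hu hZ hX hW,
      ← koszul_sub_swap, K_symm hD hu p (X p)]
    ring
  · rw [map_sub, ell_conn hD hu hX hZ, ell_conn hD hu hZ hX]
    have h := extDeriv_ell hD hu hX hZ
    simp only [extDeriv₁] at h
    simp only [PiForm_apply, D.Y_symm p (X p)]
    linarith

theorem dirDeriv_gamma (hX : X.SmoothAt p) (hZ : Z.SmoothAt p) (hW : W.SmoothAt p) :
    dirDeriv X (fun q => D.gamma q (Z q) (W q)) p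
      = D.gamma p (D.conn X Z p) (W p) + D.gamma p (Z p) (D.conn X W p)
        - D.ell p (Z p) * D.K p (X p) (W p) - D.ell p (W p) * D.K p (X p) (Z p) := by
  rw [D.gamma_symm p (Z p), gamma_conn hD hu hX hZ hW, gamma_conn hD hu hX hW hZ,
    ← koszul_add_swap]
  ring

theorem isHypersurfaceConnection_conn : D.IsHypersurfaceConnection D.conn := by
  intro X Z W hX hZ hW p
  have hX := hX.smoothAt p
  have hZ := hZ.smoothAt p
  have hW := hW.smoothAt p
  refine ⟨conn_sub_swap hD hu hX hZ, ?_, ?_⟩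
  · rw [dirDeriv_gamma hD hu hX hZ hW]; ring
  · rw [ell_conn hD hu hX hZ, ← Pi_eq, Pi, hu.ell2_zero]; ring

end HypersurfaceData

/-! ### Curvature and covariant derivatives as multilinear maps on a tangent space -/

section Trilinear

variable {E : Type*} [NormedAddCommGroup E] [NormedSpace ℝ E] [FiniteDimensional ℝ E]
  {M : Type*} [TopologicalSpace M] [ChartedSpace E M] [IsManifold 𝓘(ℝ, E) ∞ M]
  {A : Type*} [AddCommGroup A] [Module ℝ A] {p : M}

/-- The trilinear map on the tangent space induced by an operation that is tensorial in three
arguments. -/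
def IsTensorialAt.trilinear {Φ : VField E M → VField E M → VField E M → A}
    (h₁ : ∀ {W Z : VField E M}, W.SmoothAt p → Z.SmoothAt p → IsTensorialAt (fun X => Φ X W Z) p)
    (h₂ : ∀ {X Z : VField E M}, X.SmoothAt p → Z.SmoothAt p → IsTensorialAt (fun W => Φ X W Z) p)
    (h₃ : ∀ {X W : VField E M}, X.SmoothAt p → W.SmoothAt p → IsTensorialAt (fun Z => Φ X W Z) p) :
    TangentSpace 𝓘(ℝ, E) p →ₗ[ℝ] TangentSpace 𝓘(ℝ, E) p →ₗ[ℝ] TangentSpace 𝓘(ℝ, E) p →ₗ[ℝ] A :=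
  LinearMap.mk₂ ℝ (fun x w => (h₃ (.extendVec x) (.extendVec w)).toLinearMap)
    (fun x x' w => LinearMap.ext fun z =>
      map_add (h₁ (.extendVec w) (.extendVec z)).toLinearMap x x')
    (fun c x w => LinearMap.ext fun z =>
      map_smul (h₁ (.extendVec w) (.extendVec z)).toLinearMap c x)
    (fun x w w' => LinearMap.ext fun z =>
      map_add (h₂ (.extendVec x) (.extendVec z)).toLinearMap w w')
    (fun c x w => LinearMap.ext fun z =>
      map_smul (h₂ (.extendVec x) (.extendVec z)).toLinearMap c w)

variable {D : VField E M → VField E M → VField E M} {X W Z : VField E M}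

/-- The curvature of a connection on tangent vectors. -/
def IsAffineConnection.curvatureMap (hD : IsAffineConnection D) (p : M) :
    TangentSpace 𝓘(ℝ, E) p →ₗ[ℝ] TangentSpace 𝓘(ℝ, E) p →ₗ[ℝ] TangentSpace 𝓘(ℝ, E) p →ₗ[ℝ]
      TangentSpace 𝓘(ℝ, E) p :=
  IsTensorialAt.trilinear (Φ := fun X W Z => curvature D X W Z p)
    (fun hW hZ => hD.curvature_tensorial_left hW hZ)
    (fun hX hZ => hD.curvature_tensorial_middle hX hZ)
    (fun hX hW => hD.curvature_tensorial_right hX hW)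

theorem IsAffineConnection.curvatureMap_apply (hD : IsAffineConnection D) (hX : X.SmoothAt p)
    (hW : W.SmoothAt p) (hZ : Z.SmoothAt p) :
    hD.curvatureMap p (X p) (W p) (Z p) = curvature D X W Z p :=
  hD.curvature_congr (.extendVec _) hX (.extendVec _) hW (.extendVec _) hZ
    (by simp) (by simp) (by simp)

/-- The covariant derivative of a two-covariant tensor field on tangent vectors. -/
def IsAffineConnection.covDerivMap (hD : IsAffineConnection D) (T : TwoForm E M) (p : M) :
    TangentSpace 𝓘(ℝ, E) p →ₗ[ℝ] TangentSpace 𝓘(ℝ, E) p →ₗ[ℝ] TangentSpace 𝓘(ℝ, E) p →ₗ[ℝ] ℝ :=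
  IsTensorialAt.trilinear (Φ := fun X Z W => covDeriv₂ D T X Z W p)
    (fun hZ hW => hD.covDeriv₂_tensorial_left T hZ hW)
    (fun hX hW => hD.covDeriv₂_tensorial_middle T hX hW)
    (fun hX hZ => hD.covDeriv₂_tensorial_right T hX hZ)

theorem IsAffineConnection.covDerivMap_apply (hD : IsAffineConnection D) (T : TwoForm E M)
    (hX : X.SmoothAt p) (hZ : Z.SmoothAt p) (hW : W.SmoothAt p) :
    hD.covDerivMap T p (X p) (Z p) (W p) = dirDeriv X (fun q => T q (Z q) (W q)) p
      - T p (D X Z p) (W p) - T p (Z p) (D X W p) :=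
  hD.covDeriv₂_congr T (.extendVec _) hX (.extendVec _) hZ (.extendVec _) hW
    (by simp) (by simp) (by simp)

end Trilinear

/-! ### The derivative of `n` and the curvature tensors in the characteristic gauge -/

namespace HypersurfaceData

variable {E : Type*} [NormedAddCommGroup E] [NormedSpace ℝ E] [FiniteDimensional ℝ E]
  {M : Type*} [TopologicalSpace M] [ChartedSpace E M] [IsManifold 𝓘(ℝ, E) ∞ M]
  {D : HypersurfaceData E M} {X X' Z Z' W W' V V' : VField E M} {f : M → ℝ} {p : M}
  {u : D.FoliationFunction} (hD : D.IsCharacteristic) (hu : u.IsCharacteristicGauge)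

/-- The tensor `K` as a smooth tensor field. -/
def KTensor : TwoForm E M := KForm (smoothAt_n hD hu)

theorem KTensor_apply (p : M) (v w : TangentSpace 𝓘(ℝ, E) p) :
    KTensor hD hu p v w = D.K p v w := (K_eq_KForm hD hu p v w).symm

/-- The derivative `∇̄ T` of a two-covariant tensor field along the hypersurface connection. -/
def nablaTwo (T : TwoForm E M) (p : M) :
    TangentSpace 𝓘(ℝ, E) p →ₗ[ℝ] TangentSpace 𝓘(ℝ, E) p →ₗ[ℝ] TangentSpace 𝓘(ℝ, E) p →ₗ[ℝ] ℝ :=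
  (isAffineConnection_conn hD hu).covDerivMap T p

theorem nablaTwo_apply (T : TwoForm E M) (hX : X.SmoothAt p) (hZ : Z.SmoothAt p)
    (hW : W.SmoothAt p) : nablaTwo hD hu T p (X p) (Z p) (W p)
      = dirDeriv X (fun q => T q (Z q) (W q)) p
        - T p (D.conn X Z p) (W p) - T p (Z p) (D.conn X W p) :=
  (isAffineConnection_conn hD hu).covDerivMap_apply T hX hZ hW

/-- The curvature of the hypersurface connection as a trilinear map. -/
def riemMap (p : M) :
    TangentSpace 𝓘(ℝ, E) p →ₗ[ℝ] TangentSpace 𝓘(ℝ, E) p →ₗ[ℝ] TangentSpace 𝓘(ℝ, E) p →ₗ[ℝ]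
      TangentSpace 𝓘(ℝ, E) p :=
  (isAffineConnection_conn hD hu).curvatureMap p

theorem riem_eq (p : M) (x w z : TangentSpace 𝓘(ℝ, E) p) :
    D.riem p x w z = riemMap hD hu p x w z := rfl

/-- The linear map `x ↦ ∇̄_x n`. -/
def nablaN (p : M) : TangentSpace 𝓘(ℝ, E) p →ₗ[ℝ] TangentSpace 𝓘(ℝ, E) p :=
  ((isAffineConnection_conn hD hu).tensorial_left (smoothAt_n hD hu p)).toLinearMap

theorem nablaN_apply (hX : X.SmoothAt p) : nablaN hD hu p (X p) = D.conn X D.n p :=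
  IsTensorialAt.toLinearMap_apply _ hX

/-! ### Pointwise identities -/

theorem PiForm_of_tangent {v w : TangentSpace 𝓘(ℝ, E) p} (hv : D.ell p v = 0)
    (hw : D.ell p w = 0) : PiForm hD hu p v w = D.Y p v w := by
  rw [PiForm_apply, hv, hw]; ring

theorem PiForm_n_n (p : M) : PiForm hD hu p (D.n p) (D.n p) = 2 * D.omega p := by
  rw [PiForm_apply, omega]; ring

/-- Differentiating `γ(n, W) = 0` and inserting the formula for `∇̄γ` with `ℓ(n) = 1` and `K(·, n) =
0`. -/
theorem gamma_nablaN (p : M) (x w : TangentSpace 𝓘(ℝ, E) p) :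
    D.gamma p (nablaN hD hu p x) w = D.K p x w := by
  have h := dirDeriv_gamma hD hu (.extendVec x) (smoothAt_n hD hu p) (.extendVec w)
  rw [← nablaN_apply hD hu (.extendVec x)] at h
  simp only [gamma_n_left hD hu, dirDeriv_const, ell_n hu, K_n_right hD hu, extendVec_self] at h
  linarith

theorem ell_nablaN (p : M) (x : TangentSpace 𝓘(ℝ, E) p) :
    D.ell p (nablaN hD hu p x) = - PiForm hD hu p x (D.n p) := by
  have h := ell_conn hD hu (.extendVec x) (smoothAt_n hD hu p)
  rw [← nablaN_apply hD hu (.extendVec x)] at h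
  simp only [dirDeriv_const, ell_n hu, extendVec_self] at h
  linarith

/-- The splitting `∇̄_x n = ∑_k K(x, e_k) e_k - Π(x, n) n`, seen through a covector. It converts
contractions of `K` with a form into values on `∇̄_x n`, and conversely. -/
theorem map_nablaN {ι : Type*} [Fintype ι] [DecidableEq ι] {e : ι → VField E M}
    (he : u.IsLeafFrame e p) (a : TangentSpace 𝓘(ℝ, E) p →ₗ[ℝ] ℝ) (x : TangentSpace 𝓘(ℝ, E) p) :
    a (nablaN hD hu p x)
      = ∑ k, D.K p x (e k p) * a (e k p) - PiForm hD hu p x (D.n p) * a (D.n p) := by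
  have h := congrArg a (he.sub_ell_smul_n hD hu (nablaN hD hu p x))
  simp only [ell_nablaN, gamma_nablaN, map_sub, map_sum, map_smul, smul_eq_mul] at h
  linarith

include hD hu in
theorem conn_n_n (p : M) : D.conn D.n D.n p = -(2 * D.omega p) • D.n p := by
  rw [← nablaN_apply hD hu (smoothAt_n hD hu p)]
  refine eq_of_gamma_of_ell (D := D) (fun w => ?_) ?_
  · rw [gamma_nablaN, K_n_left hD hu, gamma_smul_left, gamma_n_left hD hu, mul_zero]
  · rw [ell_nablaN, PiForm_n_n, map_smul, ell_n hu, smul_eq_mul, mul_one]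

/-! ### The curvature tensors `A` and `B` -/

/-- The Ricci identity for `ℓ`, using `∇̄ℓ = Π` and vanishing torsion: the second derivatives of
`ℓ(Z)` cancel against the bracket term. -/
theorem ell_curvature (hX : X.SmoothAt p) (hW : W.SmoothAt p) (hZ : Z.SmoothAt p) :
    D.ell p (riemMap hD hu p (X p) (W p) (Z p))
      = nablaTwo hD hu (PiForm hD hu) p (W p) (X p) (Z p)
        - nablaTwo hD hu (PiForm hD hu) p (X p) (W p) (Z p) := by
  have hc := isAffineConnection_conn hD hu
  have key {X W : VField E M} (hX : X.SmoothAt p) (hW : W.SmoothAt p) :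
      D.ell p (D.conn X (D.conn W Z) p) = dirDeriv X (dirDeriv W fun q => D.ell q (Z q)) p
        - dirDeriv X (fun q => PiForm hD hu q (W q) (Z q)) p
        - PiForm hD hu p (X p) (D.conn W Z p) := by
    rw [ell_conn hD hu hX (hc.smooth hW hZ), ← dirDeriv_sub (hW.dirDeriv (smooth_ell hZ))
      ((PiForm hD hu).smooth hW hZ)]
    congr 1
    refine dirDeriv_congr ?_ rfl
    filter_upwards [hW.eventually, hZ.eventually] with q h h'
    exact ell_conn hD hu h h'
  have hb : PiForm hD hu p (bracket X W p) (Z p)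
      = PiForm hD hu p (D.conn X W p) (Z p) - PiForm hD hu p (D.conn W X p) (Z p) := by
    rw [← conn_sub_swap hD hu hX hW, map_sub, LinearMap.sub_apply]
  rw [riemMap, hc.curvatureMap_apply hX hW hZ, nablaTwo_apply hD hu _ hW hX hZ,
    nablaTwo_apply hD hu _ hX hW hZ, curvature, map_sub, map_sub, key hX hW, key hW hX,
    ell_conn hD hu (hX.bracket hW) hZ, dirDeriv_bracket hX hW (smooth_ell hZ), hb]
  ring

theorem A_eq (p : M) (b c d : TangentSpace 𝓘(ℝ, E) p) :
    D.A p b c d = nablaTwo hD hu (PiForm hD hu) p d c b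
      - nablaTwo hD hu (PiForm hD hu) p c d b := by
  have h : D.ell2 = fun _ => 0 := funext hu.ell2_zero
  have h' : mvfderiv 𝓘(ℝ, E) D.ell2 p = 0 := by rw [h]; exact mvfderiv_const 0
  have h1 := ell_curvature hD hu (.extendVec c) (.extendVec d) (.extendVec b)
  simp only [extendVec_self] at h1
  rw [A, riem_eq hD hu, h1, h', hu.ell2_zero]
  simp

/-- The product rule, with `∇̄_d ℓ_a = Π_{da}`. -/
theorem nablaKell_eq (p : M) (d c b a : TangentSpace 𝓘(ℝ, E) p) :
    D.nablaKell p d c b a = nablaTwo hD hu (KTensor hD hu) p d c b * D.ell p a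
      + D.K p c b * PiForm hD hu p d a := by
  have h := nablaTwo_apply hD hu (KTensor hD hu) (.extendVec d) (.extendVec c) (.extendVec b)
  have h1 := ell_conn hD hu (.extendVec d) (.extendVec a)
  have h2 := dirDeriv_mul (X := extendVec d)
    ((KTensor hD hu).smooth (.extendVec c) (.extendVec b))
    (smooth_ell (D := D) (.extendVec a))
  simp only [KTensor_apply, extendVec_self] at h h1 h2
  rw [nablaKell, h2, h, h1]
  ring

theorem B_eq (p : M) (a b c d : TangentSpace 𝓘(ℝ, E) p) :
    D.B p a b c d = D.gamma p a (riemMap hD hu p c d b)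
      + (nablaTwo hD hu (KTensor hD hu) p d c b
        - nablaTwo hD hu (KTensor hD hu) p c d b) * D.ell p a
      + D.K p c b * PiForm hD hu p d a - D.K p d b * PiForm hD hu p c a := by
  rw [B, riem_eq hD hu, nablaKell_eq hD hu, nablaKell_eq hD hu, hu.ell2_zero]
  ring

end HypersurfaceData

namespace HypersurfaceData

variable {E : Type*} [NormedAddCommGroup E] [NormedSpace ℝ E] [FiniteDimensional ℝ E]
  {M : Type*} [TopologicalSpace M] [ChartedSpace E M] [IsManifold 𝓘(ℝ, E) ∞ M]
  {D : HypersurfaceData E M} {p : M}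

namespace FoliationFunction

variable {u : D.FoliationFunction} (hD : D.IsCharacteristic) (hu : u.IsCharacteristicGauge)
  {X Z W V : u.LeafField}

/-! ### The Levi-Civita connection of the leaves -/

include hu in
theorem ell_toVField (X : u.LeafField) (q : M) : D.ell q (u.toVField X q) = 0 :=
  hu.ell_tangent q (X q)

include hD hu in
theorem smoothAt_extendLeaf (x : u.leafSpace p) : (u.toVField (u.extendLeaf x)).SmoothAt p := by
  have h : u.toVField (u.extendLeaf x) = extendVec (x : TangentSpace 𝓘(ℝ, E) p)
      - (fun q => D.ell q (extendVec (x : TangentSpace 𝓘(ℝ, E) p) q)) • D.n :=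
    funext fun q => coe_proj hu q _
  rw [h]
  exact (VField.SmoothAt.extendVec _).sub
    ((smoothAt_n hD hu p).smul (smooth_ell (.extendVec _)))

include hu in
theorem toVField_extendLeaf_self (x : u.leafSpace p) :
    u.toVField (u.extendLeaf x) p = (x : TangentSpace 𝓘(ℝ, E) p) := by
  refine (coe_proj hu p _).trans ?_
  rw [extendVec_self, hu.ell_tangent, zero_smul, sub_zero]

-- Integrability of the leaves: `dℓ = ℓ ∧ d log|λ|` vanishes on pairs of leaf vectors.
include hD hu in
theorem ell_bracket (hX : (u.toVField X).SmoothAt p) (hZ : (u.toVField Z).SmoothAt p) :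
    D.ell p (bracket (u.toVField X) (u.toVField Z) p) = 0 := by
  have h := extDeriv_ell hD hu hX hZ
  simp only [extDeriv₁, ell_toVField hu, dirDeriv_const] at h
  linarith

include hD hu in
theorem ell_conn_leaf (hX : (u.toVField X).SmoothAt p) (hZ : (u.toVField Z).SmoothAt p) :
    D.ell p (D.conn (u.toVField X) (u.toVField Z) p)
      = - D.Y p (u.toVField X p) (u.toVField Z p) := by
  rw [ell_conn hD hu hX hZ, PiForm_of_tangent hD hu (ell_toVField hu X p) (ell_toVField hu Z p)]
  simp only [ell_toVField hu, dirDeriv_const]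
  ring

-- On leaf fields the Koszul formulas of `∇̄` and `∇^h` agree, because `ℓ(W) = 0` removes the extra
-- `K`-term. So `∇^h` is the leaf part of `∇̄`, whose `n`-component is `-Y(X, Z)`.
include hD hu in
theorem coe_leafConn (hX : (u.toVField X).SmoothAt p) (hZ : (u.toVField Z).SmoothAt p) :
    (u.leafConn X Z p : TangentSpace 𝓘(ℝ, E) p) = D.conn (u.toVField X) (u.toVField Z) p
      + D.Y p (u.toVField X p) (u.toVField Z p) • D.n p := by
  obtain ⟨e, -, he⟩ := exists_isLeafFrame hD hu p
  have he := he.self_of_nhds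
  refine (he.coe_sharph (D.gammaForm p (D.conn (u.toVField X) (u.toVField Z) p))
    fun w => ?_).trans ?_
  · have h := gamma_conn hD hu hX hZ (smoothAt_extendLeaf hD hu w)
    rw [ell_toVField hu, zero_mul, add_zero, toVField_extendLeaf_self hu] at h
    exact h.symm
  · refine (he.sub_ell_smul_n hD hu _).symm.trans ?_
    rw [ell_conn_leaf hD hu hX hZ, neg_smul, sub_neg_eq_add]

include hD hu in
theorem toVField_leafConn_eventuallyEq (hX : (u.toVField X).SmoothAt p)
    (hZ : (u.toVField Z).SmoothAt p) : u.toVField (u.leafConn X Z) =ᶠ[𝓝 p]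
      D.conn (u.toVField X) (u.toVField Z)
        + (fun q => D.Y q (u.toVField X q) (u.toVField Z q)) • D.n := by
  filter_upwards [hX.eventually, hZ.eventually] with q h h'
  exact coe_leafConn hD hu h h'

include hD hu in
theorem smoothAt_leafConn (hX : (u.toVField X).SmoothAt p) (hZ : (u.toVField Z).SmoothAt p) :
    (u.toVField (u.leafConn X Z)).SmoothAt p :=
  (((isAffineConnection_conn hD hu).smooth hX hZ).add
    ((smoothAt_n hD hu p).smul (smooth_Y hX hZ))).congr
      (toVField_leafConn_eventuallyEq hD hu hX hZ)

include hD hu in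
theorem toVField_leafBracket_eventuallyEq (hX : (u.toVField X).SmoothAt p)
    (hZ : (u.toVField Z).SmoothAt p) :
    u.toVField (u.leafBracket X Z) =ᶠ[𝓝 p] bracket (u.toVField X) (u.toVField Z) := by
  filter_upwards [hX.eventually, hZ.eventually] with q h h'
  refine (coe_proj hu q _).trans ?_
  rw [ell_bracket hD hu h h', zero_smul, sub_zero]

include hD hu in
theorem smoothAt_leafBracket (hX : (u.toVField X).SmoothAt p) (hZ : (u.toVField Z).SmoothAt p) :
    (u.toVField (u.leafBracket X Z)).SmoothAt p :=
  (hX.bracket hZ).congr (toVField_leafBracket_eventuallyEq hD hu hX hZ)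

include hD hu in
theorem gamma_leafConn (hX : (u.toVField X).SmoothAt p) (hZ : (u.toVField Z).SmoothAt p)
    (w : TangentSpace 𝓘(ℝ, E) p) :
    D.gamma p (u.leafConn X Z p) w = D.gamma p (D.conn (u.toVField X) (u.toVField Z) p) w := by
  rw [coe_leafConn hD hu hX hZ, gamma_add_left, gamma_smul_left, gamma_n_left hD hu, mul_zero,
    add_zero]

include hD hu in
theorem leafConn_sub_swap (hX : (u.toVField X).SmoothAt p) (hZ : (u.toVField Z).SmoothAt p) :
    (u.leafConn X Z p : TangentSpace 𝓘(ℝ, E) p) - u.leafConn Z X p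
      = bracket (u.toVField X) (u.toVField Z) p := by
  rw [coe_leafConn hD hu hX hZ, coe_leafConn hD hu hZ hX, ← conn_sub_swap hD hu hX hZ,
    D.Y_symm p (u.toVField Z p)]
  abel

include hD hu in
theorem dirDeriv_gamma_leaf (hX : (u.toVField X).SmoothAt p) (hZ : (u.toVField Z).SmoothAt p)
    (hW : (u.toVField W).SmoothAt p) :
    dirDeriv (u.toVField X) (fun q => D.gamma q (u.toVField Z q) (u.toVField W q)) p
      = D.gamma p (u.leafConn X Z p) (u.toVField W p)
        + D.gamma p (u.toVField Z p) (u.leafConn X W p) := by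
  rw [dirDeriv_gamma hD hu hX hZ hW, gamma_leafConn hD hu hX hZ, D.gamma_symm p (u.toVField Z p)
    (u.leafConn X W p), gamma_leafConn hD hu hX hW, ell_toVField hu, ell_toVField hu,
    D.gamma_symm p (u.toVField Z p)]
  ring

include hD hu in
theorem isLeafLeviCivita_leafConn : u.IsLeafLeviCivita u.leafConn := by
  intro X Z W hX hZ hW p
  exact ⟨leafConn_sub_swap hD hu (hX.smoothAt p) (hZ.smoothAt p),
    dirDeriv_gamma_leaf hD hu (hX.smoothAt p) (hZ.smoothAt p) (hW.smoothAt p)⟩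

/-! ### The curvature of the leaves -/

include hD hu in
/-- The Gauss equation. -/
theorem gamma_leafCurv (hX : (u.toVField X).SmoothAt p) (hW : (u.toVField W).SmoothAt p)
    (hZ : (u.toVField Z).SmoothAt p) (v : TangentSpace 𝓘(ℝ, E) p) :
    D.gamma p (u.leafCurv X W Z p) v
      = D.gamma p (riemMap hD hu p (u.toVField X p) (u.toVField W p) (u.toVField Z p)) v
        + D.Y p (u.toVField W p) (u.toVField Z p) * D.K p (u.toVField X p) v
        - D.Y p (u.toVField X p) (u.toVField Z p) * D.K p (u.toVField W p) v := by
  have hc := isAffineConnection_conn hD hu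
  have key {X W : u.LeafField} (hX : (u.toVField X).SmoothAt p) (hW : (u.toVField W).SmoothAt p) :
      D.gamma p (u.leafConn X (u.leafConn W Z) p) v
        = D.gamma p (D.conn (u.toVField X) (D.conn (u.toVField W) (u.toVField Z)) p) v
          + D.Y p (u.toVField W p) (u.toVField Z p) * D.K p (u.toVField X p) v := by
    have hn := (smoothAt_n hD hu p).smul (smooth_Y (D := D) hW hZ)
    rw [gamma_leafConn hD hu hX (smoothAt_leafConn hD hu hW hZ),
      hc.congr hX hX (smoothAt_leafConn hD hu hW hZ) rfl
        (toVField_leafConn_eventuallyEq hD hu hW hZ), hc.add_right hX (hc.smooth hW hZ) hn,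
      hc.smul_right (smooth_Y hW hZ) hX (smoothAt_n hD hu p), ← nablaN_apply hD hu hX]
    simp only [gamma_add_left, gamma_smul_left, gamma_nablaN, gamma_n_left hD hu, mul_zero,
      add_zero]
  have hb : D.gamma p (u.leafConn (u.leafBracket X W) Z p) v
      = D.gamma p (D.conn (bracket (u.toVField X) (u.toVField W)) (u.toVField Z) p) v := by
    rw [gamma_leafConn hD hu (smoothAt_leafBracket hD hu hX hW) hZ]
    rw [hc.congr (smoothAt_leafBracket hD hu hX hW) (hX.bracket hW) hZ
      (toVField_leafBracket_eventuallyEq hD hu hX hW).eq_of_nhds .rfl]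
  simp only [leafCurv, Submodule.coe_sub, gamma_sub_left]
  rw [key hX hW, key hW hX, hb, riemMap, hc.curvatureMap_apply hX hW hZ, curvature,
    gamma_sub_left, gamma_sub_left]
  ring

-- Commuting two derivatives of `γ(Z, V)`: `∇^h` is metric on the leaves, and the mixed products of
-- first derivatives cancel.
include hD hu in
theorem gamma_leafCurv_skew (hX : (u.toVField X).SmoothAt p) (hW : (u.toVField W).SmoothAt p)
    (hZ : (u.toVField Z).SmoothAt p) (hV : (u.toVField V).SmoothAt p) :
    D.gamma p (u.leafCurv X W Z p) (u.toVField V p)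
      = - D.gamma p (u.leafCurv X W V p) (u.toVField Z p) := by
  have key {X W : u.LeafField} (hX : (u.toVField X).SmoothAt p) (hW : (u.toVField W).SmoothAt p) :
      dirDeriv (u.toVField X) (dirDeriv (u.toVField W)
          fun q => D.gamma q (u.toVField Z q) (u.toVField V q)) p
        = D.gamma p (u.leafConn X (u.leafConn W Z) p) (u.toVField V p)
          + D.gamma p (u.leafConn W Z p) (u.leafConn X V p)
          + (D.gamma p (u.leafConn X Z p) (u.leafConn W V p)
            + D.gamma p (u.toVField Z p) (u.leafConn X (u.leafConn W V) p)) := by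
    have hWZ := smoothAt_leafConn hD hu hW hZ
    have hWV := smoothAt_leafConn hD hu hW hV
    refine (dirDeriv_congr ?_ rfl).trans ((dirDeriv_add (smooth_gamma (D := D) hWZ hV)
      (smooth_gamma (D := D) hZ hWV)).trans ?_)
    · filter_upwards [hW.eventually, hZ.eventually, hV.eventually] with q h1 h2 h3
      exact dirDeriv_gamma_leaf hD hu h1 h2 h3
    · rw [dirDeriv_gamma_leaf hD hu hX hWZ hV, dirDeriv_gamma_leaf hD hu hX hZ hWV]
      rfl
  have hb := dirDeriv_gamma_leaf hD hu (smoothAt_leafBracket hD hu hX hW) hZ hV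
  rw [dirDeriv_congr .rfl (toVField_leafBracket_eventuallyEq hD hu hX hW).eq_of_nhds,
    dirDeriv_bracket hX hW (smooth_gamma hZ hV), key hX hW, key hW hX] at hb
  rw [D.gamma_symm p (u.leafCurv X W V p)]
  simp only [leafCurv, Submodule.coe_sub, gamma_sub_left, gamma_sub_right]
  linarith

-- The curvature of `∇̄` itself is not skew, as `∇̄` is not metric. The defect is found by moving to
-- `R^h` with the Gauss equation, using skewness there, and moving back.
include hD hu in
theorem gamma_riemMap_skew (x y z w : u.leafSpace p) :
    D.gamma p (riemMap hD hu p x y z) w = - D.gamma p (riemMap hD hu p x y w) z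
      - D.Y p y z * D.K p x w + D.Y p x z * D.K p y w
      - D.Y p y w * D.K p x z + D.Y p x w * D.K p y z := by
  have hx := smoothAt_extendLeaf hD hu x
  have hy := smoothAt_extendLeaf hD hu y
  have hz := smoothAt_extendLeaf hD hu z
  have hw := smoothAt_extendLeaf hD hu w
  have h := gamma_leafCurv_skew hD hu hx hy hz hw
  rw [gamma_leafCurv hD hu hx hy hz, gamma_leafCurv hD hu hx hy hw] at h
  simp only [toVField_extendLeaf_self hu] at h
  linarith

theorem riemMap_swap (p : M) (x y z : TangentSpace 𝓘(ℝ, E) p) :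
    riemMap hD hu p x y z = - riemMap hD hu p y x z :=
  (isAffineConnection_conn hD hu).curvature_swap (.extendVec x) (.extendVec y) (.extendVec z)

/-! ### The foliation tensors in the characteristic gauge -/

/-- The gauge makes `ℓ_∥` vanish identically, which removes both its Lie derivative and `ℓ♯`. -/
theorem eta_eq (p : M) (x : u.leafSpace p) : u.eta p x = - PiForm hD hu p (D.n p) x := by
  have h1 : u.ellPar = fun _ _ => 0 := funext fun q => funext fun v => hu.ell_tangent q _
  have h2 : u.ellSharp p = 0 := by simp [ellSharp, h1, sharph]
  have h3 : u.chi p 0 x = 0 := by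
    rw [chi, K_eq_KForm hD hu]; simp
  rw [eta, h2, h3, h1, Pi_eq hD hu]
  simp [lieDeriv₁, dirDeriv_const]

theorem leafD_logLam (p : M) (x : u.leafSpace p) : u.leafD u.logLam p x = dLogLam hD hu p x := rfl

/-- `Π(n, x) - Π(x, n) = 2F(n, x)`, which is `d log|λ|(x)` for `x` tangent to the leaves. The
logarithmic term in `τ` thus interchanges the arguments of `Π`. -/
theorem tau_eq (p : M) (x : u.leafSpace p) : u.tau p x = PiForm hD hu p x (D.n p) := by
  rw [tau, eta_eq hD hu, leafD_logLam hD hu, PiForm_apply, PiForm_apply, ell_n hu,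
    hu.ell_tangent, D.Y_symm p x]
  ring

include hu in
theorem leafD_eq (g : M → ℝ) (x : u.leafSpace p) :
    u.leafD g p x = dirDeriv (u.toVField (u.extendLeaf x)) g p := by
  rw [dirDeriv, toVField_extendLeaf_self hu]; rfl

include hD hu

theorem ell_conn_n (x : u.leafSpace p) :
    D.ell p (D.conn D.n (u.toVField (u.extendLeaf x)) p) = u.eta p x := by
  rw [ell_conn hD hu (smoothAt_n hD hu p) (smoothAt_extendLeaf hD hu x), eta_eq hD hu,
    toVField_extendLeaf_self hu]
  simp only [ell_toVField hu, dirDeriv_const]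
  ring

theorem coe_tildeNabla (x : u.leafSpace p) :
    (u.tildeNabla (u.extendLeaf x) p : TangentSpace 𝓘(ℝ, E) p)
      = D.conn D.n (u.toVField (u.extendLeaf x)) p - u.eta p x • D.n p := by
  rw [tildeNabla, coe_proj hu, ell_conn_n hD hu]

theorem coe_leafConn_extendLeaf (x y : u.leafSpace p) :
    (u.leafConn (u.extendLeaf x) (u.extendLeaf y) p : TangentSpace 𝓘(ℝ, E) p)
      = D.conn (u.toVField (u.extendLeaf x)) (u.toVField (u.extendLeaf y)) p
        + D.Y p x y • D.n p := by
  rw [coe_leafConn hD hu (smoothAt_extendLeaf hD hu x) (smoothAt_extendLeaf hD hu y),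
    toVField_extendLeaf_self hu, toVField_extendLeaf_self hu]

end FoliationFunction

end HypersurfaceData

/-! ### Derivatives of the foliation tensors in terms of `∇̄Π` and `∇̄K` -/

namespace HypersurfaceData

variable {E : Type*} [NormedAddCommGroup E] [NormedSpace ℝ E] [FiniteDimensional ℝ E]
  {M : Type*} [TopologicalSpace M] [ChartedSpace E M] [IsManifold 𝓘(ℝ, E) ∞ M]
  {D : HypersurfaceData E M} {p : M}

namespace FoliationFunction

variable {u : D.FoliationFunction} (hD : D.IsCharacteristic) (hu : u.IsCharacteristicGauge)

include hD hu

/-- The two correction terms come from `∇̄_n n = -2ω n` and from the component `η(x) n` that `∇̃_n`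
discards. -/
theorem tildeNabla₁_tau (x : u.leafSpace p) :
    u.tildeNabla₁ u.tau p x = nablaTwo hD hu (PiForm hD hu) p (D.n p) x (D.n p)
      - 2 * D.omega p * u.tau p x + 2 * D.omega p * u.eta p x := by
  have h := nablaTwo_apply hD hu (PiForm hD hu) (smoothAt_n hD hu p)
    (smoothAt_extendLeaf hD hu x) (smoothAt_n hD hu p)
  have h1 : (fun q => u.tau q (u.extendLeaf x q))
      = fun q => PiForm hD hu q (u.toVField (u.extendLeaf x) q) (D.n q) :=
    funext fun q => tau_eq hD hu q _
  rw [toVField_extendLeaf_self hu, conn_n_n hD hu, map_smul, smul_eq_mul,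
    ← tau_eq hD hu] at h
  rw [tildeNabla₁, h1, h, tau_eq hD hu p (u.tildeNabla _ p), coe_tildeNabla hD hu, map_sub,
    map_smul, LinearMap.sub_apply, LinearMap.smul_apply, PiForm_n_n, smul_eq_mul]
  ring

/-- On leaf vectors `Υ` equals `Π`, so `∇̄Π` applies. Discarding `η(x) n` and `η(y) n` produces the
values `Π(n, y) = -η(y)` and `Π(x, n) = τ(x)`. -/
theorem tildeNabla₂_Upsilon (x y : u.leafSpace p) :
    u.tildeNabla₂ u.Upsilon p x y = nablaTwo hD hu (PiForm hD hu) p (D.n p) x y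
      - u.eta p x * u.eta p y + u.eta p y * u.tau p x := by
  have h := nablaTwo_apply hD hu (PiForm hD hu) (smoothAt_n hD hu p)
    (smoothAt_extendLeaf hD hu x) (smoothAt_extendLeaf hD hu y)
  have hY (q : M) (v w : u.leafSpace q) : u.Upsilon q v w = PiForm hD hu q v w :=
    (PiForm_of_tangent hD hu (hu.ell_tangent q v) (hu.ell_tangent q w)).symm
  have h1 : (fun q => u.Upsilon q (u.extendLeaf x q) (u.extendLeaf y q))
      = fun q => PiForm hD hu q (u.toVField (u.extendLeaf x) q) (u.toVField (u.extendLeaf y) q) :=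
    funext fun q => hY q _ _
  rw [toVField_extendLeaf_self hu, toVField_extendLeaf_self hu] at h
  rw [tildeNabla₂, h1, h, hY, hY, coe_tildeNabla hD hu, coe_tildeNabla hD hu, map_sub,
    map_sub, map_smul, map_smul, LinearMap.sub_apply, LinearMap.smul_apply, smul_eq_mul,
    smul_eq_mul, ← tau_eq hD hu, eta_eq hD hu p y]
  ring

/-- Besides `∇̄Π`, differentiating `-Π(n, y)` differentiates `n`; the last term is `Π(n, n)` times
the `n`-component separating `∇^h` from `∇̄`. -/
theorem leafNabla₁_eta (x y : u.leafSpace p) :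
    u.leafNabla₁ u.eta p x y = - nablaTwo hD hu (PiForm hD hu) p x (D.n p) y
      - PiForm hD hu p (nablaN hD hu p x) y + 2 * D.omega p * D.Y p x y := by
  have h := nablaTwo_apply hD hu (PiForm hD hu) (smoothAt_extendLeaf hD hu x)
    (smoothAt_n hD hu p) (smoothAt_extendLeaf hD hu y)
  have h1 : (fun q => u.eta q (u.extendLeaf y q))
      = fun q => - PiForm hD hu q (D.n q) (u.toVField (u.extendLeaf y) q) :=
    funext fun q => eta_eq hD hu q _
  rw [← nablaN_apply hD hu (smoothAt_extendLeaf hD hu x), toVField_extendLeaf_self hu,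
    toVField_extendLeaf_self hu] at h
  have h2 := dirDeriv_neg (u.toVField (u.extendLeaf x))
    (fun q => PiForm hD hu q (D.n q) (u.toVField (u.extendLeaf y) q)) p
  rw [leafNabla₁, leafD_eq hu, h1, h2, eta_eq hD hu,
    coe_leafConn_extendLeaf hD hu, map_add, map_smul, PiForm_n_n, h, smul_eq_mul]
  ring

/-- No correction appears, because the two connections differ by multiples of `n` and `K` kills `n`.
-/
theorem leafNabla₂_chi (x y z : u.leafSpace p) :
    u.leafNabla₂ u.chi p x y z = nablaTwo hD hu (KTensor hD hu) p x y z := by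
  have h := nablaTwo_apply hD hu (KTensor hD hu) (smoothAt_extendLeaf hD hu x)
    (smoothAt_extendLeaf hD hu y) (smoothAt_extendLeaf hD hu z)
  have hK (q : M) (v w : u.leafSpace q) : u.chi q v w = KTensor hD hu q v w :=
    (KTensor_apply hD hu q v w).symm
  have h1 : (fun q => u.chi q (u.extendLeaf y q) (u.extendLeaf z q))
      = fun q => KTensor hD hu q (u.toVField (u.extendLeaf y) q) (u.toVField (u.extendLeaf z) q) :=
    funext fun q => hK q _ _
  simp only [toVField_extendLeaf_self hu] at h
  rw [leafNabla₂, leafD_eq hu, h1, h, hK, hK, coe_leafConn_extendLeaf hD hu,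
    coe_leafConn_extendLeaf hD hu, map_add, map_add, map_smul, map_smul, LinearMap.add_apply,
    LinearMap.smul_apply, KTensor_apply hD hu p (D.n p), KTensor_apply hD hu p _ (D.n p),
    K_n_left hD hu, K_n_right hD hu, smul_zero, smul_zero, add_zero, add_zero]

theorem two_mul_leafD_omega (x : u.leafSpace p) :
    2 * u.leafD D.omega p x = nablaTwo hD hu (PiForm hD hu) p x (D.n p) (D.n p)
      + PiForm hD hu p (nablaN hD hu p x) (D.n p) + PiForm hD hu p (D.n p) (nablaN hD hu p x) := by
  have h := nablaTwo_apply hD hu (PiForm hD hu) (smoothAt_extendLeaf hD hu x)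
    (smoothAt_n hD hu p) (smoothAt_n hD hu p)
  have h1 : (fun q => PiForm hD hu q (D.n q) (D.n q)) = fun q => 2 * D.omega q :=
    funext fun q => PiForm_n_n hD hu q
  have h2 : SmoothFunAt E D.omega p :=
    (smooth_Y (smoothAt_n hD hu p) (smoothAt_n hD hu p)).div (.const 2) two_ne_zero
  rw [← nablaN_apply hD hu (smoothAt_extendLeaf hD hu x), toVField_extendLeaf_self hu, h1,
    dirDeriv_mul (.const 2) h2, dirDeriv_const] at h
  rw [leafD_eq hu]
  linarith

end FoliationFunction

/-! ### Traces -/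

variable {u : D.FoliationFunction} (hD : D.IsCharacteristic) (hu : u.IsCharacteristicGauge)
  {ι : Type*} [Fintype ι] [DecidableEq ι] {e : ι → VField E M} {X : VField E M}

namespace FoliationFunction

include hD hu

theorem IsLeafFrame.ell_eq_zero {q : M} (he : u.IsLeafFrame e q) (k : ι) : D.ell q (e k q) = 0 :=
  (mem_leafSpace_iff hu).1 (he.tangent k)

theorem gamma_conn_frame_skew (hs : ∀ k, (e k).SmoothAt p) (he : ∀ᶠ q in 𝓝 p, u.IsLeafFrame e q)
    (hX : X.SmoothAt p) (k l : ι) :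
    D.gamma p (D.conn X (e k) p) (e l p) = - D.gamma p (D.conn X (e l) p) (e k p) := by
  have h := dirDeriv_gamma hD hu hX (hs k) (hs l)
  have h0 : (fun q => D.gamma q (e k q) (e l q)) =ᶠ[𝓝 p] fun _ => if k = l then 1 else 0 :=
    he.mono fun q hq => hq.orthonormal k l
  rw [dirDeriv_congr h0 rfl, dirDeriv_const, he.self_of_nhds.ell_eq_zero hD hu,
    he.self_of_nhds.ell_eq_zero hD hu, D.gamma_symm p (e k p)] at h
  linarith

/-- The leaf part of `∇̄_X e_k` has skew coefficients, since the frame is orthonormal and `∇̄γ`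
vanishes on leaf vectors. Contracted with a form symmetric on the frame it contributes nothing, so
only the `n`-component is left. -/
theorem sum_conn_frame (hs : ∀ k, (e k).SmoothAt p) (he : ∀ᶠ q in 𝓝 p, u.IsLeafFrame e q)
    (hX : X.SmoothAt p) (B : TangentSpace 𝓘(ℝ, E) p →ₗ[ℝ] TangentSpace 𝓘(ℝ, E) p →ₗ[ℝ] ℝ)
    (hB : ∀ k l, B (e k p) (e l p) = B (e l p) (e k p)) :
    ∑ k, B (D.conn X (e k) p) (e k p)
      = ∑ k, D.ell p (D.conn X (e k) p) * B (D.n p) (e k p) := by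
  have h1 (k : ι) : B (D.conn X (e k) p) (e k p)
      = D.ell p (D.conn X (e k) p) * B (D.n p) (e k p)
        + ∑ l, D.gamma p (D.conn X (e k) p) (e l p) * B (e l p) (e k p) := by
    have h := congrArg (fun v => B v (e k p))
      (he.self_of_nhds.sub_ell_smul_n hD hu (D.conn X (e k) p))
    simp only [map_sub, map_sum, map_smul, LinearMap.sub_apply, LinearMap.sum_apply,
      LinearMap.smul_apply, smul_eq_mul] at h
    linarith
  have h2 : ∑ k, ∑ l, D.gamma p (D.conn X (e k) p) (e l p) * B (e l p) (e k p)
      = - ∑ k, ∑ l, D.gamma p (D.conn X (e k) p) (e l p) * B (e l p) (e k p) := by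
    conv_lhs => rw [Finset.sum_comm]
    simp only [← Finset.sum_neg_distrib]
    refine Finset.sum_congr rfl fun k _ => Finset.sum_congr rfl fun l _ => ?_
    rw [gamma_conn_frame_skew hD hu hs he hX, hB]
    ring
  simp only [h1, Finset.sum_add_distrib]
  linarith

/-- Symmetry of `T` is required on leaf vectors only, so that `Π`, which is not symmetric against
`n`, is covered. -/
theorem dirDeriv_trace (hs : ∀ k, (e k).SmoothAt p) (he : ∀ᶠ q in 𝓝 p, u.IsLeafFrame e q)
    (hX : X.SmoothAt p) (T : TwoForm E M)
    (hT : ∀ k l, T p (e k p) (e l p) = T p (e l p) (e k p)) :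
    dirDeriv X (fun q => ∑ k, T q (e k q) (e k q)) p
      = ∑ k, (nablaTwo hD hu T p (X p) (e k p) (e k p) + D.ell p (D.conn X (e k) p)
        * (T p (D.n p) (e k p) + T p (e k p) (D.n p))) := by
  have h1 := sum_conn_frame hD hu hs he hX (T p) hT
  have h2 := sum_conn_frame hD hu hs he hX (T p).flip fun k l => hT l k
  simp only [LinearMap.flip_apply] at h2
  rw [dirDeriv_sum fun k _ => T.smooth (hs k) (hs k)]
  have h3 (k : ι) := nablaTwo_apply hD hu T hX (hs k) (hs k)
  simp only [h3, mul_add, Finset.sum_add_distrib, Finset.sum_sub_distrib, ← h1, ← h2]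
  ring

theorem IsLeafFrame.trChi_eq {q : M} (he : u.IsLeafFrame e q) :
    u.trChi q = ∑ k, KTensor hD hu q (e k q) (e k q) :=
  he.trh_eq_sum _ fun v w => (KTensor_apply hD hu q v w).symm

omit hD hu in
theorem IsLeafFrame.trUpsilon_eq {q : M} (he : u.IsLeafFrame e q) :
    u.trUpsilon q = ∑ k, D.Y q (e k q) (e k q) :=
  he.trh_eq_sum (D.YForm q) fun _ _ => rfl

theorem dirDeriv_trChi (hs : ∀ k, (e k).SmoothAt p) (he : ∀ᶠ q in 𝓝 p, u.IsLeafFrame e q)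
    (hX : X.SmoothAt p) :
    dirDeriv X u.trChi p = ∑ k, nablaTwo hD hu (KTensor hD hu) p (X p) (e k p) (e k p) := by
  rw [dirDeriv_congr (he.mono fun q hq => hq.trChi_eq hD hu) rfl,
    dirDeriv_trace hD hu hs he hX _ fun k l => by
      rw [KTensor_apply, KTensor_apply, K_symm hD hu]]
  simp only [KTensor_apply, K_n_left hD hu, K_n_right hD hu, add_zero, mul_zero]

/-- `Π` replaces `Υ` under the trace. The `n`-component of `∇̄_n e_k` is `η(e_k)`, so the correction
in `dirDeriv_trace` is `η(e_k)(τ(e_k) - η(e_k))`, the same as in `tildeNabla₂_Upsilon`. -/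
theorem dirDeriv_n_trUpsilon (hs : ∀ k, (e k).SmoothAt p)
    (he : ∀ᶠ q in 𝓝 p, u.IsLeafFrame e q) : dirDeriv D.n u.trUpsilon p
      = ∑ k, u.tildeNabla₂ u.Upsilon p (he.self_of_nhds.vec k) (he.self_of_nhds.vec k) := by
  have hp := he.self_of_nhds
  have h1 : u.trUpsilon =ᶠ[𝓝 p] fun q => ∑ k, PiForm hD hu q (e k q) (e k q) :=
    he.mono fun q hq => hq.trUpsilon_eq.trans (Finset.sum_congr rfl fun k _ =>
      (PiForm_of_tangent hD hu (hq.ell_eq_zero hD hu k) (hq.ell_eq_zero hD hu k)).symm)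
  rw [dirDeriv_congr h1 rfl, dirDeriv_trace hD hu hs he (smoothAt_n hD hu p) _ fun k l => by
    rw [PiForm_of_tangent hD hu (hp.ell_eq_zero hD hu k) (hp.ell_eq_zero hD hu l),
      PiForm_of_tangent hD hu (hp.ell_eq_zero hD hu l) (hp.ell_eq_zero hD hu k), D.Y_symm]]
  refine Finset.sum_congr rfl fun k _ => ?_
  have h2 : D.ell p (D.conn D.n (e k) p) = - PiForm hD hu p (D.n p) (e k p) := by
    have h0 : (fun q => D.ell q (e k q)) =ᶠ[𝓝 p] fun _ => 0 :=
      he.mono fun q hq => hq.ell_eq_zero hD hu k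
    rw [ell_conn hD hu (smoothAt_n hD hu p) (hs k), dirDeriv_congr h0 rfl, dirDeriv_const]
    ring
  have h3 : (hp.vec k : TangentSpace 𝓘(ℝ, E) p) = e k p := rfl
  rw [tildeNabla₂_Upsilon hD hu, h2, eta_eq hD hu, tau_eq hD hu, h3]
  ring

theorem trace_K_nablaN (he : u.IsLeafFrame e p) (a : TangentSpace 𝓘(ℝ, E) p →ₗ[ℝ] ℝ)
    (x : u.leafSpace p) : ∑ k, D.K p x (e k p) * a (e k p)
      = a (nablaN hD hu p x) + u.tau p x * a (D.n p) := by
  rw [map_nablaN hD hu he, tau_eq hD hu]; ring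

end FoliationFunction

end HypersurfaceData

namespace HypersurfaceData

variable {E : Type*} [NormedAddCommGroup E] [NormedSpace ℝ E] [FiniteDimensional ℝ E]
  {M : Type*} [TopologicalSpace M] [ChartedSpace E M] [IsManifold 𝓘(ℝ, E) ∞ M]
  {D : HypersurfaceData E M} {p : M} {u : D.FoliationFunction}
  (hD : D.IsCharacteristic) (hu : u.IsCharacteristicGauge)
  {ι : Type*} [Fintype ι] [DecidableEq ι] {e : ι → VField E M}

/-! ### The constraint tensors in a frame -/

/-- The form `(c, d) ↦ B_{acbd}`. -/
def BMap (p : M) (a b : TangentSpace 𝓘(ℝ, E) p) :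
    TangentSpace 𝓘(ℝ, E) p →ₗ[ℝ] TangentSpace 𝓘(ℝ, E) p →ₗ[ℝ] ℝ :=
  LinearMap.mk₂ ℝ (fun c d => D.gammaForm p a (riemMap hD hu p b d c)
      + (nablaTwo hD hu (KTensor hD hu) p d b c
        - nablaTwo hD hu (KTensor hD hu) p b d c) * D.ell p a
      + KTensor hD hu p b c * PiForm hD hu p d a - KTensor hD hu p d c * PiForm hD hu p b a)
    (fun _ _ _ => by simp only [map_add]; ring)
    (fun _ _ _ => by simp only [map_smul, smul_eq_mul]; ring)
    (fun _ _ _ => by simp only [map_add, LinearMap.add_apply]; ring)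
    (fun _ _ _ => by simp only [map_smul, LinearMap.smul_apply, smul_eq_mul]; ring)

/-- The form `(a, b) ↦ B_{acbc}`. -/
def BDiagMap (p : M) (c : TangentSpace 𝓘(ℝ, E) p) :
    TangentSpace 𝓘(ℝ, E) p →ₗ[ℝ] TangentSpace 𝓘(ℝ, E) p →ₗ[ℝ] ℝ :=
  LinearMap.mk₂ ℝ (fun a b => BMap hD hu p a b c c)
    (fun _ _ _ => by
      simp only [BMap, LinearMap.mk₂_apply, map_add, LinearMap.add_apply]; ring)
    (fun _ _ _ => by
      simp only [BMap, LinearMap.mk₂_apply, map_smul, LinearMap.smul_apply, smul_eq_mul]; ring)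
    (fun _ _ _ => by
      simp only [BMap, LinearMap.mk₂_apply, map_add, LinearMap.add_apply]; ring)
    (fun _ _ _ => by
      simp only [BMap, LinearMap.mk₂_apply, map_smul, LinearMap.smul_apply, smul_eq_mul]; ring)

/-- The form `(a, b) ↦ (A_{bac} + A_{abc}) n^c`. -/
def AMap (p : M) : TangentSpace 𝓘(ℝ, E) p →ₗ[ℝ] TangentSpace 𝓘(ℝ, E) p →ₗ[ℝ] ℝ :=
  LinearMap.mk₂ ℝ (fun a b => (nablaTwo hD hu (PiForm hD hu) p (D.n p) a b
      - nablaTwo hD hu (PiForm hD hu) p a (D.n p) b)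
      + (nablaTwo hD hu (PiForm hD hu) p (D.n p) b a
        - nablaTwo hD hu (PiForm hD hu) p b (D.n p) a))
    (fun _ _ _ => by simp only [map_add, LinearMap.add_apply]; ring)
    (fun _ _ _ => by simp only [map_smul, LinearMap.smul_apply, smul_eq_mul]; ring)
    (fun _ _ _ => by simp only [map_add, LinearMap.add_apply]; ring)
    (fun _ _ _ => by simp only [map_smul, LinearMap.smul_apply, smul_eq_mul]; ring)

/-- The scalar `H` contracts `𝓡` over an arbitrary basis. Passing to a frame requires `𝓡` to be
bilinear, which this form makes evident. -/
theorem Rcon_eq_map (he : u.IsLeafFrame e p) (a b : TangentSpace 𝓘(ℝ, E) p) :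
    D.Rcon p a b = ((∑ k, BDiagMap hD hu p (e k p)) - AMap hD hu p) a b := by
  rw [Rcon, he.trP_eq_sum hD hu (BMap hD hu p a b) fun c d => by
    rw [B_eq hD hu, ← KTensor_apply hD hu, ← KTensor_apply hD hu]; rfl, A_eq hD hu, A_eq hD hu]
  simp only [LinearMap.sub_apply, LinearMap.sum_apply]
  rfl

theorem Rcon_eq (he : u.IsLeafFrame e p) (a b : TangentSpace 𝓘(ℝ, E) p) :
    D.Rcon p a b = ∑ k, (D.gamma p a (riemMap hD hu p b (e k p) (e k p))
        + (nablaTwo hD hu (KTensor hD hu) p (e k p) b (e k p)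
          - nablaTwo hD hu (KTensor hD hu) p b (e k p) (e k p)) * D.ell p a
        + D.K p b (e k p) * PiForm hD hu p (e k p) a
        - D.K p (e k p) (e k p) * PiForm hD hu p b a)
      - ((nablaTwo hD hu (PiForm hD hu) p (D.n p) a b
        - nablaTwo hD hu (PiForm hD hu) p a (D.n p) b)
        + (nablaTwo hD hu (PiForm hD hu) p (D.n p) b a
          - nablaTwo hD hu (PiForm hD hu) p b (D.n p) a)) := by
  rw [Rcon_eq_map hD hu he, LinearMap.sub_apply, LinearMap.sub_apply, LinearMap.sum_apply,
    LinearMap.sum_apply]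
  simp only [BDiagMap, BMap, AMap, LinearMap.mk₂_apply, KTensor_apply, gammaForm_apply]

include hD hu in
theorem H_eq (he : u.IsLeafFrame e p) : D.H p = - (∑ k, D.Rcon p (e k p) (e k p)) / 2 := by
  rw [H, he.trP_eq_sum hD hu _ (Rcon_eq_map hD hu he)]
  simp only [Rcon_eq_map hD hu he]

/-- With `a = n` the curvature term disappears by `γ(n, ·) = 0`, and one of the two `A`-terms
vanishes by antisymmetry. -/
theorem J_eq (he : u.IsLeafFrame e p) (b : TangentSpace 𝓘(ℝ, E) p) :
    D.J p b = ∑ k, nablaTwo hD hu (KTensor hD hu) p (e k p) b (e k p)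
        - ∑ k, nablaTwo hD hu (KTensor hD hu) p b (e k p) (e k p)
        + ∑ k, D.K p b (e k p) * PiForm hD hu p (e k p) (D.n p)
        - (∑ k, D.K p (e k p) (e k p)) * PiForm hD hu p b (D.n p)
        - nablaTwo hD hu (PiForm hD hu) p (D.n p) b (D.n p)
        + nablaTwo hD hu (PiForm hD hu) p b (D.n p) (D.n p) := by
  rw [J, Rcon_eq hD hu he]
  simp only [gamma_n_left hD hu, ell_n hu, Finset.sum_add_distrib, Finset.sum_sub_distrib,
    Finset.sum_mul]
  simp only [zero_add, mul_one, Finset.sum_sub_distrib, Finset.sum_const_zero]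
  ring

/-! ### The constraint equations -/

namespace FoliationFunction

include hD hu in
theorem IsLeafFrame.sum_K (he : u.IsLeafFrame e p) :
    ∑ k, D.K p (e k p) (e k p) = u.trChi p := by
  rw [he.trChi_eq hD hu]
  simp only [KTensor_apply]

include hD hu in
theorem IsLeafFrame.chiSq_eq (he : u.IsLeafFrame e p) :
    u.chiSq p = ∑ k, ∑ l, D.K p (e k p) (e l p) * D.K p (e k p) (e l p) := by
  have h1 (a c : u.leafSpace p) : u.trh p (fun b d => u.chi p a b * u.chi p c d)
      = ∑ k, KTensor hD hu p a (e k p) * KTensor hD hu p c (e k p) := by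
    refine he.trh_eq_sum (LinearMap.mk₂ ℝ
      (fun b d => KTensor hD hu p a b * KTensor hD hu p c d)
      (fun _ _ _ => by simp only [map_add]; ring)
      (fun _ _ _ => by simp only [map_smul, smul_eq_mul]; ring)
      (fun _ _ _ => by simp only [map_add]; ring)
      (fun _ _ _ => by simp only [map_smul, smul_eq_mul]; ring)) fun v w => ?_
    rw [LinearMap.mk₂_apply, KTensor_apply, KTensor_apply]
    rfl
  rw [chiSq, he.trh_eq_sum (∑ k, LinearMap.mk₂ ℝ
      (fun a c => KTensor hD hu p a (e k p) * KTensor hD hu p c (e k p))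
      (fun _ _ _ => by simp only [map_add, LinearMap.add_apply]; ring)
      (fun _ _ _ => by simp only [map_smul, LinearMap.smul_apply, smul_eq_mul]; ring)
      (fun _ _ _ => by simp only [map_add, LinearMap.add_apply]; ring)
      (fun _ _ _ => by simp only [map_smul, LinearMap.smul_apply, smul_eq_mul]; ring)) fun a c => by
        rw [h1]; simp only [LinearMap.sum_apply, LinearMap.mk₂_apply]]
  simp only [LinearMap.sum_apply, LinearMap.mk₂_apply, KTensor_apply]

theorem IsLeafFrame.chiDot_eq (he : u.IsLeafFrame e p) {α : (q : M) → u.leafSpace q → ℝ}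
    (a : TangentSpace 𝓘(ℝ, E) p →ₗ[ℝ] ℝ) (ha : ∀ v, α p v = a v) (x : u.leafSpace p) :
    u.chiDot α p x = a (nablaN hD hu p x) + u.tau p x * a (D.n p) := by
  rw [← trace_K_nablaN hD hu he, chiDot, he.trh_eq_sum (LinearMap.mk₂ ℝ
      (fun b c => KTensor hD hu p b x * a c)
      (fun _ _ _ => by simp only [map_add, LinearMap.add_apply]; ring)
      (fun _ _ _ => by simp only [map_smul, LinearMap.smul_apply, smul_eq_mul]; ring)
      (fun _ _ _ => by simp only [map_add]; ring)
      (fun _ _ _ => by simp only [map_smul, smul_eq_mul]; ring)) fun v w => by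
        rw [LinearMap.mk₂_apply, KTensor_apply, ← ha]; rfl]
  simp only [LinearMap.mk₂_apply, KTensor_apply, K_symm hD hu p (x : TangentSpace 𝓘(ℝ, E) p)]

theorem nablaTwo_KTensor_symm (a b c : TangentSpace 𝓘(ℝ, E) p) :
    nablaTwo hD hu (KTensor hD hu) p a b c = nablaTwo hD hu (KTensor hD hu) p a c b := by
  have h := nablaTwo_apply hD hu (KTensor hD hu) (.extendVec a) (.extendVec b) (.extendVec c)
  have h' := nablaTwo_apply hD hu (KTensor hD hu) (.extendVec a) (.extendVec c) (.extendVec b)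
  have h1 (q : M) (v w : TangentSpace 𝓘(ℝ, E) q) :
      KTensor hD hu q v w = KTensor hD hu q w v := by
    rw [KTensor_apply, KTensor_apply, K_symm hD hu]
  simp only [extendVec_self] at h h'
  rw [h, h', h1 p _ c, h1 p b]
  simp only [h1 _ (extendVec b _)]
  ring

theorem IsLeafFrame.div₂_chi_eq (he : u.IsLeafFrame e p) (x : u.leafSpace p) :
    u.div₂ u.chi p x = ∑ k, nablaTwo hD hu (KTensor hD hu) p (e k p) x (e k p) := by
  rw [div₂, he.trh_eq_sum ((nablaTwo hD hu (KTensor hD hu) p).flip x) fun v w => by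
    rw [leafNabla₂_chi hD hu, nablaTwo_KTensor_symm]; rfl]
  rfl

include hD hu in
/-- The Raychaudhuri equation. -/
theorem J_n (p : M) : D.J p (D.n p)
    = - dirDeriv D.n u.trChi p - 2 * D.omega p * u.trChi p - u.chiSq p := by
  obtain ⟨e, hs, he⟩ := exists_isLeafFrame hD hu p
  have hp := he.self_of_nhds
  -- As `K(n, ·)` is identically zero, `(∇̄K)(n, e_k)` reduces to `-K(∇̄ n, e_k)`; this is where
  -- `|χ|²` arises.
  have h1 (k) : nablaTwo hD hu (KTensor hD hu) p (e k p) (D.n p) (e k p)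
      = - ∑ l, D.K p (e k p) (e l p) * D.K p (e k p) (e l p) := by
    have h := map_nablaN hD hu hp (KTensor hD hu p (e k p)) (e k p)
    simp only [KTensor_apply, K_n_right hD hu, mul_zero, sub_zero] at h
    rw [nablaTwo_apply hD hu _ (hs k) (smoothAt_n hD hu p) (hs k),
      ← nablaN_apply hD hu (hs k)]
    simp only [KTensor_apply, K_n_left hD hu, dirDeriv_const]
    rw [K_symm hD hu p (nablaN hD hu p (e k p)), h]
    ring
  rw [J_eq hD hu hp, ← dirDeriv_trChi hD hu hs he (smoothAt_n hD hu p), hp.sum_K hD hu,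
    hp.chiSq_eq hD hu, PiForm_n_n]
  simp only [h1, K_n_left hD hu, zero_mul, Finset.sum_const_zero, Finset.sum_neg_distrib]
  ring

-- The `∇̄K` terms of `J_eq` are `div χ - d tr χ`. Its `∇̄Π` terms are rewritten through `∇̃_n τ`
-- and `dω`, and the contraction `K · Π(·, n)` is `χ · τ`.
include hD hu in
theorem J_tangent (x : u.leafSpace p) : D.J p x
    = - u.tildeNabla₁ u.tau p x + 2 * u.leafD D.omega p x - u.chiDot u.tau p x
        - u.tau p x * u.trChi p + u.div₂ u.chi p x
        - u.leafD u.trChi p x - 2 * D.omega p * u.leafD u.logLam p x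
        - u.chiDot (u.leafD u.logLam) p x := by
  obtain ⟨e, hs, he⟩ := exists_isLeafFrame hD hu p
  have hp := he.self_of_nhds
  have h1 := dirDeriv_trChi hD hu hs he (smoothAt_extendLeaf hD hu x)
  rw [← leafD_eq hu, toVField_extendLeaf_self hu] at h1
  have h2 := trace_K_nablaN hD hu hp ((PiForm hD hu p).flip (D.n p)) x
  have h3 := hp.chiDot_eq hD hu (α := u.tau) ((PiForm hD hu p).flip (D.n p))
    (fun v => tau_eq hD hu p v) x
  have h4 := hp.chiDot_eq hD hu (α := u.leafD u.logLam) (dLogLam hD hu p)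
    (fun v => leafD_logLam hD hu p v) x
  -- The derivative of `2ω = Π(n, n)` contains `∇̄_x n` in both slots. Exchanging the slots costs
  -- `2F`, which accounts for `χ · d log|λ|`.
  have h5 : PiForm hD hu p (nablaN hD hu p x) (D.n p) - PiForm hD hu p (D.n p) (nablaN hD hu p x)
      = D.ell p (nablaN hD hu p x) * dLogLam hD hu p (D.n p)
        - dLogLam hD hu p (nablaN hD hu p x) := by
    rw [PiForm_apply, PiForm_apply, ell_n hu, D.Y_symm p (D.n p)]
    ring
  have h6 := two_mul_leafD_omega hD hu x
  have h7 := tildeNabla₁_tau hD hu x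
  have h8 : u.eta p x = - u.tau p x - u.leafD u.logLam p x := by rw [tau]; ring
  rw [ell_nablaN, ← tau_eq hD hu] at h5
  simp only [LinearMap.flip_apply, PiForm_n_n] at h2 h3
  rw [h8] at h7
  rw [J_eq hD hu hp, ← h1, hp.sum_K hD hu, ← hp.div₂_chi_eq hD hu, h2, ← tau_eq hD hu, h3, h4, h7]
  linear_combination h5 - h6

theorem IsLeafFrame.leafRicci_eq (he : u.IsLeafFrame e p) (x y : u.leafSpace p) :
    u.leafRicci p x y = ∑ k, (D.gamma p (riemMap hD hu p (e k p) y x) (e k p)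
      + D.Y p y x * D.K p (e k p) (e k p) - D.Y p (e k p) x * D.K p y (e k p)) := by
  rw [leafRicci, he.trh_eq_sum (LinearMap.mk₂ ℝ
      (fun c d => D.gammaForm p (riemMap hD hu p c y x) d
        + D.YForm p y x * KTensor hD hu p c d - D.YForm p c x * KTensor hD hu p y d)
      (fun _ _ _ => by simp only [map_add, LinearMap.add_apply]; ring)
      (fun _ _ _ => by simp only [map_smul, LinearMap.smul_apply, smul_eq_mul]; ring)
      (fun _ _ _ => by simp only [map_add]; ring)
      (fun _ _ _ => by simp only [map_smul, smul_eq_mul]; ring)) fun v w => ?_]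
  · simp only [LinearMap.mk₂_apply, gammaForm_apply, YForm_apply, KTensor_apply]
  · have hv := smoothAt_extendLeaf hD hu v
    have hy := smoothAt_extendLeaf hD hu y
    have hx := smoothAt_extendLeaf hD hu x
    refine (gamma_leafCurv hD hu hv hy hx _).trans ?_
    simp only [toVField_extendLeaf_self hu, LinearMap.mk₂_apply, gammaForm_apply, YForm_apply,
      KTensor_apply]

include hD hu in
theorem IsLeafFrame.leafScalar_eq (he : u.IsLeafFrame e p) :
    u.leafScalar p = ∑ k, u.leafRicci p (he.vec k) (he.vec k) := by
  rw [leafScalar, he.trh_eq_sum (∑ k, LinearMap.mk₂ ℝ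
      (fun x y => D.gammaForm p (riemMap hD hu p (e k p) y x) (e k p)
        + D.YForm p y x * KTensor hD hu p (e k p) (e k p)
        - D.YForm p (e k p) x * KTensor hD hu p y (e k p))
      (fun _ _ _ => by simp only [map_add, LinearMap.add_apply]; ring)
      (fun _ _ _ => by simp only [map_smul, LinearMap.smul_apply, smul_eq_mul]; ring)
      (fun _ _ _ => by simp only [map_add, LinearMap.add_apply]; ring)
      (fun _ _ _ => by simp only [map_smul, LinearMap.smul_apply, smul_eq_mul]; ring))
        fun x y => ?_]
  · simp only [he.leafRicci_eq hD hu, LinearMap.sum_apply, LinearMap.mk₂_apply, gammaForm_apply,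
      YForm_apply, KTensor_apply]
    rfl
  · simp only [he.leafRicci_eq hD hu, LinearMap.sum_apply, LinearMap.mk₂_apply, gammaForm_apply,
      YForm_apply, KTensor_apply]

include hD hu in
theorem IsLeafFrame.div₁_eta_eq (he : u.IsLeafFrame e p) :
    u.div₁ u.eta p = ∑ k, u.leafNabla₁ u.eta p (he.vec k) (he.vec k) := by
  rw [div₁, he.trh_eq_sum (-(nablaTwo hD hu (PiForm hD hu) p).flip (D.n p)
    - PiForm hD hu p ∘ₗ nablaN hD hu p + (2 * D.omega p) • D.YForm p) (leafNabla₁_eta hD hu)]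
  refine Finset.sum_congr rfl fun k _ => ?_
  rw [leafNabla₁_eta hD hu (he.vec k) (he.vec k)]
  rfl

include hD hu in
theorem IsLeafFrame.etaSq_eq (he : u.IsLeafFrame e p) :
    u.etaSq p = ∑ k, u.eta p (he.vec k) * u.eta p (he.vec k) := by
  rw [etaSq, he.trh_eq_sum (LinearMap.mk₂ ℝ
      (fun a b => (- PiForm hD hu p (D.n p) a) * (- PiForm hD hu p (D.n p) b))
      (fun _ _ _ => by simp only [map_add]; ring)
      (fun _ _ _ => by simp only [map_smul, smul_eq_mul]; ring)
      (fun _ _ _ => by simp only [map_add]; ring)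
      (fun _ _ _ => by simp only [map_smul, smul_eq_mul]; ring)) fun v w => by
        rw [eta_eq hD hu, eta_eq hD hu]; rfl]
  simp only [eta_eq hD hu]
  rfl

omit [Fintype ι] [DecidableEq ι] in
theorem tildeNabla₂_Upsilon_symm (x y : u.leafSpace p) :
    u.tildeNabla₂ u.Upsilon p x y = u.tildeNabla₂ u.Upsilon p y x := by
  have h (q : M) (v w : u.leafSpace q) : u.Upsilon q v w = u.Upsilon q w v := D.Y_symm q v w
  have h1 : (fun q => u.Upsilon q (u.extendLeaf x q) (u.extendLeaf y q))
      = fun q => u.Upsilon q (u.extendLeaf y q) (u.extendLeaf x q) := funext fun q => h q _ _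
  rw [tildeNabla₂, tildeNabla₂, h1, h p _ y, h p x]
  ring

-- The Gauss equation and the skewness defect turn the contracted curvature into `R^h`, `tr Υ`, `tr
-- χ` and contractions `K · Y`. The latter are, up to `τ η`, the terms `Π(∇̄_x n, y)` in `∇^h η`;
-- the remaining `∇̄Π` terms are `∇̃_n Υ` and `∇^h η`.
include hD hu in
theorem Rcon_tangent (x y : u.leafSpace p) : D.Rcon p x y
    = u.leafRicci p x y - 2 * u.tildeNabla₂ u.Upsilon p x y + 4 * D.omega p * u.Upsilon p x y
        - u.leafNabla₁ u.eta p x y - u.leafNabla₁ u.eta p y x - 2 * u.eta p x * u.eta p y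
        - u.chi p x y * u.trUpsilon p - u.Upsilon p x y * u.trChi p := by
  obtain ⟨e, hs, he⟩ := exists_isLeafFrame hD hu p
  have hp := he.self_of_nhds
  have hl (k) : D.ell p (e k p) = 0 := hp.ell_eq_zero hD hu k
  have hPi {v w : TangentSpace 𝓘(ℝ, E) p} (hv : D.ell p v = 0) (hw : D.ell p w = 0) :=
    PiForm_of_tangent hD hu hv hw
  have hS (x y : u.leafSpace p) : PiForm hD hu p (nablaN hD hu p x) y
      = ∑ k, D.K p x (e k p) * D.Y p (e k p) y + u.tau p x * u.eta p y := by
    have h := map_nablaN hD hu hp ((PiForm hD hu p).flip y) x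
    simp only [LinearMap.flip_apply, hPi (hl _) (hu.ell_tangent p y)] at h
    rw [h, tau_eq hD hu, eta_eq hD hu]
    ring
  -- `𝓡` traces the curvature over its second and third vector arguments, and the Ricci tensor over
  -- the first and the lowered one. Swapping the first pair and using the skewness relation matches
  -- them, at the price of `Y K` terms.
  have hR (k) : D.gamma p x (riemMap hD hu p y (e k p) (e k p))
      = D.gamma p (riemMap hD hu p (e k p) y x) (e k p)
        - D.Y p (e k p) (e k p) * D.K p y x + D.K p x (e k p) * D.Y p (e k p) y
        - D.Y p (e k p) x * D.K p y (e k p) + D.Y p y x * D.K p (e k p) (e k p) := by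
    have h := gamma_riemMap_skew hD hu y (hp.vec k) (hp.vec k) x
    have h3 : (hp.vec k : TangentSpace 𝓘(ℝ, E) p) = e k p := rfl
    rw [h3, riemMap_swap hD hu p y (e k p) x, D.gamma_symm p _ (x : TangentSpace 𝓘(ℝ, E) p),
      ← gammaForm_apply, ← gammaForm_apply, map_neg, LinearMap.neg_apply, gammaForm_apply,
      gammaForm_apply] at h
    rw [h, D.Y_symm p y (e k p), K_symm hD hu p (e k p) x]
    ring
  have h1 : D.Rcon p x y = u.leafRicci p x y - u.chi p x y * u.trUpsilon p
      - u.Upsilon p x y * u.trChi p + ∑ k, D.K p x (e k p) * D.Y p (e k p) y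
      + ∑ k, D.K p y (e k p) * D.Y p (e k p) x
      - ((nablaTwo hD hu (PiForm hD hu) p (D.n p) x y
        - nablaTwo hD hu (PiForm hD hu) p x (D.n p) y)
        + (nablaTwo hD hu (PiForm hD hu) p (D.n p) y x
          - nablaTwo hD hu (PiForm hD hu) p y (D.n p) x)) := by
    rw [Rcon_eq hD hu hp, hp.leafRicci_eq hD hu, hp.trUpsilon_eq, ← hp.sum_K hD hu]
    congr 1
    simp only [Finset.mul_sum, ← Finset.sum_add_distrib, ← Finset.sum_sub_distrib]
    refine Finset.sum_congr rfl fun k _ => ?_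
    rw [hR, hu.ell_tangent, hPi (hl k) (hu.ell_tangent p x),
      hPi (hu.ell_tangent p y) (hu.ell_tangent p x), chi, Upsilon, K_symm hD hu p x y,
      D.Y_symm p x y]
    ring
  have h2 := tildeNabla₂_Upsilon hD hu x y
  have h3 := tildeNabla₂_Upsilon hD hu y x
  have h4 := leafNabla₁_eta hD hu x y
  have h5 := leafNabla₁_eta hD hu y x
  rw [← tildeNabla₂_Upsilon_symm] at h3
  rw [hS, D.Y_symm] at h5
  rw [hS] at h4
  rw [h1, Upsilon]
  linear_combination h2 + h3 + h4 + h5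

-- Trace of `Rcon_tangent` over a frame, times `-1/2`; the trace of `∇̃_n Υ` is `n(tr_h Υ)` by
-- `dirDeriv_n_trUpsilon`.
include hD hu in
theorem H_formula (p : M) : D.H p
    = dirDeriv D.n u.trUpsilon p + u.etaSq p + u.div₁ u.eta p - u.leafScalar p / 2
        + (u.trChi p - 2 * D.omega p) * u.trUpsilon p := by
  obtain ⟨e, hs, he⟩ := exists_isLeafFrame hD hu p
  have hp := he.self_of_nhds
  have h1 : ∑ k, D.Rcon p (e k p) (e k p) = ∑ k, D.Rcon p (hp.vec k) (hp.vec k) := rfl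
  have h2 : u.trUpsilon p = ∑ k, u.Upsilon p (hp.vec k) (hp.vec k) := hp.trUpsilon_eq
  have h3 : u.trChi p = ∑ k, u.chi p (hp.vec k) (hp.vec k) := (hp.sum_K hD hu).symm
  rw [H_eq hD hu hp, h1, hp.leafScalar_eq hD hu, hp.div₁_eta_eq hD hu, hp.etaSq_eq hD hu,
    dirDeriv_n_trUpsilon hD hu hs he]
  simp only [Rcon_tangent hD hu, Finset.sum_add_distrib, Finset.sum_sub_distrib,
    ← Finset.mul_sum, ← Finset.sum_mul, mul_assoc, ← h2, ← h3]
  ring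

end FoliationFunction

end HypersurfaceData

end

/-! ### The constraint equations -/

theorem mainTheorem3
    {E : Type*} [NormedAddCommGroup E] [NormedSpace ℝ E] [FiniteDimensional ℝ E]
    {M : Type*} [TopologicalSpace M] [T2Space M] [SecondCountableTopology M]
    [ChartedSpace E M] [IsManifold 𝓘(ℝ, E) ∞ M]
    (D : HypersurfaceData E M) (hD : D.IsCharacteristic)
    (u : D.FoliationFunction) (hu : u.IsCharacteristicGauge) :
    -- the connections that enter are the ones fixed by their defining conditions
    D.IsHypersurfaceConnection D.conn ∧ u.IsLeafLeviCivita u.leafConn ∧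
    -- the Raychaudhuri equation
    (∀ p, D.J p (D.n p) =
      - dirDeriv D.n u.trChi p - 2 * D.omega p * u.trChi p - u.chiSq p) ∧
    (∀ p (x : u.leafSpace p), D.J p x =
      - u.tildeNabla₁ u.tau p x + 2 * u.leafD D.omega p x - u.chiDot u.tau p x
        - u.tau p x * u.trChi p + u.div₂ u.chi p x
        - u.leafD u.trChi p x - 2 * D.omega p * u.leafD u.logLam p x
        - u.chiDot (u.leafD u.logLam) p x) ∧
    (∀ p (x y : u.leafSpace p), D.Rcon p x y =
      u.leafRicci p x y - 2 * u.tildeNabla₂ u.Upsilon p x y + 4 * D.omega p * u.Upsilon p x y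
        - u.leafNabla₁ u.eta p x y - u.leafNabla₁ u.eta p y x - 2 * u.eta p x * u.eta p y
        - u.chi p x y * u.trUpsilon p - u.Upsilon p x y * u.trChi p) ∧
    (∀ p, D.H p =
      dirDeriv D.n u.trUpsilon p + u.etaSq p + u.div₁ u.eta p - u.leafScalar p / 2
        + (u.trChi p - 2 * D.omega p) * u.trUpsilon p) :=
  ⟨HypersurfaceData.isHypersurfaceConnection_conn hD hu,
    HypersurfaceData.FoliationFunction.isLeafLeviCivita_leafConn hD hu,
    HypersurfaceData.FoliationFunction.J_n hD hu,
    fun _ => HypersurfaceData.FoliationFunction.J_tangent hD hu,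
    fun _ => HypersurfaceData.FoliationFunction.Rcon_tangent hD hu,
    HypersurfaceData.FoliationFunction.H_formula hD hu⟩
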